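/- Let $V_6^3$ be the 2-dimensional complex with one vertex and four oriented edges labelled $1,2,3,4$, obtained by gluing three lozenges (each the union of two equilateral triangles along its short diagonal) along their boundaries, where the two positively oriented boundary paths of length two joining the ends of the short diagonal read $12$ and $23$ in the first lozenge, $13$ and $34$ in the second, $14$ and $42$ in the third. Let $\Gamma=\pi_1(V_6^3)=\langle x_1,x_2,x_3,x_4\mid x_1x_2=x_2x_3,\ x_1x_3=x_3x_4,\ x_1x_4=x_4x_2\rangle$, and let $X=X_6^3$ be the universal cover of $V_6^3$, triangulated by cutting every lozenge along its short diagonal: its vertex set is $\Gamma$ and its triangles are the sets $\{g,\,gx_a,\,gx_ax_b\}$ with $g\in\Gamma$ and $(a,b)\in\{(1,2),(2,3),(1,3),(3,4),(1,4),(4,2)\}$. Let $G_6$ be the graph obtained from the incidence graph of the Fano plane (points and lines indexed by $\mathbb Z/7$, with $p$ on $l$ if and only if $p+l\in\{1,2,4\}$) by removing the three edges $\{p,l\}=\{3,1\},\{6,2\},\{5,4\}$. Here, for a group $\Gamma$ acting on a simplicial complex $X$ by automorphisms, freely on the realization and with finite fundamental domain, $(X,\Gamma)$ is a *building with chambers missing*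 if there are a Tits building $X'$, a group $\Gamma'$ of automorphisms of $X'$ acting freely (on the realization) with finite fundamental domain, a simplicial map $\lambda:X\to X'$ and chambers $C_1,\dots,C_n$ ($n\ge 0$) of $X'$ with pairwise distinct $\Gamma'$-orbits such that $\lambda(X)\cap \mathring C_i=\emptyset$ for all $i$, $X'=\lambda(X)\cup\bigcup_i\Gamma'\mathring C_i$, and two points $x,y$ of $X$ are in the same $\Gamma$-orbit if and only if $\lambda(x),\lambda(y)$ are in the same $\Gamma'$-orbit. It is *spherical* if $X$ is finite, $\Gamma$ is trivial and $X'$ can be chosen spherical; it is *non-degenerate* if some apartment of $X'$ contains no missing chamber. The *projective order* of a link $L$ is the number $q\ge 0$ such that $L$ has $2(q^2+q+1)$ vertices, and $q_*(X)$ is the maximum over the links. The *extension invariant* of $(X,\Gamma)$ is the following labelled graph. Its edges of type $0$ are the $\Gamma$-orbits of edges of $X$ lying in at most $q_*(X)$ triangles, labelled by $q_*(X)-v+1$ where $v$ is the number of triangles containing the edge; its vertices are the $\Gamma$-orbits of the ends of these edges; two distinct vertices are joined by an edge of type $1$ if they are represented by two vertices of the link of some vertex of $X$ that are at distance at least $5$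 in this link. **Proposition.** $X_6^3$ is a simply connected simplicial complex, homogeneous of dimension 2 and without boundary, and the countable group $\Gamma$ acts on it by automorphisms, freely, with finite fundamental domain and transitively on vertices. All links of $X_6^3$ are isomorphic to $G_6$ and are spherical buildings with chambers missing; more precisely $G_6$ is homogeneous of dimension 1, has no boundary, and is a non-degenerate spherical building of type $A_2$ and order $2$ with three chambers missing. The extension invariant of $(X_6^3,\Gamma)$ is the disjoint union of three graphs, each consisting of two vertices joined by one edge of type $0$ with label $1$ and by one edge of type $1$. Nevertheless $(X_6^3,\Gamma)$ is not a building with chambers missing. -/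

import Mathlib

universe u v

namespace ChambersMissing

noncomputable section

open scoped Classical

/-! ### Simplicial complexes

Simplicial complexes are abstract simplicial complexes all of whose elements `v : V` are vertices;
faces are non-empty finite sets. -/

/-- `K` and `L` are isomorphic as simplicial complexes. -/
def SimplicialIso {V : Type u} {W : Type v} (K : AbstractSimplicialComplex V)
    (L : AbstractSimplicialComplex W) : Prop :=
  ∃ e : V ≃ W, ∀ s : Finset V, s.map e.toEmbedding ∈ L.faces ↔ s ∈ K.faces

/-- Chambers are the maximal faces. -/
def IsChamber {V : Type u} (K : AbstractSimplicialComplex V) (s : Finset V) : Prop :=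
  Maximal (fun t => t ∈ K.faces) s

/-- `K` is homogeneous of dimension `d`. -/
def IsPureOfDim {V : Type u} (K : AbstractSimplicialComplex V) (d : ℕ) : Prop :=
  (∀ s ∈ K.faces, s.card ≤ d + 1) ∧
    ∀ s ∈ K.faces, ∃ t ∈ K.faces, s ⊆ t ∧ t.card = d + 1

/-- A complex of dimension `d` has no boundary: each face of codimension one lies in
at least two chambers. -/
def HasNoBoundary {V : Type u} (K : AbstractSimplicialComplex V) (d : ℕ) : Prop :=
  ∀ s ∈ K.faces, s.card = d →
    ∃ t t', t ≠ t' ∧ IsChamber K t ∧ IsChamber K t' ∧ s ⊆ t ∧ s ⊆ t'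

/-- The vertices of the link of `x`. -/
abbrev LinkVertex {V : Type u} (K : AbstractSimplicialComplex V) (x : V) : Type u :=
  {y : V // y ≠ x ∧ ({x, y} : Finset V) ∈ K.faces}

/-- The link of the vertex `x`: the sets of vertices distinct from `x` which form a face
together with `x`. -/
def link {V : Type u} (K : AbstractSimplicialComplex V) (x : V) :
    AbstractSimplicialComplex (LinkVertex K x) where
  faces := {s | s.Nonempty ∧ insert x (s.map (Function.Embedding.subtype _)) ∈ K.faces}
  isRelLowerSet_faces := by
    intro s hs
    refine ⟨hs.1, fun t hts ht => ⟨ht, ?_⟩⟩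
    exact (K.isRelLowerSet_faces hs.2).2
      (Finset.insert_subset_insert _ (Finset.map_subset_map.2 hts)) (Finset.insert_nonempty _ _)
  singleton_mem := by
    intro y
    refine ⟨Finset.singleton_nonempty _, ?_⟩
    simpa using y.2.2

/-- The graph formed by the vertices and edges of a complex. -/
def oneSkeleton {V : Type u} (K : AbstractSimplicialComplex V) : SimpleGraph V where
  Adj x y := x ≠ y ∧ ({x, y} : Finset V) ∈ K.faces
  symm := ⟨fun x y h => ⟨h.1.symm, by rw [Finset.pair_comm]; exact h.2⟩⟩
  loopless := ⟨fun _ h => h.1 rfl⟩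

/-- A graph, viewed as a simplicial complex of dimension at most one. -/
def graphComplex {V : Type u} (G : SimpleGraph V) : AbstractSimplicialComplex V where
  faces := {s | s.Nonempty ∧ s.card ≤ 2 ∧ ∀ x ∈ s, ∀ y ∈ s, x ≠ y → G.Adj x y}
  isRelLowerSet_faces := by
    intro s hs
    refine ⟨hs.1, fun t hts ht => ⟨ht, (Finset.card_le_card hts).trans hs.2.1, ?_⟩⟩
    exact fun x hx y hy => hs.2.2 x (hts hx) y (hts hy)
  singleton_mem := by
    intro x
    refine ⟨Finset.singleton_nonempty _, by simp, ?_⟩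
    intro y hy z hz hyz
    rw [Finset.mem_singleton] at hy hz
    exact absurd (hy.trans hz.symm) hyz

/-! ### Connectedness and simple connectedness, through edge paths -/

/-- `l` is an edge path from `x` to `y`: consecutive vertices span a face. -/
def IsEdgePath {V : Type u} (K : AbstractSimplicialComplex V) (x y : V) (l : List V) : Prop :=
  l.IsChain (fun a b => ({a, b} : Finset V) ∈ K.faces) ∧ l.head? = some x ∧ l.getLast? = some y

/-- The elementary homotopies of edge paths. -/
inductive ElementaryHomotopy {V : Type u} (K : AbstractSimplicialComplex V) :
    List V → List V → Prop
  | stutter (p q : List V) (x : V) : ElementaryHomotopy K (p ++ x :: x :: q) (p ++ x :: q)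
  | triangle (p q : List V) (x y z : V) (h : ({x, y, z} : Finset V) ∈ K.faces) :
      ElementaryHomotopy K (p ++ x :: y :: z :: q) (p ++ x :: z :: q)

/-- `K` is non-empty, connected, and each closed edge path is homotopic to a constant one. -/
def IsSimplyConnectedComplex {V : Type u} (K : AbstractSimplicialComplex V) : Prop :=
  Nonempty V ∧ (∀ x y, ∃ l, IsEdgePath K x y l) ∧
    ∀ x l, IsEdgePath K x x l → Relation.EqvGen (ElementaryHomotopy K) l [x]

/-! ### Points of the realization and group actions -/

/-- Points of the geometric realization of `K`, in barycentric coordinates. -/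
def IsPoint {V : Type u} (K : AbstractSimplicialComplex V) (p : V →₀ ℝ) : Prop :=
  (∀ x, 0 ≤ p x) ∧ (p.sum fun _ t => t) = 1 ∧ p.support ∈ K.faces

/-- The affine extension to the realization of a map between vertices. -/
def pushPoint {V : Type u} {W : Type v} (f : V → W) (p : V →₀ ℝ) : W →₀ ℝ :=
  Finsupp.mapDomain f p

/-- The translate of a set of vertices. -/
def translateFace {Γ : Type u} {V : Type v} [Group Γ] [MulAction Γ V] (g : Γ) (s : Finset V) :
    Finset V :=
  s.map (MulAction.toPerm g).toEmbedding

/-- `Γ` acts on `K` by automorphisms, freely (on the realization), with finite fundamental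
domain. -/
structure IsFreeCofiniteAction {V : Type u} (K : AbstractSimplicialComplex V) (Γ : Type v)
    [Group Γ] [MulAction Γ V] : Prop where
  simplicial : ∀ (g : Γ), ∀ s ∈ K.faces, translateFace g s ∈ K.faces
  free : ∀ (g : Γ) (p : V →₀ ℝ), IsPoint K p → pushPoint (fun x => g • x) p = p → g = 1
  cofinite : ∃ F : Set (Finset V), F.Finite ∧ F ⊆ K.faces ∧
    ∀ s ∈ K.faces, ∃ t ∈ F, ∃ g : Γ, translateFace g t = s

/-- Two points lie in the same `Γ`-orbit. -/
def SameOrbit {V : Type u} (Γ : Type v) [Group Γ] [MulAction Γ V] (p q : V →₀ ℝ) : Prop :=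
  ∃ g : Γ, pushPoint (fun x => g • x) p = q

/-! ### Coxeter complexes and buildings -/

/-- The standard maximal parabolic subgroup generated by the simple reflections other than `i`. -/
def maxParabolic {B : Type} (M : CoxeterMatrix B) (i : B) : Subgroup M.Group :=
  Subgroup.closure (M.simple '' {j | j ≠ i})

/-- The vertices of the Coxeter complex: the left cosets of the standard maximal parabolic
subgroups. -/
abbrev CoxeterVertex {B : Type} (M : CoxeterMatrix B) : Type :=
  Σ i : B, M.Group ⧸ maxParabolic M i

/-- The Coxeter complex: a face is a non-empty finite set of cosets with a common element `w`, i.e.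
a set of vertices of the chamber `w`. -/
def coxeterComplex {B : Type} (M : CoxeterMatrix B) :
    AbstractSimplicialComplex (CoxeterVertex M) where
  faces := {s | s.Nonempty ∧ ∃ w : M.Group, ∀ c ∈ s, c.2 = (w : M.Group ⧸ maxParabolic M c.1)}
  isRelLowerSet_faces := by
    rintro s ⟨hs, w, hw⟩
    exact ⟨hs, fun t hts ht => ⟨ht, w, fun c hc => hw c (hts hc)⟩⟩
  singleton_mem := by
    rintro ⟨i, c⟩
    obtain ⟨w, rfl⟩ := QuotientGroup.mk_surjective c
    refine ⟨Finset.singleton_nonempty _, w, ?_⟩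
    intro d hd
    rw [Finset.mem_singleton] at hd
    subst hd
    rfl

/-- `A` is a system of apartments making `X` a (not necessarily thick) Tits building
of type `M`. -/
structure IsApartmentSystem {B : Type} (M : CoxeterMatrix B) {V : Type u}
    (X : AbstractSimplicialComplex V) (A : Set (PreAbstractSimplicialComplex V)) : Prop where
  nonempty : A.Nonempty
  subcomplex : ∀ S ∈ A, S.faces ⊆ X.faces
  coxeter : ∀ S ∈ A, ∃ f : CoxeterVertex M ↪ V,
    ∀ s : Finset V, s ∈ S.faces ↔ ∃ t ∈ (coxeterComplex M).faces, t.map f = s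
  common : ∀ s ∈ X.faces, ∀ t ∈ X.faces, ∃ S ∈ A, s ∈ S.faces ∧ t ∈ S.faces
  /-- Two apartments containing `s` and `t` are isomorphic by a map `φ` fixing `s` and `t`
  pointwise. -/
  exchange : ∀ S ∈ A, ∀ S' ∈ A, ∀ s t : Finset V,
    s ∈ S.faces → t ∈ S.faces → s ∈ S'.faces → t ∈ S'.faces →
    ∃ φ : V → V, Set.InjOn φ {x | {x} ∈ S.faces} ∧
      (∀ r : Finset V, r ∈ S'.faces ↔ ∃ r₀ ∈ S.faces, r₀.image φ = r) ∧
      (∀ x ∈ s, φ x = x) ∧ (∀ x ∈ t, φ x = x)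

/-- `X` is a Tits building (of finite rank). -/
def IsBuilding {V : Type u} (X : AbstractSimplicialComplex V) : Prop :=
  ∃ (B : Type) (_ : Finite B) (M : CoxeterMatrix B) (A : Set (PreAbstractSimplicialComplex V)),
    IsApartmentSystem M X A

/-- `X` is a spherical Tits building. -/
def IsSphericalBuilding {V : Type u} (X : AbstractSimplicialComplex V) : Prop :=
  ∃ (B : Type) (_ : Finite B) (M : CoxeterMatrix B) (A : Set (PreAbstractSimplicialComplex V)),
    Finite M.Group ∧ IsApartmentSystem M X A

/-! ### Buildings with chambers missing -/

/-- The conditions on `f : X → X'` and on the removed chambers `C 0, …, C (n - 1)` of `X'`.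
The map `f` on vertices induces the map `pushPoint f` on realizations, whose image is the union of
the open simplices `f(s)`, for `s` a face of `X`; so it is disjoint from the open chamber `C i` if
and only if no face of `X` is mapped onto `C i`. -/
structure IsExtension {V V' Γ Γ' : Type*} [Group Γ] [MulAction Γ V] [Group Γ'] [MulAction Γ' V']
    (X : AbstractSimplicialComplex V) (X' : AbstractSimplicialComplex V')
    (f : V → V') {n : ℕ} (C : Fin n → Finset V') : Prop where
  simplicial : ∀ s ∈ X.faces, s.image f ∈ X'.faces
  chamber : ∀ i, IsChamber X' (C i)
  distinct : ∀ i j, i ≠ j → ∀ g : Γ', translateFace g (C i) ≠ C j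
  missing : ∀ i, ∀ s ∈ X.faces, s.image f ≠ C i
  cover : ∀ t ∈ X'.faces, (∃ s ∈ X.faces, s.image f = t) ∨ ∃ i, ∃ g : Γ', translateFace g (C i) = t
  orbits : ∀ p q : V →₀ ℝ, IsPoint X p → IsPoint X q →
    (SameOrbit Γ p q ↔ SameOrbit Γ' (pushPoint f p) (pushPoint f q))

/-- `(X, Γ)` is a building with chambers missing, possibly with boundary. -/
def IsBuildingWithChambersMissing {V : Type} (X : AbstractSimplicialComplex V) (Γ : Type) [Group Γ]
    [MulAction Γ V] : Prop :=
  ∃ (V' : Type u) (X' : AbstractSimplicialComplex V') (Γ' : Type u) (_ : Group Γ')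
    (_ : MulAction Γ' V') (f : V → V') (n : ℕ) (C : Fin n → Finset V'),
    IsBuilding X' ∧ IsFreeCofiniteAction X' Γ' ∧ IsExtension (Γ := Γ) (Γ' := Γ') X X' f C

/-- The finite complex `G`, with the action of the trivial group, is a spherical building with
chambers missing. -/
def IsSphericalBuildingWithChambersMissing {V : Type} (G : AbstractSimplicialComplex V) : Prop :=
  Finite V ∧
  ∃ (V' : Type) (X' : AbstractSimplicialComplex V') (Γ' : Type) (_ : Group Γ')
    (_ : MulAction Γ' V') (f : V → V') (n : ℕ) (C : Fin n → Finset V'),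
    IsSphericalBuilding X' ∧ IsFreeCofiniteAction X' Γ' ∧
      IsExtension (Γ := (⊥ : Subgroup (Equiv.Perm V))) (Γ' := Γ') G X' f C

/-- The finite graph `G` is a non-degenerate spherical building of type `A₂` and order `q` with `n`
chambers missing: it extends to a building of type `A₂` all of whose vertices lie in `q + 1`
chambers, with `n` chambers missing, and some apartment contains no missing chamber. -/
def IsA₂BuildingWithChambersMissing {V : Type} (G : AbstractSimplicialComplex V) (q n : ℕ) : Prop :=
  Finite V ∧
  ∃ (V' : Type) (X' : AbstractSimplicialComplex V') (A : Set (PreAbstractSimplicialComplex V'))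
    (Γ' : Type) (_ : Group Γ') (_ : MulAction Γ' V') (f : V → V') (C : Fin n → Finset V'),
    IsApartmentSystem (CoxeterMatrix.A 2) X' A ∧
      (∀ x, Nat.card {t : Finset V' // IsChamber X' t ∧ x ∈ t} = q + 1) ∧
      IsFreeCofiniteAction X' Γ' ∧
      IsExtension (Γ := (⊥ : Subgroup (Equiv.Perm V))) (Γ' := Γ') G X' f C ∧
      ∃ S ∈ A, ∀ t ∈ S.faces, ∃ s ∈ G.faces, s.image f = t

/-! ### The extension invariant -/

/-- A labelled graph with two types of edges. The edges of type `0` form a type `E₀` with an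
incidence relation `Inc x e` (`x` is an end of `e`) and carry labels; the edges of type `1` form a
simple graph. -/
structure LabelledGraph where
  V : Type
  E₀ : Type
  Inc : V → E₀ → Prop
  label : E₀ → ℝ
  E₁ : SimpleGraph V

/-- Isomorphism of labelled graphs. -/
def LabelledGraph.Iso (O O' : LabelledGraph) : Prop :=
  ∃ (a : O.V ≃ O'.V) (b : O.E₀ ≃ O'.E₀),
    (∀ x e, O'.Inc (a x) (b e) ↔ O.Inc x e) ∧ (∀ e, O'.label (b e) = O.label e) ∧
      ∀ x y, O'.E₁.Adj (a x) (a y) ↔ O.E₁.Adj x y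

/-- The projective order of the link of `x`: the number `q` with `2 (q² + q + 1)` equal to the
number of vertices of the link. -/
def linkOrder {V : Type} (K : AbstractSimplicialComplex V) (x : V) : ℝ :=
  (√(2 * (Nat.card (LinkVertex K x) : ℝ) - 3) - 1) / 2

/-- The projective order of `K`: the largest projective order of a link. -/
def projectiveOrder {V : Type} (K : AbstractSimplicialComplex V) : ℝ :=
  ⨆ x, linkOrder K x

/-- The number of chambers which contain `e`. -/
def valency {V : Type} (K : AbstractSimplicialComplex V) (e : Finset V) : ℕ :=
  Nat.card {t : Finset V // IsChamber K t ∧ e ⊆ t}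

/-- `e` is an edge incident to at most `projectiveOrder K` chambers. -/
def IsDeficientEdge {V : Type} (K : AbstractSimplicialComplex V) (e : Finset V) : Prop :=
  e ∈ K.faces ∧ e.card = 2 ∧ (valency K e : ℝ) ≤ projectiveOrder K

/-- The deficient edges. -/
abbrev DeficientEdge {V : Type} (K : AbstractSimplicialComplex V) : Type :=
  {e : Finset V // IsDeficientEdge K e}

/-- The deficient edges with a distinguished end: `(x, y)` stands for the end `x` of the edge
`{x, y}`. -/
abbrev DeficientEnd {V : Type} (K : AbstractSimplicialComplex V) : Type :=
  {d : V × V // IsDeficientEdge K {d.1, d.2}}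

/-- The edge to which an end belongs. -/
def DeficientEnd.edge {V : Type} {K : AbstractSimplicialComplex V} (d : DeficientEnd K) :
    DeficientEdge K :=
  ⟨{d.1.1, d.1.2}, d.2⟩

/-- The extension invariant of `(K, Γ)`. Its edges of type `0` are the orbits of deficient edges,
its vertices are the orbits of the ends of deficient edges, the label of the orbit of `e` is
`projectiveOrder K - valency K e + 1`, and two distinct vertices are joined by an edge of type `1`
if they are represented by vertices `y`, `z` of the link of a vertex `x` at distance
at least `5` in this link. -/
def extensionInvariant {V : Type} (K : AbstractSimplicialComplex V) (Γ : Type) [Group Γ]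
    [MulAction Γ V] : LabelledGraph where
  V := Quot fun d d' : DeficientEnd K => ∃ g : Γ, (g • d.1.1, g • d.1.2) = d'.1
  E₀ := Quot fun e e' : DeficientEdge K => ∃ g : Γ, translateFace g e.1 = e'.1
  Inc o ε := ∃ d : DeficientEnd K, o = Quot.mk _ d ∧ ε = Quot.mk _ d.edge
  label ε := projectiveOrder K - valency K ε.out.1 + 1
  E₁ :=
    { Adj := fun o o' => o ≠ o' ∧ ∃ (x : V) (y z : LinkVertex K x)
        (hy : IsDeficientEdge K {x, y.1}) (hz : IsDeficientEdge K {x, z.1}),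
        o = Quot.mk _ ⟨(x, y.1), hy⟩ ∧ o' = Quot.mk _ ⟨(x, z.1), hz⟩ ∧
          5 ≤ (oneSkeleton (link K x)).edist y z
      symm := ⟨by
        rintro o o' ⟨hne, x, y, z, hy, hz, ho, ho', h⟩
        exact ⟨hne.symm, x, z, y, hz, hy, ho', ho, by rwa [SimpleGraph.edist_comm]⟩⟩
      loopless := ⟨fun _ h => h.1 rfl⟩ }

/-- Three disjoint copies of the graph with two vertices, joined by one edge of type `0` and
label `1` and by one edge of type `1`. -/
def threeDigons : LabelledGraph where
  V := Fin 3 × Bool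
  E₀ := Fin 3
  Inc x e := x.1 = e
  label _ := 1
  E₁ :=
    { Adj := fun x y => x.1 = y.1 ∧ x.2 ≠ y.2
      symm := ⟨fun _ _ h => ⟨h.1.symm, h.2.symm⟩⟩
      loopless := ⟨fun _ h => h.2 rfl⟩ }

/-! ### The graph `G₆` -/

/-- The incidence graph of the Fano plane: points `inl p` and lines `inr l` are indexed by the
integers modulo `7`, and `p` lies on `l` if `p + l` is `1`, `2` or `4`. -/
def fanoGraph : SimpleGraph (ZMod 7 ⊕ ZMod 7) where
  Adj
    | .inl p, .inr l => p + l = 1 ∨ p + l = 2 ∨ p + l = 4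
    | .inr l, .inl p => p + l = 1 ∨ p + l = 2 ∨ p + l = 4
    | _, _ => False
  symm := ⟨by rintro (p | p) (l | l) h <;> exact h⟩
  loopless := ⟨by rintro (p | p) h <;> exact h⟩

/-- The graph `G₆`: the Fano graph with three edges removed. The removed edges are pairwise disjoint
and at distance `2`; in what remains, the maximal non-branching paths with two edges form the
disjoint union of a circle with six edges and a tripod, while the non-branching paths with a single
edge form a tripod, hence contain no apartment. -/
def G₆Graph : SimpleGraph (ZMod 7 ⊕ ZMod 7) :=
  fanoGraph.deleteEdges {s(.inl 3, .inr 1), s(.inl 6, .inr 2), s(.inl 5, .inr 4)}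

/-- `G₆`, as a simplicial complex. -/
def G₆ : AbstractSimplicialComplex (ZMod 7 ⊕ ZMod 7) :=
  graphComplex G₆Graph

/-! ### The complex `X₆³` -/

/-- The three lozenges of `V₆³`, with edges labelled by `0, 1, 2, 3`. The boundary of a lozenge
consists of two positively oriented paths `(a, b)` and `(c, d)` of length two between the ends of
the short diagonal. -/
def lozenge : Fin 3 → (Fin 4 × Fin 4) × (Fin 4 × Fin 4)
  | 0 => ((0, 1), (1, 2))
  | 1 => ((0, 2), (2, 3))
  | 2 => ((0, 3), (3, 1))

/-- The group of `V₆³`, a complex with a single vertex: generated by the four edges, with a relation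
`a b = c d` for each lozenge. -/
abbrev Γ₆₃ : Type :=
  PresentedGroup {r : FreeGroup (Fin 4) | ∃ i : Fin 3, r =
    (FreeGroup.of (lozenge i).1.1 * FreeGroup.of (lozenge i).1.2) *
      (FreeGroup.of (lozenge i).2.1 * FreeGroup.of (lozenge i).2.2)⁻¹}

/-- The generator of `Γ₆₃` given by an edge of `V₆³`. -/
def gen (a : Fin 4) : Γ₆₃ :=
  PresentedGroup.of a

/-- The two triangles `(a, b)` and `(c, d)` into which each lozenge is cut by its short diagonal,
given by their pairs of consecutive sides other than the diagonal. -/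
def triangles : Set (Fin 4 × Fin 4) :=
  {t | ∃ i : Fin 3, t = (lozenge i).1 ∨ t = (lozenge i).2}

/-- The universal cover `X₆³` of `V₆³`, each lozenge being cut into two triangles by its short
diagonal. Its vertices are the elements of `Γ₆₃`, and its chambers are the lifts
`{g, g a, g a b}` of the triangles `(a, b)`. -/
def X₆₃ : AbstractSimplicialComplex Γ₆₃ where
  faces := {s | s.Nonempty ∧ ∃ g : Γ₆₃, ∃ t ∈ triangles,
    s ⊆ {g, g * gen t.1, g * gen t.1 * gen t.2}}
  isRelLowerSet_faces := by
    rintro s ⟨hs, g, t, ht, h⟩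
    exact ⟨hs, fun r hrs hr => ⟨hr, g, t, ht, hrs.trans h⟩⟩
  singleton_mem := by
    intro g
    exact ⟨Finset.singleton_nonempty _, g, _, ⟨0, Or.inl rfl⟩, by simp⟩

end

end ChambersMissing

open ChambersMissing

/-! The local statements are finite computations. The fourteen neighbours of `1` in `X₆₃` are the
generators, the diagonals and their inverses. They are labelled by the vertices of the Fano graph so
that two of them span a triangle with `1` exactly when their labels are adjacent in `G₆`
(`triple_mem_faces_iff`). The degree and a homomorphism to permutations keep these neighbours
distinct. Simple connectedness is a monodromy argument: the group acts on homotopy classes of paths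
by prolongation, so the class of an edge path depends only on its ends (`IsEdgePath.mk_eq`). The
Fano plane itself is the building extending each link.

The three removed edges of `G₆` join a diagonal to its inverse. This determines the extension
invariant, and it is also the obstruction. Suppose that a building `X'` with a free action extends
`X₆₃` through `f`. The orbit condition, tested on asymmetric points of edges, makes `f` injective on
the neighbours of `1` and equivariant for a homomorphism `φ` (`IsExtension.exists_hom`). Faces of
`X'` smaller than a chamber come from `X₆₃`. So `X'` has rank three, since `G₆` has no triangles,
and the link of `f 1` has the same vertices as `G₆` but possibly more edges.

Retraction onto apartments shows that this link is a generalized `m`-gon, in the sense of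
`IsPolygonal`. This needs the rank two residues of an arbitrary Coxeter complex to be genuine
circuits of length `2 m` or lines, which is proved with the geometric representation. A hexagon that
survives in `G₆` forces `m = 2` or `m = 3` (`IsPolygonal.eq_two_or_three`). For `m = 2` the link is
complete bipartite; for `m = 3` the added edges are exactly the removed ones.

Added edges are corners of missing triangles, and passing to the next corner of a triangle permutes
them with order dividing three. For `m = 2` there are 31 added edges, so one of them is fixed; for
`m = 3` the edge from a diagonal to its inverse is fixed. A fixed corner gives an element `a = φ (nb
z)` with `a ^ 2 = a⁻¹` that rotates a triangle of `X'`. It fixes the centre, so freeness on the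
realization gives `a = 1`, although `a` moves `f 1` to a different vertex. -/

namespace ChambersMissing

noncomputable section

open scoped Classical

/-! ### The geometric representation of a Coxeter group -/

section Rotation

variable {E : Type*} [AddCommGroup E] [Module ℝ E]

/-- The reflection `v ↦ v - φ v • a`. -/
def reflectionMap (φ : E →ₗ[ℝ] ℝ) (a : E) : Module.End ℝ E :=
  LinearMap.id - φ.smulRight a

lemma reflectionMap_apply (φ : E →ₗ[ℝ] ℝ) (a v : E) : reflectionMap φ a v = v - φ v • a := rfl

variable {φ ψ : E →ₗ[ℝ] ℝ} {a b : E} {θ : ℝ}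

/-- On the span of `a` and `b` the product acts as a rotation by `2 * θ`; the coefficients follow
the sine recurrences `e₁` to `e₄`. The factor `sin θ` on the left avoids a division. -/
lemma rotation_pow_apply (h₁ : φ a = 2) (h₂ : ψ b = 2) (h₃ : φ b = -2 * Real.cos θ)
    (h₄ : ψ a = -2 * Real.cos θ) (l : ℕ) :
    Real.sin θ • ((reflectionMap φ a * reflectionMap ψ b) ^ l) a =
      Real.sin ((2 * l + 1) * θ) • a + Real.sin (2 * l * θ) • b ∧
    Real.sin θ • ((reflectionMap φ a * reflectionMap ψ b) ^ l) b =
      -Real.sin (2 * l * θ) • a - Real.sin ((2 * l - 1) * θ) • b := by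
  have ha : (reflectionMap φ a * reflectionMap ψ b) a =
      (4 * Real.cos θ ^ 2 - 1) • a + (2 * Real.cos θ) • b := by
    simp only [Module.End.mul_apply, reflectionMap_apply, map_sub, map_smul, h₁, h₃, h₄]
    module
  have hb : (reflectionMap φ a * reflectionMap ψ b) b = -(2 * Real.cos θ) • a - b := by
    simp only [Module.End.mul_apply, reflectionMap_apply, map_sub, map_smul, h₂, h₃]
    module
  induction l with
  | zero => simp
  | succ l ih =>
    obtain ⟨iha, ihb⟩ := ih
    have e₁ : Real.sin ((2 * (l + 1 : ℕ) + 1) * θ) =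
        (4 * Real.cos θ ^ 2 - 1) * Real.sin ((2 * l + 1) * θ) -
          2 * Real.cos θ * Real.sin (2 * l * θ) := by
      have h : (2 * ((l + 1 : ℕ) : ℝ) + 1) * θ = (2 * l * θ + 2 * θ) + θ := by push_cast; ring
      have h' : (2 * (l : ℝ) + 1) * θ = 2 * l * θ + θ := by ring
      rw [h, h', Real.sin_add, Real.sin_add _ (2 * θ), Real.cos_add _ (2 * θ), Real.sin_add _ θ,
        Real.sin_two_mul, Real.cos_two_mul]
      linear_combination (-2 * Real.sin (2 * l * θ) * Real.cos θ) * Real.sin_sq_add_cos_sq θ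
    have e₂ : Real.sin (2 * (l + 1 : ℕ) * θ) =
        2 * Real.cos θ * Real.sin ((2 * l + 1) * θ) - Real.sin (2 * l * θ) := by
      have h : 2 * ((l + 1 : ℕ) : ℝ) * θ = 2 * l * θ + 2 * θ := by push_cast; ring
      have h' : (2 * (l : ℝ) + 1) * θ = 2 * l * θ + θ := by ring
      rw [h, h', Real.sin_add, Real.sin_add, Real.sin_two_mul, Real.cos_two_mul]
      ring
    have e₃ : Real.sin ((2 * (l + 1 : ℕ) - 1) * θ) =
        2 * Real.cos θ * Real.sin (2 * l * θ) - Real.sin ((2 * l - 1) * θ) := by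
      have h : (2 * ((l + 1 : ℕ) : ℝ) - 1) * θ = 2 * l * θ + θ := by push_cast; ring
      have h' : (2 * (l : ℝ) - 1) * θ = 2 * l * θ - θ := by ring
      rw [h, h', Real.sin_add, Real.sin_sub]
      ring
    have e₄ : Real.sin ((2 * l + 1) * θ) =
        2 * Real.cos θ * Real.sin (2 * l * θ) - Real.sin ((2 * l - 1) * θ) := by
      rw [← e₃]; congr 1; push_cast; ring
    constructor
    · rw [pow_succ', Module.End.mul_apply, ← map_smul, iha, map_add, map_smul, map_smul, ha, hb,
        e₁, e₂]
      module
    · rw [pow_succ', Module.End.mul_apply, ← map_smul, ihb, map_sub, map_smul, map_smul, ha, hb,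
        e₂, e₃, e₄]
      module

/-- A full turn fixes `a` and `b`, and the common kernel of `φ` and `ψ` is fixed from the start.
Together they span, because the Gram determinant `4 * sin θ ^ 2` is not zero. -/
lemma rotation_pow_eq_one (h₁ : φ a = 2) (h₂ : ψ b = 2) (h₃ : φ b = -2 * Real.cos θ)
    (h₄ : ψ a = -2 * Real.cos θ) (hθ : Real.sin θ ≠ 0) {m : ℕ} (hm : m * θ = Real.pi) :
    (reflectionMap φ a * reflectionMap ψ b) ^ m = 1 := by
  obtain ⟨ha, hb⟩ := rotation_pow_apply h₁ h₂ h₃ h₄ m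
  have s₁ : Real.sin ((2 * m + 1) * θ) = Real.sin θ := by
    rw [show (2 * m + 1) * θ = θ + 2 * Real.pi by rw [← hm]; ring, Real.sin_add_two_pi]
  have s₂ : Real.sin (2 * m * θ) = 0 := by
    rw [show 2 * m * θ = 2 * Real.pi by rw [← hm]; ring, Real.sin_two_pi]
  have s₃ : Real.sin ((2 * m - 1) * θ) = -Real.sin θ := by
    rw [show (2 * m - 1) * θ = -θ + 2 * Real.pi by rw [← hm]; ring, Real.sin_add_two_pi,
      Real.sin_neg]
  rw [s₁, s₂, zero_smul, add_zero] at ha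
  rw [s₂, s₃, neg_zero, zero_smul, zero_sub, neg_smul, neg_neg] at hb
  replace ha := smul_right_injective E hθ ha
  replace hb := smul_right_injective E hθ hb
  ext v
  have hs : Real.sin θ ^ 2 ≠ 0 := pow_ne_zero 2 hθ
  have hc := Real.sin_sq_add_cos_sq θ
  -- The coefficients solve the linear system `φ z = ψ z = 0` for the vector `z` below.
  set α := (φ v + Real.cos θ * ψ v) / (2 * Real.sin θ ^ 2) with hα
  set β := (ψ v + Real.cos θ * φ v) / (2 * Real.sin θ ^ 2) with hβ
  set z := v - α • a - β • b with hz
  have hφ : φ z = 0 := by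
    simp only [hz, map_sub, map_smul, h₁, h₃, smul_eq_mul, hα, hβ]
    field_simp
    linear_combination (φ v) * hc
  have hψ : ψ z = 0 := by
    simp only [hz, map_sub, map_smul, h₂, h₄, smul_eq_mul, hα, hβ]
    field_simp
    linear_combination (ψ v) * hc
  have hfix : ∀ l : ℕ, ((reflectionMap φ a * reflectionMap ψ b) ^ l) z = z := by
    intro l
    induction l with
    | zero => simp
    | succ l ih =>
      rw [pow_succ', Module.End.mul_apply, ih, Module.End.mul_apply]
      simp [reflectionMap_apply, hφ, hψ]
  have hv : v = z + α • a + β • b := by rw [hz]; abel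
  rw [hv]
  simp only [map_add, map_smul, hfix, ha, hb, Module.End.one_apply]

end Rotation

section Geometric

variable {B : Type} (M : CoxeterMatrix B)

/-- The angle between the mirrors of two simple reflections. When the product of the reflections has
infinite order, any angle which is not a rational multiple of `π` will do. -/
def mirrorAngle (i j : B) : ℝ :=
  if M i j = 0 then 1 else Real.pi / M i j

lemma mirrorAngle_self (i : B) : mirrorAngle M i i = Real.pi := by
  simp [mirrorAngle]

lemma mirrorAngle_comm (i j : B) : mirrorAngle M i j = mirrorAngle M j i := by
  simp [mirrorAngle, M.symmetric i j]

lemma sin_mirrorAngle_ne_zero {i j : B} (h : i ≠ j) : Real.sin (mirrorAngle M i j) ≠ 0 := by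
  have hpi := Real.pi_gt_three
  apply ne_of_gt
  apply Real.sin_pos_of_pos_of_lt_pi
  · unfold mirrorAngle
    split_ifs with h0
    · exact one_pos
    · positivity
  · unfold mirrorAngle
    split_ifs with h0
    · linarith
    · have h1 : M i j ≠ 1 := M.off_diagonal i j h
      have : (1 : ℝ) < M i j := by exact_mod_cast (by omega : 1 < M i j)
      exact div_lt_self (by linarith) this

/-- The cosine is `1` only at multiples of `2 * π`. With angle `π / M i j` this is divisibility.
With angle `1`, used for infinite order, a nonzero `l` would make `π` rational. -/
lemma dvd_of_cos_mirrorAngle_eq_one {i j : B} {l : ℕ}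
    (h : Real.cos (2 * l * mirrorAngle M i j) = 1) : M i j ∣ l := by
  obtain ⟨n, hn⟩ := (Real.cos_eq_one_iff _).1 h
  have hpi := Real.pi_pos
  unfold mirrorAngle at hn
  split_ifs at hn with h0
  · rw [h0, zero_dvd_iff]
    by_contra hl
    have hl' : (l : ℝ) ≠ 0 := by exact_mod_cast hl
    have hn0 : (n : ℝ) ≠ 0 := by
      intro h'
      rw [h'] at hn
      apply hl'
      linarith
    refine irrational_pi ⟨(l : ℚ) / n, ?_⟩
    push_cast
    field_simp
    linarith
  · have hm : (M i j : ℝ) ≠ 0 := by exact_mod_cast h0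
    have : (l : ℝ) = n * M i j := by
      field_simp at hn
      linarith
    have h' : (l : ℤ) = n * (M i j : ℤ) := by exact_mod_cast this
    exact Int.natCast_dvd_natCast.1 ⟨n, by rw [h', mul_comm]⟩

variable [Fintype B]

/-- The linear form defining the mirror of a simple reflection. -/
def mirrorForm (i : B) : (B → ℝ) →ₗ[ℝ] ℝ :=
  ∑ j, (-2 * Real.cos (mirrorAngle M i j)) • LinearMap.proj j

lemma mirrorForm_single (i j : B) :
    mirrorForm M i (Pi.single j 1) = -2 * Real.cos (mirrorAngle M i j) := by
  simp [mirrorForm, Pi.single_apply]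

lemma mirrorForm_single_self (i : B) : mirrorForm M i (Pi.single i 1) = 2 := by
  simp [mirrorForm_single, mirrorAngle_self]

/-- The reflection of the geometric representation given by a simple reflection. -/
def simpleReflection (i : B) : Module.End ℝ (B → ℝ) :=
  reflectionMap (mirrorForm M i) (Pi.single i 1)

lemma simpleReflection_apply_of_ne {i j : B} (h : i ≠ j) (v : B → ℝ) :
    simpleReflection M i v j = v j := by
  simp [simpleReflection, reflectionMap_apply, h.symm]

lemma isLiftable_simpleReflection : M.IsLiftable (simpleReflection M) := by
  intro i j
  by_cases hij : i = j
  · subst hij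
    rw [M.diagonal, pow_one]
    refine LinearMap.ext fun v => ?_
    have h := mirrorForm_single_self M i
    simp only [Module.End.mul_apply, simpleReflection, reflectionMap_apply, map_sub, map_smul, h,
      Module.End.one_apply]
    module
  · by_cases h0 : M i j = 0
    · rw [h0, pow_zero]
    · refine rotation_pow_eq_one (θ := mirrorAngle M i j) (mirrorForm_single_self M i)
        (mirrorForm_single_self M j) (mirrorForm_single M i j) ?_
        (sin_mirrorAngle_ne_zero M hij) ?_
      · rw [mirrorForm_single, mirrorAngle_comm]
      · have : (M i j : ℝ) ≠ 0 := by exact_mod_cast h0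
        rw [mirrorAngle, if_neg h0]
        field_simp

/-- The geometric representation. -/
def geometricRep : M.Group →* Module.End ℝ (B → ℝ) :=
  M.toCoxeterSystem.lift ⟨simpleReflection M, isLiftable_simpleReflection M⟩

lemma geometricRep_simple (i : B) : geometricRep M (M.simple i) = simpleReflection M i :=
  M.toCoxeterSystem.lift_apply_simple (isLiftable_simpleReflection M) i

/-- A simple reflection changes only its own coordinate, and `j` is the one reflection left out of
this parabolic. -/
lemma geometricRep_apply_of_mem {j : B} {w : M.Group} (hw : w ∈ maxParabolic M j) (v : B → ℝ) :
    geometricRep M w v j = v j := by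
  induction hw using Subgroup.closure_induction generalizing v with
  | mem x hx =>
    obtain ⟨i, hi, rfl⟩ := hx
    rw [geometricRep_simple, simpleReflection_apply_of_ne M hi]
  | one => simp
  | mul x y _ _ hx hy => rw [map_mul, Module.End.mul_apply, hx, hy]
  | inv x _ hx =>
    rw [← hx (geometricRep M x⁻¹ v), ← Module.End.mul_apply, ← map_mul, mul_inv_cancel, map_one,
      Module.End.one_apply]

/-- This prevents the residues from collapsing. Comparing one unchanged coordinate of the images of
both basis vectors yields `sin (2 * l * θ) = 0` and then `cos (2 * l * θ) = 1`. -/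
lemma dvd_of_zpow_mem_maxParabolic {j k : B} (hjk : j ≠ k) {l : ℤ}
    (h : (M.simple j * M.simple k) ^ l ∈ maxParabolic M j ∨
      (M.simple j * M.simple k) ^ l ∈ maxParabolic M k) : (M j k : ℤ) ∣ l := by
  have key : ∀ l : ℕ, ((M.simple j * M.simple k) ^ l ∈ maxParabolic M j ∨
      (M.simple j * M.simple k) ^ l ∈ maxParabolic M k) → M j k ∣ l := by
    intro l hl
    have hs := sin_mirrorAngle_ne_zero M hjk
    obtain ⟨ha, hb⟩ := rotation_pow_apply (θ := mirrorAngle M j k) (mirrorForm_single_self M j)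
      (mirrorForm_single_self M k) (mirrorForm_single M j k)
      (by rw [mirrorForm_single, mirrorAngle_comm]) l
    have hr : (reflectionMap (mirrorForm M j) (Pi.single j 1) *
        reflectionMap (mirrorForm M k) (Pi.single k 1)) ^ l =
          geometricRep M ((M.simple j * M.simple k) ^ l) := by
      rw [map_pow, map_mul, geometricRep_simple, geometricRep_simple]
      rfl
    rw [hr] at ha hb
    apply dvd_of_cos_mirrorAngle_eq_one
    set θ := mirrorAngle M j k
    apply mul_left_cancel₀ hs
    rcases hl with hl | hl
    · have ha' := congrFun ha j
      have hb' := congrFun hb j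
      simp only [Pi.smul_apply, Pi.add_apply, Pi.sub_apply, smul_eq_mul,
        geometricRep_apply_of_mem M hl, Pi.single_eq_same, Pi.single_eq_of_ne hjk, mul_one,
        mul_zero, add_zero, sub_zero] at ha' hb'
      rw [show (2 * (l : ℝ) + 1) * θ = 2 * l * θ + θ by ring, Real.sin_add] at ha'
      linear_combination -ha' - Real.cos θ * hb'
    · have ha' := congrFun ha k
      have hb' := congrFun hb k
      simp only [Pi.smul_apply, Pi.add_apply, Pi.sub_apply, smul_eq_mul,
        geometricRep_apply_of_mem M hl, Pi.single_eq_same, Pi.single_eq_of_ne hjk.symm, mul_one,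
        mul_zero, zero_add, zero_sub] at ha' hb'
      rw [show (2 * (l : ℝ) - 1) * θ = 2 * l * θ - θ by ring, Real.sin_sub] at hb'
      linear_combination -hb' - Real.cos θ * ha'
  obtain ⟨n, rfl | rfl⟩ := l.eq_nat_or_neg
  · rw [zpow_natCast] at h
    exact Int.natCast_dvd_natCast.2 (key n h)
  · rw [zpow_neg, zpow_natCast, inv_mem_iff, inv_mem_iff] at h
    exact (Int.natCast_dvd_natCast.2 (key n h)).neg_right

end Geometric

/-! ### The star of a face of codimension two of a Coxeter complex -/

section Cycle

variable {B : Type} (M : CoxeterMatrix B)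

lemma simple_mul_self (i : B) : M.simple i * M.simple i = 1 := by
  simpa using M.toCoxeterSystem.simple_mul_simple_self i

lemma simple_mem_maxParabolic {i j : B} (h : i ≠ j) : M.simple i ∈ maxParabolic M j :=
  Subgroup.subset_closure ⟨i, h, rfl⟩

lemma simple_mul_simple_zpow_eq_one {j k : B} {l : ℤ} (h : (M j k : ℤ) ∣ l) :
    (M.simple j * M.simple k) ^ l = 1 := by
  obtain ⟨n, rfl⟩ := h
  have := M.toCoxeterSystem.simple_mul_simple_pow j k
  rw [CoxeterMatrix.toCoxeterSystem_simple] at this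
  rw [zpow_mul, zpow_natCast, this, one_zpow]

/-- The bi-infinite path formed by the vertices of types `j` and `k` of the chambers obtained
from `w` by right multiplication by the simple reflections `j` and `k` alternately. -/
def coxeterPath (w : M.Group) (j k : B) (t : ℤ) : CoxeterVertex M :=
  if Even t then ⟨j, (w * (M.simple j * M.simple k) ^ (t / 2) : M.Group)⟩
  else ⟨k, (w * (M.simple j * M.simple k) ^ (t / 2) : M.Group)⟩

lemma coxeterPath_two_mul (w : M.Group) (j k : B) (l : ℤ) :
    coxeterPath M w j k (2 * l) = ⟨j, (w * (M.simple j * M.simple k) ^ l : M.Group)⟩ := by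
  rw [coxeterPath, if_pos (even_two_mul l), Int.mul_ediv_cancel_left _ two_ne_zero]

lemma coxeterPath_two_mul_add_one (w : M.Group) (j k : B) (l : ℤ) :
    coxeterPath M w j k (2 * l + 1) = ⟨k, (w * (M.simple j * M.simple k) ^ l : M.Group)⟩ := by
  rw [coxeterPath, if_neg (by simp), show (2 * l + 1) / 2 = l by omega]

lemma vertex_mk_eq_iff {i : B} (x y : M.Group) :
    (⟨i, (x : M.Group ⧸ maxParabolic M i)⟩ : CoxeterVertex M) = ⟨i, (y : M.Group)⟩ ↔
      x⁻¹ * y ∈ maxParabolic M i := by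
  rw [← QuotientGroup.eq]
  simp

/-- The parity of the index is the type of the vertex; within one type the question is which powers
of the rotation lie in the parabolic. So the path is a circuit of length `2 * M j k`, or a line if
`M j k = 0`. -/
lemma coxeterPath_eq_iff [Finite B] (w : M.Group) {j k : B} (hjk : j ≠ k) (s t : ℤ) :
    coxeterPath M w j k s = coxeterPath M w j k t ↔ (2 * M j k : ℤ) ∣ t - s := by
  cases nonempty_fintype B
  have key : ∀ (i : B) (l l' : ℤ), (i = j ∨ i = k) →
      ((⟨i, (w * (M.simple j * M.simple k) ^ l : M.Group)⟩ : CoxeterVertex M) =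
        ⟨i, (w * (M.simple j * M.simple k) ^ l' : M.Group)⟩ ↔ (M j k : ℤ) ∣ l' - l) := by
    intro i l l' hi
    rw [vertex_mk_eq_iff, show (w * (M.simple j * M.simple k) ^ l)⁻¹ *
      (w * (M.simple j * M.simple k) ^ l') = (M.simple j * M.simple k) ^ (l' - l) by
        rw [sub_eq_neg_add, zpow_add, zpow_neg]; group]
    constructor
    · intro h
      apply dvd_of_zpow_mem_maxParabolic M hjk
      rcases hi with rfl | rfl
      · exact Or.inl h
      · exact Or.inr h
    · intro h
      rw [simple_mul_simple_zpow_eq_one M h]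
      exact one_mem _
  have hne : ∀ l l' : ℤ, (⟨j, (w * (M.simple j * M.simple k) ^ l : M.Group)⟩ : CoxeterVertex M) ≠
      ⟨k, (w * (M.simple j * M.simple k) ^ l' : M.Group)⟩ := fun l l' h =>
    hjk (congrArg Sigma.fst h)
  have hodd : ∀ a b : ℤ, ¬ (2 * b ∣ 2 * a + 1) := by
    rintro a b ⟨c, hc⟩
    have : 2 * a + 1 = 2 * (b * c) := by rw [hc, mul_assoc]
    omega
  obtain ⟨l, rfl | rfl⟩ := s.even_or_odd' <;> obtain ⟨l', rfl | rfl⟩ := t.even_or_odd'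
  · rw [coxeterPath_two_mul, coxeterPath_two_mul, key j l l' (Or.inl rfl), ← mul_sub,
      mul_dvd_mul_iff_left two_ne_zero]
  · rw [coxeterPath_two_mul, coxeterPath_two_mul_add_one,
      show 2 * l' + 1 - 2 * l = 2 * (l' - l) + 1 by ring]
    exact iff_of_false (hne _ _) (hodd _ _)
  · rw [coxeterPath_two_mul, coxeterPath_two_mul_add_one,
      show 2 * l' - (2 * l + 1) = 2 * (l' - l - 1) + 1 by ring]
    exact iff_of_false (hne _ _).symm (hodd _ _)
  · rw [coxeterPath_two_mul_add_one, coxeterPath_two_mul_add_one, key k l l' (Or.inr rfl),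
      show 2 * l' + 1 - (2 * l + 1) = 2 * (l' - l) by ring, mul_dvd_mul_iff_left two_ne_zero]

/-- Normal form in a group generated by two involutions: right multiplication by either of them
exchanges the two shapes. -/
lemma exists_zpow_of_mem_closure_pair {j k : B} {p : M.Group}
    (hp : p ∈ Subgroup.closure {M.simple j, M.simple k}) :
    ∃ l : ℤ, p = (M.simple j * M.simple k) ^ l ∨
      p = (M.simple j * M.simple k) ^ l * M.simple j := by
  have hj := simple_mul_self M j
  have hk := simple_mul_self M k
  have hinv : ∀ i, (M.simple i)⁻¹ = M.simple i := fun i =>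
    inv_eq_of_mul_eq_one_right (simple_mul_self M i)
  have step : ∀ x : M.Group, (∃ l : ℤ, x = (M.simple j * M.simple k) ^ l ∨
      x = (M.simple j * M.simple k) ^ l * M.simple j) → ∀ y ∈ ({M.simple j, M.simple k} : Set _),
      ∃ l : ℤ, x * y = (M.simple j * M.simple k) ^ l ∨
        x * y = (M.simple j * M.simple k) ^ l * M.simple j := by
    rintro x ⟨l, rfl | rfl⟩ y (rfl | rfl)
    · exact ⟨l, Or.inr rfl⟩
    · refine ⟨l - 1, Or.inr ?_⟩
      rw [zpow_sub_one, mul_inv_rev, hinv, hinv, mul_assoc, mul_assoc, hj, mul_one]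
    · exact ⟨l, Or.inl (by rw [mul_assoc, hj, mul_one])⟩
    · exact ⟨l + 1, Or.inl (by rw [zpow_add_one, mul_assoc])⟩
  induction hp using Subgroup.closure_induction_right with
  | one => exact ⟨0, Or.inl (by simp)⟩
  | mul_right x _ y hy ih => exact step x ih y hy
  | mul_inv_cancel x _ y hy ih =>
    refine step x ih y⁻¹ ?_
    rcases hy with rfl | rfl
    · exact Or.inl (hinv j)
    · exact Or.inr (hinv k)

/-- The vertices of types `j` and `k` of the chamber `w`, for the chambers of the form
`c * (s_j s_k)^l`. -/
lemma coxeterPath_chamber (w : M.Group) (j k : B) (l : ℤ) :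
    (⟨j, (w * (M.simple j * M.simple k) ^ l : M.Group)⟩ : CoxeterVertex M) =
        coxeterPath M w j k (2 * l) ∧
      (⟨k, (w * (M.simple j * M.simple k) ^ l : M.Group)⟩ : CoxeterVertex M) =
        coxeterPath M w j k (2 * l + 1) :=
  ⟨(coxeterPath_two_mul M w j k l).symm, (coxeterPath_two_mul_add_one M w j k l).symm⟩

lemma coxeterPath_chamber' (w : M.Group) {j k : B} (hjk : j ≠ k) (l : ℤ) :
    (⟨k, (w * ((M.simple j * M.simple k) ^ l * M.simple j) : M.Group)⟩ : CoxeterVertex M) =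
        coxeterPath M w j k (2 * l + 1) ∧
      (⟨j, (w * ((M.simple j * M.simple k) ^ l * M.simple j) : M.Group)⟩ : CoxeterVertex M) =
        coxeterPath M w j k (2 * l + 1 + 1) := by
  constructor
  · rw [coxeterPath_two_mul_add_one, ← mul_assoc]
    congr 1
    exact QuotientGroup.mk_mul_of_mem _ (simple_mem_maxParabolic M hjk)
  · rw [show 2 * l + 1 + 1 = 2 * (l + 1) by ring, coxeterPath_two_mul, zpow_add_one, ← mul_assoc,
      ← mul_assoc, ← mul_assoc]
    congr 1
    exact (QuotientGroup.mk_mul_of_mem _ (simple_mem_maxParabolic M hjk.symm)).symm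

lemma exists_coxeterPath_of_mem (w : M.Group) {j k : B} (hjk : j ≠ k) {p : M.Group}
    (hp : p ∈ Subgroup.closure {M.simple j, M.simple k}) :
    ∃ t : ℤ, ((⟨j, (w * p : M.Group)⟩ : CoxeterVertex M) = coxeterPath M w j k t ∧
        (⟨k, (w * p : M.Group)⟩ : CoxeterVertex M) = coxeterPath M w j k (t + 1)) ∨
      ((⟨k, (w * p : M.Group)⟩ : CoxeterVertex M) = coxeterPath M w j k t ∧
        (⟨j, (w * p : M.Group)⟩ : CoxeterVertex M) = coxeterPath M w j k (t + 1)) := by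
  obtain ⟨l, rfl | rfl⟩ := exists_zpow_of_mem_closure_pair M hp
  · exact ⟨2 * l, Or.inl (coxeterPath_chamber M w j k l)⟩
  · exact ⟨2 * l + 1, Or.inr (coxeterPath_chamber' M w hjk l)⟩

/-- Converse of `exists_coxeterPath_of_mem`: edges of the path and chambers of the residue are the
same. -/
lemma exists_chamber_of_coxeterPath (w : M.Group) {j k : B} (hjk : j ≠ k) (t : ℤ) :
    ∃ p ∈ Subgroup.closure {M.simple j, M.simple k},
      ((⟨j, (w * p : M.Group)⟩ : CoxeterVertex M) = coxeterPath M w j k t ∧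
        (⟨k, (w * p : M.Group)⟩ : CoxeterVertex M) = coxeterPath M w j k (t + 1)) ∨
      ((⟨k, (w * p : M.Group)⟩ : CoxeterVertex M) = coxeterPath M w j k t ∧
        (⟨j, (w * p : M.Group)⟩ : CoxeterVertex M) = coxeterPath M w j k (t + 1)) := by
  have hj : M.simple j ∈ Subgroup.closure {M.simple j, M.simple k} :=
    Subgroup.subset_closure (by simp)
  have hk : M.simple k ∈ Subgroup.closure {M.simple j, M.simple k} :=
    Subgroup.subset_closure (by simp)
  obtain ⟨l, rfl | rfl⟩ := t.even_or_odd'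
  · exact ⟨_, zpow_mem (mul_mem hj hk) l, Or.inl (coxeterPath_chamber M w j k l)⟩
  · exact ⟨_, mul_mem (zpow_mem (mul_mem hj hk) l) hj, Or.inr (coxeterPath_chamber' M w hjk l)⟩

end Cycle

end

end ChambersMissing

namespace ChambersMissing

noncomputable section

open scoped Classical

/-! ### The graph `G₆`, computably -/

/-- The vertices of the Fano graph. -/
abbrev FanoVertex : Type := ZMod 7 ⊕ ZMod 7

/-- The adjacency relation of the Fano graph. -/
def fanoAdj : FanoVertex → FanoVertex → Bool
  | .inl p, .inr l => p + l == 1 || p + l == 2 || p + l == 4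
  | .inr l, .inl p => p + l == 1 || p + l == 2 || p + l == 4
  | _, _ => false

/-- The edges removed from the Fano graph. -/
def removedAdj : FanoVertex → FanoVertex → Bool
  | .inl p, .inr l => (p == 3 && l == 1) || (p == 6 && l == 2) || (p == 5 && l == 4)
  | .inr l, .inl p => (p == 3 && l == 1) || (p == 6 && l == 2) || (p == 5 && l == 4)
  | _, _ => false

/-- The adjacency relation of `G₆`. -/
def G₆Adj (z w : FanoVertex) : Bool := fanoAdj z w && !removedAdj z w

lemma fanoGraph_adj (z w : FanoVertex) : fanoGraph.Adj z w ↔ fanoAdj z w = true := by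
  rcases z with p | p <;> rcases w with l | l <;> simp [fanoGraph, fanoAdj, or_assoc]

lemma G₆Graph_adj (z w : FanoVertex) : G₆Graph.Adj z w ↔ G₆Adj z w = true := by
  rw [G₆Graph, SimpleGraph.deleteEdges_adj, fanoGraph_adj, G₆Adj, Bool.and_eq_true]
  refine and_congr_right fun _ => ?_
  rcases z with p | p <;> rcases w with l | l <;>
    simp [removedAdj] <;> tauto

lemma G₆Adj_comm (z w : FanoVertex) : G₆Adj z w = G₆Adj w z := by
  revert z w; decide +kernel

/-! ### The group of `V₆³` -/

/-- The triangles of `V₆³`: the first side. -/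
def firstSide : Fin 6 → Fin 4 := ![0, 1, 0, 2, 0, 3]

/-- The triangles of `V₆³`: the second side. -/
def secondSide : Fin 6 → Fin 4 := ![1, 2, 2, 3, 3, 1]

lemma mem_triangles_iff (t : Fin 4 × Fin 4) :
    t ∈ triangles ↔ ∃ i, t = (firstSide i, secondSide i) := by
  constructor
  · rintro ⟨i, h⟩
    fin_cases i <;> rcases h with rfl | rfl
    exacts [⟨0, rfl⟩, ⟨1, rfl⟩, ⟨2, rfl⟩, ⟨3, rfl⟩, ⟨4, rfl⟩, ⟨5, rfl⟩]
  · rintro ⟨i, rfl⟩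
    fin_cases i
    exacts [⟨0, Or.inl rfl⟩, ⟨0, Or.inr rfl⟩, ⟨1, Or.inl rfl⟩, ⟨1, Or.inr rfl⟩, ⟨2, Or.inl rfl⟩,
      ⟨2, Or.inr rfl⟩]

lemma gen_mul_gen (i : Fin 3) :
    gen (lozenge i).1.1 * gen (lozenge i).1.2 = gen (lozenge i).2.1 * gen (lozenge i).2.2 := by
  rw [← mul_inv_eq_one]
  exact PresentedGroup.one_of_mem (rels := {r : FreeGroup (Fin 4) | ∃ i : Fin 3, r =
    (FreeGroup.of (lozenge i).1.1 * FreeGroup.of (lozenge i).1.2) *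
      (FreeGroup.of (lozenge i).2.1 * FreeGroup.of (lozenge i).2.2)⁻¹}) ⟨i, rfl⟩

/-- A homomorphism from `Γ₆₃` is given by four elements satisfying the relations. -/
def liftGen {H : Type*} [Group H] (f : Fin 4 → H)
    (h : ∀ i, f (lozenge i).1.1 * f (lozenge i).1.2 = f (lozenge i).2.1 * f (lozenge i).2.2) :
    Γ₆₃ →* H :=
  PresentedGroup.toGroup (f := f) (by
    rintro r ⟨i, rfl⟩
    simp only [map_mul, map_inv, FreeGroup.lift_apply_of]
    rw [h i, mul_inv_cancel])

lemma liftGen_gen {H : Type*} [Group H] (f : Fin 4 → H)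
    (h : ∀ i, f (lozenge i).1.1 * f (lozenge i).1.2 = f (lozenge i).2.1 * f (lozenge i).2.2)
    (a : Fin 4) : liftGen f h (gen a) = f a :=
  PresentedGroup.toGroup.of _

/-- The homomorphism mapping each generator to `1 : ℤ`. -/
def degreeHom : Γ₆₃ →* Multiplicative ℤ := liftGen (fun _ => Multiplicative.ofAdd 1) fun _ => rfl

/-- The degree of an element of `Γ₆₃`. -/
def degree (g : Γ₆₃) : ℤ := (degreeHom g).toAdd

@[simp] lemma degree_mul (g h : Γ₆₃) : degree (g * h) = degree g + degree h := by simp [degree]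

@[simp] lemma degree_inv (g : Γ₆₃) : degree g⁻¹ = -degree g := by simp [degree]

@[simp] lemma degree_one : degree 1 = 0 := by simp [degree]

@[simp] lemma degree_gen (a : Fin 4) : degree (gen a) = 1 := by
  simp [degree, degreeHom, liftGen_gen]

/-- The four three-cycles which are the images of the generators in the alternating group. -/
def threeCycle : Fin 4 → Equiv.Perm (Fin 4) :=
  ![⟨![0, 2, 3, 1], ![0, 3, 1, 2], by decide, by decide⟩,
    ⟨![1, 3, 2, 0], ![3, 0, 2, 1], by decide, by decide⟩,
    ⟨![2, 0, 1, 3], ![1, 2, 0, 3], by decide, by decide⟩,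
    ⟨![3, 1, 0, 2], ![2, 1, 3, 0], by decide, by decide⟩]

/-- A homomorphism onto the alternating group of degree four. -/
def tetrahedralHom : Γ₆₃ →* Equiv.Perm (Fin 4) := liftGen threeCycle (by decide +kernel)

/-- The neighbours of `1` in `X₆₃`, indexed by the vertices of the Fano graph. -/
def nb : FanoVertex → Γ₆₃
  | .inl p => (![gen 0, gen 1, gen 2, (gen 0 * gen 1)⁻¹, gen 3, (gen 0 * gen 3)⁻¹,
      (gen 0 * gen 2)⁻¹] : Fin 7 → Γ₆₃) p
  | .inr l => (![(gen 0)⁻¹, gen 0 * gen 1, gen 0 * gen 2, (gen 3)⁻¹, gen 0 * gen 3, (gen 2)⁻¹,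
      (gen 1)⁻¹] : Fin 7 → Γ₆₃) l

/-- The involution of the link induced by the inversion of the group. -/
def nbInv : FanoVertex → FanoVertex
  | .inl p => .inr ((![0, 6, 5, 1, 3, 4, 2] : Fin 7 → ZMod 7) p)
  | .inr l => .inl ((![0, 3, 6, 4, 5, 2, 1] : Fin 7 → ZMod 7) l)

/-- Inversion exchanges points and lines. In particular it exchanges the ends of each removed edge,
which are a diagonal and its inverse. -/
lemma nb_nbInv (z : FanoVertex) : nb (nbInv z) = (nb z)⁻¹ := by
  rcases z with p | p <;> (change Fin 7 at p; fin_cases p)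
  all_goals rfl

lemma nbInv_nbInv (z : FanoVertex) : nbInv (nbInv z) = z := by
  revert z; decide +kernel

/-- The degrees of the neighbours of `1`. -/
def nbDegree : FanoVertex → ℤ
  | .inl p => (![1, 1, 1, -2, 1, -2, -2] : Fin 7 → ℤ) p
  | .inr l => (![-1, 2, 2, -1, 2, -1, -1] : Fin 7 → ℤ) l

lemma degree_nb (z : FanoVertex) : degree (nb z) = nbDegree z := by
  rcases z with p | p <;> (change Fin 7 at p; fin_cases p)
  all_goals simp [nb, nbDegree]

/-- The images of the neighbours of `1` in the alternating group. -/
def nbPerm : FanoVertex → Equiv.Perm (Fin 4)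
  | .inl p => (![threeCycle 0, threeCycle 1, threeCycle 2, (threeCycle 0 * threeCycle 1)⁻¹,
      threeCycle 3, (threeCycle 0 * threeCycle 3)⁻¹, (threeCycle 0 * threeCycle 2)⁻¹] :
      Fin 7 → Equiv.Perm (Fin 4)) p
  | .inr l => (![(threeCycle 0)⁻¹, threeCycle 0 * threeCycle 1, threeCycle 0 * threeCycle 2,
      (threeCycle 3)⁻¹, threeCycle 0 * threeCycle 3, (threeCycle 2)⁻¹, (threeCycle 1)⁻¹] :
      Fin 7 → Equiv.Perm (Fin 4)) l

lemma tetrahedralHom_nb (z : FanoVertex) : tetrahedralHom (nb z) = nbPerm z := by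
  rcases z with p | p <;> (change Fin 7 at p; fin_cases p)
  all_goals simp [nb, nbPerm, tetrahedralHom, liftGen_gen]

/-- The degree separates generators, diagonals and their inverses; the images under `tetrahedralHom`
separate neighbours of equal degree. -/
lemma nb_injective : Function.Injective nb := by
  intro z w h
  have h₁ := congrArg degree h
  have h₂ := congrArg tetrahedralHom h
  rw [degree_nb, degree_nb] at h₁
  rw [tetrahedralHom_nb, tetrahedralHom_nb] at h₂
  revert z w
  have : ∀ z w : FanoVertex, nbDegree z = nbDegree w → nbPerm z = nbPerm w → z = w := by
    decide +kernel
  exact fun z w _ => this z w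

lemma nb_ne_one (z : FanoVertex) : nb z ≠ 1 := by
  intro h
  have h₁ := congrArg degree h
  rw [degree_nb, degree_one] at h₁
  revert h₁ z
  have : ∀ z : FanoVertex, nbDegree z ≠ 0 := by decide +kernel
  exact fun z _ => this z

/-- The vertex of the Fano graph corresponding to a generator. -/
def genVertex (a : Fin 4) : FanoVertex := .inl ((![0, 1, 2, 4] : Fin 4 → ZMod 7) a)

/-- The vertex of the Fano graph corresponding to the diagonal side of a triangle. -/
def diagVertex (i : Fin 6) : FanoVertex := .inr ((![1, 1, 2, 2, 4, 4] : Fin 6 → ZMod 7) i)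

lemma nb_genVertex (a : Fin 4) : nb (genVertex a) = gen a := by
  fin_cases a <;> rfl

lemma nb_diagVertex (i : Fin 6) : nb (diagVertex i) = gen (firstSide i) * gen (secondSide i) := by
  fin_cases i
  exacts [rfl, gen_mul_gen 0, rfl, gen_mul_gen 1, rfl, gen_mul_gen 2]

/-! ### The faces of `X₆³` -/

lemma mem_faces_X₆₃_iff (s : Finset Γ₆₃) : s ∈ X₆₃.faces ↔ s.Nonempty ∧ ∃ (g : Γ₆₃) (i : Fin 6),
    s ⊆ {g, g * gen (firstSide i), g * gen (firstSide i) * gen (secondSide i)} := by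
  refine and_congr_right fun _ => exists_congr fun g => ?_
  constructor
  · rintro ⟨t, ht, h⟩
    obtain ⟨i, rfl⟩ := (mem_triangles_iff t).1 ht
    exact ⟨i, h⟩
  · rintro ⟨i, h⟩
    exact ⟨_, (mem_triangles_iff _).2 ⟨i, rfl⟩, h⟩

lemma translateFace_eq_image {Γ : Type u} {V : Type v} [Group Γ] [MulAction Γ V] (g : Γ)
    (s : Finset V) : translateFace g s = s.image (g • ·) := by
  rw [translateFace, Finset.map_eq_image]
  rfl

lemma translateFace_mem_faces_X₆₃ (h : Γ₆₃) {s : Finset Γ₆₃} (hs : s ∈ X₆₃.faces) :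
    translateFace h s ∈ X₆₃.faces := by
  rw [mem_faces_X₆₃_iff] at hs ⊢
  obtain ⟨hne, g, i, hi⟩ := hs
  rw [translateFace_eq_image]
  refine ⟨hne.image _, h * g, i, ?_⟩
  refine (Finset.image_subset_image hi).trans ?_
  simp [Finset.image_insert, mul_assoc]

/-- The corners of a triangle are edges of `G₆`. -/
lemma corners_adj (i : Fin 6) :
    G₆Adj (genVertex (firstSide i)) (diagVertex i) = true ∧
    G₆Adj (genVertex (secondSide i)) (nbInv (genVertex (firstSide i))) = true ∧
    G₆Adj (nbInv (diagVertex i)) (nbInv (genVertex (secondSide i))) = true := by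
  revert i; decide +kernel

/-- Each edge of `G₆` is a corner of a triangle. -/
lemma exists_corner {p l : ZMod 7} (h : G₆Adj (.inl p) (.inr l) = true) : ∃ i : Fin 6,
    (.inl p = genVertex (firstSide i) ∧ .inr l = diagVertex i) ∨
    (.inl p = genVertex (secondSide i) ∧ .inr l = nbInv (genVertex (firstSide i))) ∨
    (.inl p = nbInv (diagVertex i) ∧ .inr l = nbInv (genVertex (secondSide i))) := by
  revert p l; decide +kernel

/-- The cases correspond to the place of `x` in the triangle. The base point of the triangle is `x`,
or `x` moved back along the first side, or `x` moved back along the diagonal. -/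
lemma corner_mem_faces {p l : ZMod 7} (h : G₆Adj (.inl p) (.inr l) = true) (x : Γ₆₃) :
    ({x, x * nb (.inl p), x * nb (.inr l)} : Finset Γ₆₃) ∈ X₆₃.faces := by
  rw [mem_faces_X₆₃_iff]
  refine ⟨⟨x, by simp⟩, ?_⟩
  obtain ⟨i, ⟨h₁, h₂⟩ | ⟨h₁, h₂⟩ | ⟨h₁, h₂⟩⟩ := exists_corner h
  · refine ⟨x, i, ?_⟩
    rw [h₁, h₂, nb_genVertex, nb_diagVertex]
    simp [mul_assoc]
  · refine ⟨x * (gen (firstSide i))⁻¹, i, ?_⟩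
    rw [h₁, h₂, nb_nbInv, nb_genVertex, nb_genVertex]
    intro y
    simp only [Finset.mem_insert, Finset.mem_singleton, inv_mul_cancel_right]
    tauto
  · refine ⟨x * (gen (firstSide i) * gen (secondSide i))⁻¹, i, ?_⟩
    rw [h₁, h₂, nb_nbInv, nb_nbInv, nb_genVertex, nb_diagVertex]
    intro y
    simp only [Finset.mem_insert, Finset.mem_singleton, mul_inv_rev, mul_assoc, inv_mul_cancel,
      mul_one]
    tauto

lemma exists_G₆Adj (z : FanoVertex) : ∃ w, G₆Adj z w = true := by
  revert z; decide +kernel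

lemma G₆Adj_isLeft {z w : FanoVertex} (h : G₆Adj z w = true) :
    (∃ p l, z = .inl p ∧ w = .inr l) ∨ ∃ p l, z = .inr l ∧ w = .inl p := by
  rcases z with p | p <;> rcases w with l | l <;> simp [G₆Adj, fanoAdj] at h ⊢

lemma triangle_mem_faces {z w : FanoVertex} (h : G₆Adj z w = true) (x : Γ₆₃) :
    ({x, x * nb z, x * nb w} : Finset Γ₆₃) ∈ X₆₃.faces := by
  rcases G₆Adj_isLeft h with ⟨p, l, rfl, rfl⟩ | ⟨p, l, rfl, rfl⟩
  · exact corner_mem_faces h x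
  · rw [G₆Adj_comm] at h
    rw [Finset.pair_comm]
    exact corner_mem_faces h x

lemma edge_mem_faces (x : Γ₆₃) (z : FanoVertex) :
    ({x, x * nb z} : Finset Γ₆₃) ∈ X₆₃.faces := by
  obtain ⟨w, hw⟩ := exists_G₆Adj z
  refine (X₆₃.isRelLowerSet_faces (triangle_mem_faces hw x)).2 ?_ (by simp)
  intro y
  simp only [Finset.mem_insert, Finset.mem_singleton]
  tauto

/-- The position of a vertex of a triangle with respect to another one. -/
lemma triangle_cases {g x : Γ₆₃} {i : Fin 6}
    (hx : x ∈ ({g, g * gen (firstSide i), g * gen (firstSide i) * gen (secondSide i)} :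
      Finset Γ₆₃)) : ∃ z w, G₆Adj z w = true ∧
      ({g, g * gen (firstSide i), g * gen (firstSide i) * gen (secondSide i)} : Finset Γ₆₃) =
        {x, x * nb z, x * nb w} := by
  obtain ⟨h₁, h₂, h₃⟩ := corners_adj i
  simp only [Finset.mem_insert, Finset.mem_singleton] at hx
  rcases hx with rfl | rfl | rfl
  · exact ⟨_, _, h₁, by rw [nb_genVertex, nb_diagVertex, mul_assoc]⟩
  · refine ⟨_, _, h₂, ?_⟩
    rw [nb_nbInv, nb_genVertex, nb_genVertex, mul_inv_cancel_right]
    ext y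
    simp only [Finset.mem_insert, Finset.mem_singleton]
    tauto
  · refine ⟨_, _, h₃, ?_⟩
    rw [nb_nbInv, nb_nbInv, nb_genVertex, nb_diagVertex, mul_inv_cancel_right]
    ext y
    simp only [Finset.mem_insert, Finset.mem_singleton, mul_inv_rev, mul_assoc,
      mul_inv_cancel_left, mul_inv_cancel, mul_one]
    tauto

lemma mem_faces_X₆₃_iff_of_mem {x : Γ₆₃} {s : Finset Γ₆₃} (hx : x ∈ s) :
    s ∈ X₆₃.faces ↔ ∃ z w, G₆Adj z w = true ∧ s ⊆ {x, x * nb z, x * nb w} := by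
  constructor
  · rw [mem_faces_X₆₃_iff]
    rintro ⟨-, g, i, hi⟩
    obtain ⟨z, w, h, heq⟩ := triangle_cases (hi hx)
    exact ⟨z, w, h, heq ▸ hi⟩
  · rintro ⟨z, w, h, hs⟩
    exact (X₆₃.isRelLowerSet_faces (triangle_mem_faces h x)).2 hs ⟨x, hx⟩

lemma pair_mem_faces_iff {x y : Γ₆₃} (hxy : y ≠ x) :
    ({x, y} : Finset Γ₆₃) ∈ X₆₃.faces ↔ ∃ z, y = x * nb z := by
  constructor
  · rw [mem_faces_X₆₃_iff_of_mem (x := x) (by simp)]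
    rintro ⟨z, w, -, hs⟩
    have := hs (show y ∈ _ by simp)
    simp only [Finset.mem_insert, Finset.mem_singleton] at this
    rcases this with h | h | h
    exacts [absurd h hxy, ⟨z, h⟩, ⟨w, h⟩]
  · rintro ⟨z, rfl⟩
    exact edge_mem_faces x z

lemma mul_nb_mem_iff {x : Γ₆₃} {z a b : FanoVertex} :
    x * nb z ∈ ({x, x * nb a, x * nb b} : Finset Γ₆₃) ↔ z = a ∨ z = b := by
  simp [nb_ne_one, nb_injective.eq_iff]

/-- A face through `x` lies in a triangle at `x` whose other two vertices are labelled by an edge of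
`G₆`, and the vertices determine their labels. -/
lemma triple_mem_faces_iff (x : Γ₆₃) (z w : FanoVertex) :
    ({x, x * nb z, x * nb w} : Finset Γ₆₃) ∈ X₆₃.faces ↔ z = w ∨ G₆Adj z w = true := by
  constructor
  · rw [mem_faces_X₆₃_iff_of_mem (x := x) (by simp)]
    rintro ⟨a, b, h, hs⟩
    have hz := mul_nb_mem_iff.1 (hs (show x * nb z ∈ _ by simp))
    have hw := mul_nb_mem_iff.1 (hs (show x * nb w ∈ _ by simp))
    rcases hz with rfl | rfl <;> rcases hw with rfl | rfl
    · exact Or.inl rfl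
    · exact Or.inr h
    · exact Or.inr (by rwa [G₆Adj_comm])
    · exact Or.inl rfl
  · rintro (rfl | h)
    · simpa using edge_mem_faces x z
    · exact triangle_mem_faces h x

lemma G₆Adj_ne {z w : FanoVertex} (h : G₆Adj z w = true) : z ≠ w := by
  rintro rfl
  revert h z
  decide +kernel

lemma card_triangle {z w : FanoVertex} (h : G₆Adj z w = true) (x : Γ₆₃) :
    ({x, x * nb z, x * nb w} : Finset Γ₆₃).card = 3 := by
  rw [Finset.card_eq_three]
  exact ⟨x, x * nb z, x * nb w, by simp [(nb_ne_one z)], by simp [(nb_ne_one w)],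
    by simpa [nb_injective.eq_iff] using G₆Adj_ne h, rfl⟩

lemma exists_triangle {s : Finset Γ₆₃} (hs : s ∈ X₆₃.faces) :
    ∃ x z w, G₆Adj z w = true ∧ x ∈ s ∧ s ⊆ {x, x * nb z, x * nb w} := by
  obtain ⟨x, hx⟩ := (X₆₃.isRelLowerSet_faces hs).1
  obtain ⟨z, w, h, hsub⟩ := (mem_faces_X₆₃_iff_of_mem hx).1 hs
  exact ⟨x, z, w, h, hx, hsub⟩

lemma card_le_three {s : Finset Γ₆₃} (hs : s ∈ X₆₃.faces) : s.card ≤ 3 := by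
  obtain ⟨x, z, w, h, -, hsub⟩ := exists_triangle hs
  exact (Finset.card_le_card hsub).trans (card_triangle h x).le

lemma isPureOfDim_X₆₃ : IsPureOfDim X₆₃ 2 := by
  refine ⟨fun s hs => card_le_three hs, fun s hs => ?_⟩
  obtain ⟨x, z, w, h, -, hsub⟩ := exists_triangle hs
  exact ⟨_, triangle_mem_faces h x, hsub, card_triangle h x⟩

lemma isChamber_of_card_eq {V : Type u} {K : AbstractSimplicialComplex V} {d : ℕ}
    (hK : IsPureOfDim K d) {s : Finset V} : IsChamber K s ↔ s ∈ K.faces ∧ s.card = d + 1 := by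
  constructor
  · intro h
    obtain ⟨t, ht, hst, hcard⟩ := hK.2 s h.1
    exact ⟨h.1, by rw [h.eq_of_le ht hst, hcard]⟩
  · rintro ⟨hs, hcard⟩
    refine ⟨hs, fun t ht hst => ?_⟩
    exact (Finset.eq_of_subset_of_card_le hst ((hK.1 t ht).trans hcard.ge)).ge

lemma exists_two_G₆Adj (z : FanoVertex) :
    ∃ w w', w ≠ w' ∧ G₆Adj z w = true ∧ G₆Adj z w' = true := by
  revert z; decide +kernel

lemma hasNoBoundary_X₆₃ : HasNoBoundary X₆₃ 2 := by
  intro s hs hcard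
  obtain ⟨x, y, hxy, rfl⟩ := Finset.card_eq_two.1 hcard
  obtain ⟨z, rfl⟩ := (pair_mem_faces_iff hxy.symm).1 hs
  obtain ⟨w, w', hne, h, h'⟩ := exists_two_G₆Adj z
  have hsub : ∀ w, ({x, x * nb z} : Finset Γ₆₃) ⊆ {x, x * nb z, x * nb w} := by
    intro w y
    simp only [Finset.mem_insert, Finset.mem_singleton]
    tauto
  refine ⟨{x, x * nb z, x * nb w}, {x, x * nb z, x * nb w'}, ?_,
    (isChamber_of_card_eq isPureOfDim_X₆₃).2 ⟨triangle_mem_faces h x, card_triangle h x⟩,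
    (isChamber_of_card_eq isPureOfDim_X₆₃).2 ⟨triangle_mem_faces h' x, card_triangle h' x⟩,
    hsub w, hsub w'⟩
  intro heq
  have : x * nb w ∈ ({x, x * nb z, x * nb w'} : Finset Γ₆₃) := heq ▸ by simp
  rcases mul_nb_mem_iff.1 this with rfl | rfl
  · exact G₆Adj_ne h rfl
  · exact hne rfl

end

end ChambersMissing

namespace ChambersMissing

noncomputable section

open scoped Classical

/-! ### The action of `Γ₆₃` -/

lemma countable_Γ₆₃ : Countable Γ₆₃ := by
  have : Countable (FreeGroup (Fin 4)) :=
    Function.Surjective.countable (f := FreeGroup.mk) (Quot.mk_surjective)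
  exact Function.Surjective.countable (f := PresentedGroup.mk _) (QuotientGroup.mk_surjective)

/-- Distinct vertices of a face differ by a neighbour of `1`, and no such neighbour has degree zero.
-/
lemma degree_injOn {s : Finset Γ₆₃} (hs : s ∈ X₆₃.faces) {x y : Γ₆₃} (hx : x ∈ s) (hy : y ∈ s)
    (h : degree x = degree y) : x = y := by
  by_contra hne
  have hxy : ({x, y} : Finset Γ₆₃) ∈ X₆₃.faces := by
    refine (X₆₃.isRelLowerSet_faces hs).2 ?_ (by simp)
    intro z hz
    simp only [Finset.mem_insert, Finset.mem_singleton] at hz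
    rcases hz with rfl | rfl <;> assumption
  obtain ⟨z, rfl⟩ := (pair_mem_faces_iff (Ne.symm hne)).1 hxy
  rw [degree_mul, degree_nb] at h
  have : ∀ z : FanoVertex, nbDegree z ≠ 0 := by decide +kernel
  exact this z (by omega)

/-- Summing degrees over the invariant face shows that `g` has degree zero, so it fixes each vertex.
Setwise stabilizers are what freeness on the realization requires. -/
lemma eq_one_of_image_eq {s : Finset Γ₆₃} (hs : s ∈ X₆₃.faces) {g : Γ₆₃}
    (h : s.image (g • ·) = s) : g = 1 := by
  have hinj : Function.Injective (g • · : Γ₆₃ → Γ₆₃) := MulAction.injective g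
  have hsum : ∑ x ∈ s, degree x = s.card * degree g + ∑ x ∈ s, degree x := by
    conv_lhs => rw [← h]
    rw [Finset.sum_image hinj.injOn]
    simp [Finset.sum_add_distrib]
  obtain ⟨x, hx⟩ := (X₆₃.isRelLowerSet_faces hs).1
  have hcard : (s.card : ℤ) ≠ 0 := by
    exact_mod_cast (Finset.card_pos.2 ⟨x, hx⟩).ne'
  have hg : degree g = 0 := by
    have : (s.card : ℤ) * degree g = 0 := by linarith
    exact (mul_eq_zero.1 this).resolve_left hcard
  have hgx : g • x ∈ s := by
    rw [← h]
    exact Finset.mem_image_of_mem _ hx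
  have := degree_injOn hs hgx hx (by simp [hg])
  simpa using this

lemma support_pushPoint {V : Type u} {W : Type v} {f : V → W} (hf : Function.Injective f)
    (p : V →₀ ℝ) : (pushPoint f p).support = p.support.image f := by
  rw [pushPoint, Finsupp.mapDomain_support_of_injective hf]

lemma isFreeCofiniteAction_X₆₃ : IsFreeCofiniteAction X₆₃ Γ₆₃ where
  simplicial g s hs := translateFace_mem_faces_X₆₃ g hs
  free g p hp h := by
    refine eq_one_of_image_eq hp.2.2 ?_
    rw [← support_pushPoint (MulAction.injective g), h]
  cofinite := by
    -- The fundamental domain consists of the faces inside the ball of radius one about `1`.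
    refine ⟨{s | s ∈ X₆₃.faces ∧ s ⊆ insert 1 (Finset.univ.image nb)}, ?_, fun s hs => hs.1, ?_⟩
    · refine (Finset.finite_toSet (insert 1 (Finset.univ.image nb)).powerset).subset ?_
      intro s hs
      exact Finset.mem_coe.2 (Finset.mem_powerset.2 hs.2)
    · intro s hs
      obtain ⟨x, z, w, -, -, hsub⟩ := exists_triangle hs
      refine ⟨translateFace x⁻¹ s, ⟨translateFace_mem_faces_X₆₃ _ hs, ?_⟩, x, ?_⟩
      · rw [translateFace_eq_image]
        refine (Finset.image_subset_image hsub).trans ?_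
        intro y
        simp only [Finset.image_insert, Finset.image_singleton, smul_eq_mul, inv_mul_cancel,
          inv_mul_cancel_left, Finset.mem_insert, Finset.mem_singleton, Finset.mem_image,
          Finset.mem_univ, true_and]
        rintro (h | h | h)
        exacts [Or.inl h, Or.inr ⟨z, h.symm⟩, Or.inr ⟨w, h.symm⟩]
      · rw [translateFace_eq_image, translateFace_eq_image, Finset.image_image,
          show ((x • ·) ∘ (x⁻¹ • ·) : Γ₆₃ → Γ₆₃) = id by ext y; simp, Finset.image_id]

/-! ### Simple connectedness -/

lemma closure_gen : Subgroup.closure (Set.range gen) = ⊤ :=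
  PresentedGroup.closure_range_of _

lemma gen_induction {P : Γ₆₃ → Prop} (one : P 1) (mul : ∀ g a, P g → P (g * gen a))
    (mul_inv : ∀ g a, P g → P (g * (gen a)⁻¹)) (g : Γ₆₃) : P g := by
  have hg : g ∈ Subgroup.closure (Set.range gen) := closure_gen ▸ Subgroup.mem_top g
  induction hg using Subgroup.closure_induction_right with
  | one => exact one
  | mul_right x _ y hy ih => obtain ⟨a, rfl⟩ := hy; exact mul x a ih
  | mul_inv_cancel x _ y hy ih => obtain ⟨a, rfl⟩ := hy; exact mul_inv x a ih

lemma gen_pair_mem_faces (g : Γ₆₃) (a : Fin 4) : ({g, g * gen a} : Finset Γ₆₃) ∈ X₆₃.faces := by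
  rw [← nb_genVertex]
  exact edge_mem_faces g _

lemma gen_inv_pair_mem_faces (g : Γ₆₃) (a : Fin 4) :
    ({g, g * (gen a)⁻¹} : Finset Γ₆₃) ∈ X₆₃.faces := by
  rw [← nb_genVertex, ← nb_nbInv]
  exact edge_mem_faces g _

lemma IsEdgePath.append_singleton {V : Type u} {K : AbstractSimplicialComplex V} {x y z : V}
    {l : List V} (h : IsEdgePath K x y l) (hyz : ({y, z} : Finset V) ∈ K.faces) :
    IsEdgePath K x z (l ++ [z]) := by
  obtain ⟨h₁, h₂, h₃⟩ := h
  refine ⟨?_, ?_, by simp⟩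
  · rw [List.isChain_append]
    refine ⟨h₁, List.isChain_singleton z, ?_⟩
    intro a ha b hb
    rw [h₃] at ha
    simp only [Option.mem_some_iff, List.head?_cons] at ha hb
    rw [← ha, ← hb]
    exact hyz
  · rw [List.head?_append, h₂]
    rfl

lemma exists_isEdgePath (x y : Γ₆₃) : ∃ l, IsEdgePath X₆₃ x y l := by
  suffices h : ∀ g, ∃ l, IsEdgePath X₆₃ x (x * g) l by simpa using h (x⁻¹ * y)
  intro g
  induction g using gen_induction with
  | one => exact ⟨[x], List.isChain_singleton x, by simp, by simp⟩
  | mul g a ih =>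
    obtain ⟨l, hl⟩ := ih
    exact ⟨_, hl.append_singleton (by simpa [mul_assoc] using gen_pair_mem_faces (x * g) a)⟩
  | mul_inv g a ih =>
    obtain ⟨l, hl⟩ := ih
    exact ⟨_, hl.append_singleton (by simpa [mul_assoc] using gen_inv_pair_mem_faces (x * g) a)⟩

/-- Edge paths up to homotopy. -/
abbrev PathClass : Type := Quot (ElementaryHomotopy X₆₃)

/-- Extension of a path ending at `g` by the step from `g` to `g * h`. -/
def extendPath (h : Γ₆₃) (l : List Γ₆₃) : List Γ₆₃ :=
  l ++ (l.getLast?.map (· * h)).toList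

lemma ElementaryHomotopy.getLast?_eq {V : Type u} {K : AbstractSimplicialComplex V} {l l' : List V}
    (h : ElementaryHomotopy K l l') : l.getLast? = l'.getLast? := by
  cases h with
  | stutter p q x => simp [List.getLast?_append, List.getLast?_cons_cons]
  | triangle p q x y z h => simp [List.getLast?_append, List.getLast?_cons_cons]

lemma ElementaryHomotopy.append {V : Type u} {K : AbstractSimplicialComplex V} {l l' : List V}
    (h : ElementaryHomotopy K l l') (m : List V) : ElementaryHomotopy K (l ++ m) (l' ++ m) := by
  cases h with
  | stutter p q x =>
    simpa using ElementaryHomotopy.stutter (K := K) p (q ++ m) x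
  | triangle p q x y z h =>
    simpa using ElementaryHomotopy.triangle (K := K) p (q ++ m) x y z h

/-- The extension of path classes. -/
def extendClass (h : Γ₆₃) : PathClass → PathClass :=
  Quot.map (extendPath h) fun l l' hl => by
    rw [extendPath, extendPath, hl.getLast?_eq]
    exact hl.append _

lemma extendPath_append_singleton (h : Γ₆₃) (l : List Γ₆₃) (g : Γ₆₃) :
    extendPath h (l ++ [g]) = l ++ [g, g * h] := by
  simp [extendPath]

lemma extendClass_mk (h : Γ₆₃) (l : List Γ₆₃) :
    extendClass h (Quot.mk _ l) = Quot.mk _ (extendPath h l) := rfl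

lemma extendClass_one (q : PathClass) : extendClass 1 q = q := by
  induction q using Quot.inductionOn with | h l => ?_
  rw [extendClass_mk]
  induction l using List.reverseRecOn with
  -- Path classes are formed from all lists; the empty list has no last vertex and is its own
  -- extension.
  | nil => rfl
  | append_singleton l g _ =>
    rw [extendPath_append_singleton, mul_one]
    exact Quot.sound (ElementaryHomotopy.stutter l [] g)

/-- This is one triangle move at the end of the path. -/
lemma extendClass_extendClass {h k : Γ₆₃}
    (hk : ∀ g, ({g, g * h, g * h * k} : Finset Γ₆₃) ∈ X₆₃.faces) (q : PathClass) :
    extendClass k (extendClass h q) = extendClass (h * k) q := by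
  induction q using Quot.inductionOn with | h l => ?_
  rw [extendClass_mk, extendClass_mk, extendClass_mk]
  induction l using List.reverseRecOn with
  | nil => rfl
  | append_singleton l g _ =>
    rw [extendPath_append_singleton, extendPath_append_singleton,
      show l ++ [g, g * h] = (l ++ [g]) ++ [g * h] by simp, extendPath_append_singleton,
      ← mul_assoc]
    simpa using Quot.sound
      (ElementaryHomotopy.triangle (K := X₆₃) l [] g (g * h) (g * h * k) (hk g))

/-- A step forth and back runs around a degenerate triangle, which is an edge; what remains is a
stutter. -/
lemma extendClass_inv_extendClass (z : FanoVertex) (q : PathClass) :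
    extendClass (nb z)⁻¹ (extendClass (nb z) q) = q := by
  rw [extendClass_extendClass, mul_inv_cancel, extendClass_one]
  intro g
  rw [mul_inv_cancel_right]
  convert edge_mem_faces g z using 1
  ext y
  simp only [Finset.mem_insert, Finset.mem_singleton]
  tauto

lemma extendClass_extendClass_inv (z : FanoVertex) (q : PathClass) :
    extendClass (nb z) (extendClass (nb z)⁻¹ q) = q := by
  have := extendClass_inv_extendClass (nbInv z) q
  rwa [nb_nbInv, inv_inv] at this

/-- The permutation of path classes given by extension. -/
def extendPerm (z : FanoVertex) : Equiv.Perm PathClass where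
  toFun := extendClass (nb z)
  invFun := extendClass (nb z)⁻¹
  left_inv := extendClass_inv_extendClass z
  right_inv := extendClass_extendClass_inv z

lemma extendPerm_apply (z : FanoVertex) (q : PathClass) :
    extendPerm z q = extendClass (nb z) q := rfl

lemma extendPerm_nbInv (z : FanoVertex) : extendPerm (nbInv z) = (extendPerm z)⁻¹ := by
  ext q
  rw [extendPerm_apply, nb_nbInv]
  rfl

lemma extendClass_gen_gen {a b : Fin 4} (hab : (a, b) ∈ triangles) (q : PathClass) :
    extendClass (gen b) (extendClass (gen a) q) = extendClass (gen a * gen b) q := by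
  apply extendClass_extendClass
  exact fun g => ⟨by simp, g, (a, b), hab, subset_rfl⟩

/-- Both sides of a lozenge are homotopic to its short diagonal. The opposite group appears because
prolonging by `a` and then by `b` must correspond to the product `a * b`. -/
lemma extendPerm_relation (i : Fin 3) :
    MulOpposite.op (extendPerm (genVertex (lozenge i).1.1)) *
        MulOpposite.op (extendPerm (genVertex (lozenge i).1.2)) =
      MulOpposite.op (extendPerm (genVertex (lozenge i).2.1)) *
        MulOpposite.op (extendPerm (genVertex (lozenge i).2.2)) := by
  rw [← MulOpposite.op_mul, ← MulOpposite.op_mul]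
  congr 1
  ext q
  simp only [Equiv.Perm.mul_apply, extendPerm_apply, nb_genVertex]
  rw [extendClass_gen_gen ⟨i, Or.inl rfl⟩, extendClass_gen_gen ⟨i, Or.inr rfl⟩, gen_mul_gen]

/-- The action of `Γ₆₃` on path classes, on the right. -/
def pathAction : Γ₆₃ →* (Equiv.Perm PathClass)ᵐᵒᵖ :=
  liftGen (fun a => MulOpposite.op (extendPerm (genVertex a))) extendPerm_relation

/-- The action is defined on generators only; triangle moves extend the formula to diagonals, and
`extendPerm_nbInv` to inverses. -/
lemma pathAction_nb (z : FanoVertex) : pathAction (nb z) = MulOpposite.op (extendPerm z) := by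
  have hgen : ∀ a, pathAction (nb (genVertex a)) = MulOpposite.op (extendPerm (genVertex a)) := by
    intro a
    rw [nb_genVertex]
    exact liftGen_gen _ _ a
  have hdiag : ∀ i, pathAction (nb (diagVertex i)) =
      MulOpposite.op (extendPerm (diagVertex i)) := by
    intro i
    rw [nb_diagVertex, map_mul, ← nb_genVertex, ← nb_genVertex, hgen, hgen, ← MulOpposite.op_mul]
    congr 1
    ext q
    simp only [Equiv.Perm.mul_apply, extendPerm_apply, nb_genVertex, nb_diagVertex]
    exact extendClass_gen_gen ((mem_triangles_iff _).2 ⟨i, rfl⟩) q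
  have hinv : ∀ z, pathAction (nb z) = MulOpposite.op (extendPerm z) →
      pathAction (nb (nbInv z)) = MulOpposite.op (extendPerm (nbInv z)) := by
    intro z hz
    rw [nb_nbInv, map_inv, hz, extendPerm_nbInv, MulOpposite.op_inv]
  have hz : (∃ a, z = genVertex a) ∨ (∃ i, z = diagVertex i) ∨ (∃ a, z = nbInv (genVertex a)) ∨
      ∃ i, z = nbInv (diagVertex i) := by
    revert z; decide +kernel
  rcases hz with ⟨a, rfl⟩ | ⟨i, rfl⟩ | ⟨a, rfl⟩ | ⟨i, rfl⟩
  exacts [hgen a, hdiag i, hinv _ (hgen a), hinv _ (hdiag i)]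

/-- The right-hand side depends only on the ends of the path, so a closed path has the class of the
constant one. -/
lemma IsEdgePath.mk_eq {x : Γ₆₃} {l : List Γ₆₃} {y : Γ₆₃} (h : IsEdgePath X₆₃ x y l) :
    (Quot.mk _ l : PathClass) = (pathAction (x⁻¹ * y)).unop (Quot.mk _ [x]) := by
  induction l using List.reverseRecOn generalizing y with
  | nil => simpa using h.2.1
  | append_singleton l g ih =>
    obtain ⟨h₁, h₂, h₃⟩ := h
    obtain rfl : g = y := by simpa using h₃
    rcases l.eq_nil_or_concat' with rfl | ⟨m, k, rfl⟩
    · obtain rfl : g = x := by simpa using h₂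
      simp
    · rw [List.isChain_append] at h₁
      have hkg : ({k, g} : Finset Γ₆₃) ∈ X₆₃.faces := h₁.2.2 k (by simp) g (by simp)
      have hk := ih (y := k) ⟨h₁.1, by simpa using h₂, by simp⟩
      rw [show x⁻¹ * g = x⁻¹ * k * (k⁻¹ * g) by group, map_mul, MulOpposite.unop_mul,
        Equiv.Perm.mul_apply, ← hk]
      have hext : (Quot.mk _ (m ++ [k] ++ [g]) : PathClass) =
          extendClass (k⁻¹ * g) (Quot.mk _ (m ++ [k])) := by
        rw [extendClass_mk, extendPath_append_singleton]
        simp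
      rw [hext]
      -- An edge path may repeat a vertex, since a single vertex is a face.
      by_cases hne : g = k
      · rw [hne, inv_mul_cancel, extendClass_one, map_one]
        rfl
      · obtain ⟨z, rfl⟩ := (pair_mem_faces_iff hne).1 hkg
        rw [inv_mul_cancel_left, pathAction_nb]
        rfl

lemma isSimplyConnectedComplex_X₆₃ : IsSimplyConnectedComplex X₆₃ := by
  refine ⟨⟨1⟩, exists_isEdgePath, fun x l hl => ?_⟩
  have := hl.mk_eq
  rw [inv_mul_cancel, map_one] at this
  exact Quot.eqvGen_exact this

end

end ChambersMissing

namespace ChambersMissing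

set_option synthInstance.maxHeartbeats 200000 in
set_option synthInstance.maxSize 1000 in
/-- Two flags of the Fano plane lie in a common hexagon. -/
lemma exists_hexagon : ∀ p l : ZMod 7, fanoAdj (.inl p) (.inr l) = true →
    ∀ q m : ZMod 7, fanoAdj (.inl q) (.inr m) = true →
    ∃ p₁ : ZMod 7, fanoAdj (.inl p₁) (.inr l) = true ∧ p ≠ p₁ ∧
    ∃ l₁ : ZMod 7, fanoAdj (.inl p₁) (.inr l₁) = true ∧ l ≠ l₁ ∧
    ∃ p₂ : ZMod 7, fanoAdj (.inl p₂) (.inr l₁) = true ∧ (p₁ ≠ p₂ ∧ p ≠ p₂) ∧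
    ∃ l₂ : ZMod 7, fanoAdj (.inl p₂) (.inr l₂) = true ∧ fanoAdj (.inl p) (.inr l₂) = true ∧
      (l₁ ≠ l₂ ∧ l ≠ l₂) ∧
      ((q = p ∧ (m = l ∨ m = l₂)) ∨ (q = p₁ ∧ (m = l ∨ m = l₁)) ∨
        (q = p₂ ∧ (m = l₁ ∨ m = l₂))) := by
  decide +kernel

noncomputable section

open scoped Classical

/-! ### Graphs as complexes -/

section Graph

variable {V : Type u} {G : SimpleGraph V}

lemma mem_graphComplex_iff (hG : ∀ z, ∃ w, G.Adj z w) (s : Finset V) :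
    s ∈ (graphComplex G).faces ↔ s.Nonempty ∧ ∃ z w, G.Adj z w ∧ s ⊆ {z, w} := by
  constructor
  · rintro ⟨hne, hcard, h⟩
    refine ⟨hne, ?_⟩
    obtain ⟨z, hz⟩ := hne
    by_cases hs : s = {z}
    · obtain ⟨w, hw⟩ := hG z
      exact ⟨z, w, hw, by simp [hs]⟩
    · obtain ⟨w, hw, hzw⟩ : ∃ w ∈ s, w ≠ z := by
        by_contra! hcon
        exact hs (Finset.eq_singleton_iff_unique_mem.2 ⟨hz, hcon⟩)
      refine ⟨z, w, h z hz w hw hzw.symm, ?_⟩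
      have hsub : ({z, w} : Finset V) ⊆ s := by
        intro y
        simp only [Finset.mem_insert, Finset.mem_singleton]
        rintro (rfl | rfl) <;> assumption
      rw [Finset.eq_of_subset_of_card_le hsub (by rwa [Finset.card_pair hzw.symm])]
  · rintro ⟨hne, z, w, h, hs⟩
    refine ⟨hne, (Finset.card_le_card hs).trans Finset.card_le_two, ?_⟩
    intro x hx y hy hxy
    have hx' := hs hx
    have hy' := hs hy
    simp only [Finset.mem_insert, Finset.mem_singleton] at hx' hy'
    rcases hx' with rfl | rfl <;> rcases hy' with rfl | rfl
    exacts [absurd rfl hxy, h, h.symm, absurd rfl hxy]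

lemma pair_mem_graphComplex {z w : V} (h : G.Adj z w) :
    ({z, w} : Finset V) ∈ (graphComplex G).faces := by
  refine ⟨by simp, Finset.card_le_two, ?_⟩
  intro x hx y hy hxy
  simp only [Finset.mem_insert, Finset.mem_singleton] at hx hy
  rcases hx with rfl | rfl <;> rcases hy with rfl | rfl
  exacts [absurd rfl hxy, h, h.symm, absurd rfl hxy]

lemma pair_mem_graphComplex_iff {z w : V} (hzw : z ≠ w) :
    ({z, w} : Finset V) ∈ (graphComplex G).faces ↔ G.Adj z w :=
  ⟨fun h => h.2.2 z (by simp) w (by simp) hzw, pair_mem_graphComplex⟩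

lemma isPureOfDim_graphComplex (hG : ∀ z, ∃ w, G.Adj z w) : IsPureOfDim (graphComplex G) 1 := by
  refine ⟨fun s hs => hs.2.1, fun s hs => ?_⟩
  obtain ⟨-, z, w, h, hsub⟩ := (mem_graphComplex_iff hG s).1 hs
  exact ⟨_, pair_mem_graphComplex h, hsub, Finset.card_pair h.ne⟩

lemma isChamber_graphComplex_iff (hG : ∀ z, ∃ w, G.Adj z w) (s : Finset V) :
    IsChamber (graphComplex G) s ↔ ∃ z w, G.Adj z w ∧ s = {z, w} := by
  rw [isChamber_of_card_eq (isPureOfDim_graphComplex hG)]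
  constructor
  · rintro ⟨hs, hcard⟩
    obtain ⟨z, w, hzw, rfl⟩ := Finset.card_eq_two.1 hcard
    exact ⟨z, w, (pair_mem_graphComplex_iff hzw).1 hs, rfl⟩
  · rintro ⟨z, w, h, rfl⟩
    exact ⟨pair_mem_graphComplex h, Finset.card_pair h.ne⟩

lemma hasNoBoundary_graphComplex (hG : ∀ z, ∃ w w', w ≠ w' ∧ G.Adj z w ∧ G.Adj z w') :
    HasNoBoundary (graphComplex G) 1 := by
  have hG' : ∀ z, ∃ w, G.Adj z w := fun z => (hG z).imp fun w ⟨_, _, h, _⟩ => h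
  intro s _ hcard
  obtain ⟨z, rfl⟩ := Finset.card_eq_one.1 hcard
  obtain ⟨w, w', hne, h, h'⟩ := hG z
  refine ⟨{z, w}, {z, w'}, ?_, (isChamber_graphComplex_iff hG' _).2 ⟨z, w, h, rfl⟩,
    (isChamber_graphComplex_iff hG' _).2 ⟨z, w', h', rfl⟩, by simp, by simp⟩
  intro heq
  have : w ∈ ({z, w'} : Finset V) := heq ▸ by simp
  simp [hne, h.ne.symm] at this

lemma card_chambers_graphComplex (hG : ∀ z, ∃ w, G.Adj z w) (x : V) :
    Nat.card {t : Finset V // IsChamber (graphComplex G) t ∧ x ∈ t} =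
      Nat.card {w // G.Adj x w} := by
  symm
  refine Nat.card_congr (Equiv.ofBijective
    (fun w => ⟨{x, w.1}, (isChamber_graphComplex_iff hG _).2 ⟨x, w.1, w.2, rfl⟩, by simp⟩) ⟨?_, ?_⟩)
  · rintro ⟨w, hw⟩ ⟨w', hw'⟩ h
    have h' : ({x, w} : Finset V) = {x, w'} := congrArg Subtype.val h
    have : w ∈ ({x, w'} : Finset V) := h' ▸ by simp
    simpa [hw.ne.symm] using this
  · rintro ⟨t, ht, hx⟩
    obtain ⟨z, w, h, rfl⟩ := (isChamber_graphComplex_iff hG _).1 ht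
    simp only [Finset.mem_insert, Finset.mem_singleton] at hx
    rcases hx with rfl | rfl
    · exact ⟨⟨w, h⟩, rfl⟩
    · exact ⟨⟨z, h.symm⟩, Subtype.ext (Finset.pair_comm _ _)⟩

end Graph

lemma exists_adj_G₆ (z : FanoVertex) : ∃ w, G₆Graph.Adj z w := by
  simpa only [G₆Graph_adj] using exists_G₆Adj z

lemma exists_adj_fano (z : FanoVertex) : ∃ w, fanoGraph.Adj z w := by
  simp only [fanoGraph_adj]
  revert z; decide +kernel

lemma isPureOfDim_G₆ : IsPureOfDim G₆ 1 := isPureOfDim_graphComplex exists_adj_G₆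

lemma hasNoBoundary_G₆ : HasNoBoundary G₆ 1 := by
  refine hasNoBoundary_graphComplex fun z => ?_
  simpa only [G₆Graph_adj] using exists_two_G₆Adj z

/-! ### The links of `X₆³` -/

/-- The vertices of the link of `x`. -/
def linkEquiv (x : Γ₆₃) : FanoVertex ≃ LinkVertex X₆₃ x :=
  Equiv.ofBijective (fun z => ⟨x * nb z, by simpa using nb_ne_one z, edge_mem_faces x z⟩) ⟨by
    intro z w h
    simpa [nb_injective.eq_iff] using h, by
    rintro ⟨y, hy, h⟩
    obtain ⟨z, rfl⟩ := (pair_mem_faces_iff hy).1 h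
    exact ⟨z, rfl⟩⟩

lemma map_linkEquiv_mem_iff (x : Γ₆₃) (s : Finset FanoVertex) :
    s.map (linkEquiv x).toEmbedding ∈ (link X₆₃ x).faces ↔ s ∈ G₆.faces := by
  have hmap : insert x ((s.map (linkEquiv x).toEmbedding).map (Function.Embedding.subtype _)) =
      insert x (s.image fun z => x * nb z) := by
    rw [Finset.map_map, Finset.map_eq_image]
    rfl
  have hlink : s.map (linkEquiv x).toEmbedding ∈ (link X₆₃ x).faces ↔
      s.Nonempty ∧ insert x (s.image fun z => x * nb z) ∈ X₆₃.faces := by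
    rw [← hmap]
    exact and_congr_left' Finset.map_nonempty
  rw [hlink, G₆, mem_graphComplex_iff exists_adj_G₆]
  refine and_congr_right fun _ => ?_
  rw [mem_faces_X₆₃_iff_of_mem (x := x) (Finset.mem_insert_self _ _)]
  refine exists₂_congr fun z w => ?_
  rw [G₆Graph_adj]
  refine and_congr_right fun _ => ?_
  constructor
  · intro h a ha
    have := mul_nb_mem_iff.1 (h (Finset.mem_insert_of_mem (Finset.mem_image_of_mem _ ha)))
    simpa using this
  · intro h y hy
    rw [Finset.mem_insert, Finset.mem_image] at hy
    rcases hy with rfl | ⟨a, ha, rfl⟩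
    · simp
    · exact mul_nb_mem_iff.2 (by simpa using h ha)

lemma simplicialIso_link (x : Γ₆₃) (s : Finset (LinkVertex X₆₃ x)) :
    s.map (linkEquiv x).symm.toEmbedding ∈ G₆.faces ↔ s ∈ (link X₆₃ x).faces := by
  rw [← map_linkEquiv_mem_iff x, Finset.map_map]
  convert Iff.rfl using 2
  ext y
  simp

/-! ### The Coxeter complex of type `A₂` -/

/-- The vertices of the Coxeter complex of type `A₂`, in cyclic order. -/
def A₂Path (t : ℤ) : CoxeterVertex (CoxeterMatrix.A 2) :=
  coxeterPath (CoxeterMatrix.A 2) 1 0 1 t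

lemma A₂Path_eq_iff (s t : ℤ) : A₂Path s = A₂Path t ↔ (s : ZMod 6) = t := by
  rw [A₂Path, A₂Path, coxeterPath_eq_iff _ _ (by decide), ZMod.intCast_eq_intCast_iff_dvd_sub]
  have : (CoxeterMatrix.A 2) 0 1 = 3 := by decide
  rw [this]
  norm_num

lemma mem_closure_A₂ (w : (CoxeterMatrix.A 2).Group) :
    w ∈ Subgroup.closure {(CoxeterMatrix.A 2).simple 0, (CoxeterMatrix.A 2).simple 1} := by
  have := (CoxeterMatrix.A 2).toCoxeterSystem.subgroup_closure_range_simple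
  rw [CoxeterMatrix.toCoxeterSystem_simple] at this
  have h : Set.range (CoxeterMatrix.A 2).simple =
      {(CoxeterMatrix.A 2).simple 0, (CoxeterMatrix.A 2).simple 1} := by
    ext x
    simp [Fin.exists_fin_two, eq_comm]
  rw [← h, this]
  exact Subgroup.mem_top w

lemma finite_A₂_group : Finite (CoxeterMatrix.A 2).Group := by
  set r := (CoxeterMatrix.A 2).simple 0 * (CoxeterMatrix.A 2).simple 1
  have hr : r ^ 3 = 1 := by
    have := (CoxeterMatrix.A 2).toCoxeterSystem.simple_mul_simple_pow 0 1
    rw [CoxeterMatrix.toCoxeterSystem_simple] at this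
    exact this
  refine Finite.of_surjective (fun x : Fin 3 × Bool =>
    r ^ (x.1 : ℤ) * if x.2 then (CoxeterMatrix.A 2).simple 0 else 1) fun w => ?_
  obtain ⟨l, hl⟩ := exists_zpow_of_mem_closure_pair _ (mem_closure_A₂ w)
  have hmod : r ^ l = r ^ (l % 3) := by
    conv_lhs => rw [← Int.mul_ediv_add_emod l 3, zpow_add, zpow_mul]
    rw [show r ^ (3 : ℤ) = 1 from mod_cast hr, one_zpow, one_mul]
  have hlt : (l % 3).toNat < 3 := by omega
  have hcast : (((l % 3).toNat : ℕ) : ℤ) = l % 3 := by omega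
  rcases hl with rfl | rfl
  · exact ⟨(⟨_, hlt⟩, false), by simpa [hcast] using hmod.symm⟩
  · exact ⟨(⟨_, hlt⟩, true), by simpa [hcast] using hmod.symm⟩

lemma exists_A₂Path (w : (CoxeterMatrix.A 2).Group) : ∃ t : ℤ,
    ∀ c : CoxeterVertex (CoxeterMatrix.A 2),
      c.2 = (w : (CoxeterMatrix.A 2).Group ⧸ maxParabolic _ c.1) ↔
        c = A₂Path t ∨ c = A₂Path (t + 1) := by
  obtain ⟨t, ht⟩ := exists_coxeterPath_of_mem (CoxeterMatrix.A 2) 1 (show (0 : Fin 2) ≠ 1 by decide)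
    (mem_closure_A₂ w)
  rw [one_mul] at ht
  refine ⟨t, fun c => ?_⟩
  have hc : c.2 = (w : (CoxeterMatrix.A 2).Group ⧸ maxParabolic _ c.1) ↔
      c = ⟨0, (w : (CoxeterMatrix.A 2).Group)⟩ ∨ c = ⟨1, (w : (CoxeterMatrix.A 2).Group)⟩ := by
    obtain ⟨i, c⟩ := c
    fin_cases i <;> simp
  rw [hc]
  rcases ht with ⟨h₁, h₂⟩ | ⟨h₁, h₂⟩
  · rw [h₁, h₂]
    rfl
  · rw [h₁, h₂, or_comm]
    rfl

lemma exists_A₂Path' (t : ℤ) : ∃ w : (CoxeterMatrix.A 2).Group,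
    ∀ c : CoxeterVertex (CoxeterMatrix.A 2),
      c = A₂Path t ∨ c = A₂Path (t + 1) →
        c.2 = (w : (CoxeterMatrix.A 2).Group ⧸ maxParabolic _ c.1) := by
  obtain ⟨p, -, ht⟩ := exists_chamber_of_coxeterPath (CoxeterMatrix.A 2) 1
    (show (0 : Fin 2) ≠ 1 by decide) t
  refine ⟨1 * p, ?_⟩
  rintro c (rfl | rfl) <;> rw [A₂Path] <;> rcases ht with ⟨h₁, h₂⟩ | ⟨h₁, h₂⟩
  · rw [← h₁]
  · rw [← h₁]
  · rw [← h₂]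
  · rw [← h₂]

lemma mem_coxeterComplex_A₂_iff (s : Finset (CoxeterVertex (CoxeterMatrix.A 2))) :
    s ∈ (coxeterComplex (CoxeterMatrix.A 2)).faces ↔
      s.Nonempty ∧ ∃ t : ℤ, s ⊆ {A₂Path t, A₂Path (t + 1)} := by
  refine and_congr_right fun _ => ?_
  constructor
  · rintro ⟨w, hw⟩
    obtain ⟨t, ht⟩ := exists_A₂Path w
    exact ⟨t, fun c hc => by simpa using (ht c).1 (hw c hc)⟩
  · rintro ⟨t, ht⟩
    obtain ⟨w, hw⟩ := exists_A₂Path' t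
    exact ⟨w, fun c hc => hw c (by simpa using ht hc)⟩

lemma A₂Path_surjective : Function.Surjective A₂Path := by
  rintro ⟨i, c⟩
  obtain ⟨w, rfl⟩ := QuotientGroup.mk_surjective c
  obtain ⟨t, ht⟩ := exists_A₂Path w
  rcases (ht ⟨i, w⟩).1 rfl with h | h
  exacts [⟨t, h.symm⟩, ⟨t + 1, h.symm⟩]

/-! ### The Fano plane as a building -/

/-- The circle with six edges given by a cyclic sequence of six vertices. -/
def hexagonComplex {V : Type u} (e : ZMod 6 → V) : PreAbstractSimplicialComplex V where
  faces := {s | s.Nonempty ∧ ∃ i, s ⊆ {e i, e (i + 1)}}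
  isRelLowerSet_faces := by
    rintro s ⟨hs, i, hi⟩
    exact ⟨hs, fun t hts ht => ⟨ht, i, hts.trans hi⟩⟩

lemma mem_hexagonComplex {V : Type u} (e : ZMod 6 → V) (s : Finset V) :
    s ∈ (hexagonComplex e).faces ↔ s.Nonempty ∧ ∃ i, s ⊆ {e i, e (i + 1)} := Iff.rfl

/-- The Coxeter complex is itself a circuit of length six, so `e` transports it once each vertex is
given an integer position; only its class modulo six matters. -/
lemma exists_A₂Embedding {V : Type u} {e : ZMod 6 → V} (he : Function.Injective e) :
    ∃ f : CoxeterVertex (CoxeterMatrix.A 2) ↪ V, ∀ s : Finset V,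
      s ∈ (hexagonComplex e).faces ↔
        ∃ t ∈ (coxeterComplex (CoxeterMatrix.A 2)).faces, t.map f = s := by
  set τ := Function.surjInv A₂Path_surjective
  have hτ : ∀ c, A₂Path (τ c) = c := Function.surjInv_eq A₂Path_surjective
  let f : CoxeterVertex (CoxeterMatrix.A 2) ↪ V := ⟨fun c => e (τ c), by
    intro c c' h
    rw [← hτ c, ← hτ c', A₂Path_eq_iff]
    exact he h⟩
  have hf : ∀ t : ℤ, f (A₂Path t) = e t := by
    intro t
    change e _ = e _
    congr 1
    rw [← A₂Path_eq_iff, hτ]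
  have hpair : ∀ t : ℤ, ({A₂Path t, A₂Path (t + 1)} : Finset _).map f =
      {e (t : ZMod 6), e ((t : ZMod 6) + 1)} := by
    intro t
    rw [Finset.map_insert, Finset.map_singleton, hf, hf]
    push_cast
    rfl
  refine ⟨f, fun s => ?_⟩
  rw [mem_hexagonComplex]
  constructor
  · rintro ⟨hne, i, hi⟩
    obtain ⟨t, rfl⟩ := ZMod.intCast_surjective i
    rw [← hpair] at hi
    obtain ⟨u, hu, rfl⟩ := Finset.subset_map_iff.1 hi
    exact ⟨u, (mem_coxeterComplex_A₂_iff u).2 ⟨by simpa using hne, t, hu⟩, rfl⟩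
  · rintro ⟨u, hu, rfl⟩
    obtain ⟨hne, t, ht⟩ := (mem_coxeterComplex_A₂_iff u).1 hu
    exact ⟨by simpa using hne, t, hpair t ▸ Finset.map_subset_map.2 ht⟩

/-- A closed path with six edges in the Fano graph, without repetitions. -/
structure IsHexagon (e : ZMod 6 → FanoVertex) : Prop where
  injective : Function.Injective e
  adj : ∀ i, fanoAdj (e i) (e (i + 1)) = true

/-- The distance in the Fano graph. -/
def fanoDist (z w : FanoVertex) : ℕ :=
  if z = w then 0 else if z.isLeft = w.isLeft then 2 else if fanoAdj z w then 1 else 3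

/-- The distance in a circle with six edges. -/
def hexagonDist (i : ZMod 6) : ℕ := (![0, 1, 2, 3, 2, 1] : Fin 6 → ℕ) i

lemma fanoAdj_isLeft {z w : FanoVertex} (h : fanoAdj z w = true) : z.isLeft = !w.isLeft := by
  rcases z with p | p <;> rcases w with l | l <;> simp [fanoAdj] at h ⊢

lemma fanoAdj_comm (z w : FanoVertex) : fanoAdj z w = fanoAdj w z := by
  revert z w; decide +kernel

/-- Two points lie on only one common line. -/
lemma fano_no_square (p l q m : ZMod 7) (h₁ : fanoAdj (.inl p) (.inr l) = true)
    (h₂ : fanoAdj (.inl q) (.inr l) = true) (h₃ : fanoAdj (.inl q) (.inr m) = true)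
    (h₄ : fanoAdj (.inl p) (.inr m) = true) : p = q ∨ l = m := by
  revert p l q m; decide +kernel

lemma fano_no_square' {a b c d : FanoVertex} (h₁ : fanoAdj a b = true) (h₂ : fanoAdj b c = true)
    (h₃ : fanoAdj c d = true) (h₄ : fanoAdj d a = true) : a = c ∨ b = d := by
  rcases a with a | a <;> rcases b with b | b <;> try (simp [fanoAdj] at h₁; done)
  all_goals rcases c with c | c <;> try (simp [fanoAdj] at h₂; done)
  all_goals rcases d with d | d <;> try (simp [fanoAdj] at h₃; done)
  · rw [fanoAdj_comm] at h₂ h₄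
    simpa using fano_no_square a b c d h₁ h₂ h₃ h₄
  · rw [fanoAdj_comm] at h₁ h₃
    simpa [or_comm] using fano_no_square b a d c h₁ h₄ h₃ h₂

lemma fanoDist_self (z : FanoVertex) : fanoDist z z = 0 := if_pos rfl

lemma fanoDist_of_adj {z w : FanoVertex} (h : fanoAdj z w = true) : fanoDist z w = 1 := by
  have := fanoAdj_isLeft h
  have hne : z.isLeft ≠ w.isLeft := by rw [this]; exact Bool.not_ne_self _
  rw [fanoDist, if_neg (fun h' => hne (congrArg _ h')), if_neg hne, if_pos h]

lemma fanoDist_comm (z w : FanoVertex) : fanoDist z w = fanoDist w z := by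
  unfold fanoDist
  rw [fanoAdj_comm]
  simp only [eq_comm]

/-- Hexagons are isometrically embedded: sides alternate, and opposite vertices are not adjacent
because such a chord would create a square. A distance common to all apartments is what the exchange
property uses. -/
lemma IsHexagon.dist {e : ZMod 6 → FanoVertex} (he : IsHexagon e) (i j : ZMod 6) :
    fanoDist (e i) (e j) = hexagonDist (j - i) := by
  have hside : ∀ i, (e (i + 1)).isLeft = !(e i).isLeft := by
    intro i
    rw [fanoAdj_isLeft (he.adj i), Bool.not_not]
  have hne : ∀ i k : ZMod 6, k ≠ 0 → e i ≠ e (i + k) := by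
    intro i k hk h
    exact hk (by simpa using he.injective h)
  have h2 : ∀ i, fanoDist (e i) (e (i + 2)) = 2 := by
    intro i
    have : (e i).isLeft = (e (i + 2)).isLeft := by
      rw [show i + 2 = i + 1 + 1 by ring, hside, hside, Bool.not_not]
    rw [fanoDist, if_neg (hne i 2 (by decide)), if_pos this]
  have h3 : ∀ i, fanoDist (e i) (e (i + 3)) = 3 := by
    intro i
    have : (e i).isLeft ≠ (e (i + 3)).isLeft := by
      rw [show i + 3 = i + 1 + 1 + 1 by ring, hside, hside, hside, Bool.not_not]
      exact (Bool.not_ne_self _).symm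
    have hadj : ¬ fanoAdj (e i) (e (i + 3)) = true := by
      intro h
      have h₁ := he.adj i
      have h₂ := he.adj (i + 1)
      have h₃ := he.adj (i + 2)
      rw [show i + 1 + 1 = i + 2 by ring] at h₂
      rw [show i + 2 + 1 = i + 3 by ring] at h₃
      rw [fanoAdj_comm] at h
      rcases fano_no_square' h₁ h₂ h₃ h with h' | h'
      · exact hne i 2 (by decide) h'
      · exact hne (i + 1) 2 (by decide) (by rwa [show i + 1 + 2 = i + 3 by ring])
    rw [fanoDist, if_neg (hne i 3 (by decide)), if_neg this, if_neg hadj]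
  obtain ⟨k, rfl⟩ : ∃ k, j = i + k := ⟨j - i, by ring⟩
  rw [add_sub_cancel_left]
  have hk : k = 0 ∨ k = 1 ∨ k = 2 ∨ k = 3 ∨ k = 4 ∨ k = 5 := by revert k; decide +kernel
  have h6 : (6 : ZMod 6) = 0 := rfl
  rcases hk with rfl | rfl | rfl | rfl | rfl | rfl
  · rw [add_zero, fanoDist_self]; rfl
  · rw [fanoDist_of_adj (he.adj i)]; rfl
  · rw [h2]; rfl
  · rw [h3]; rfl
  · have := h2 (i + 4)
    rw [show i + 4 + 2 = i by linear_combination h6] at this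
    rw [fanoDist_comm, this]; rfl
  · have := fanoDist_of_adj (he.adj (i + 5))
    rw [show i + 5 + 1 = i by linear_combination h6] at this
    rw [fanoDist_comm, this]; rfl

/-- The partial isometries of a circle with six edges extend. -/
lemma hexagonDist_extend : ∀ u u', hexagonDist u = hexagonDist u' →
    ∀ v v', hexagonDist v = hexagonDist v' → hexagonDist (u - v) = hexagonDist (u' - v') →
    ∀ w w', hexagonDist w = hexagonDist w' → hexagonDist (u - w) = hexagonDist (u' - w') →
      hexagonDist (v - w) = hexagonDist (v' - w') →
      ∃ ε : ZMod 6, (ε = 1 ∨ ε = -1) ∧ u' = ε * u ∧ v' = ε * v ∧ w' = ε * w := by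
  decide +kernel

/-- Repetition is allowed, so vertices and edges are treated alike as pairs. -/
lemma exists_pair_of_subset {V : Type u} {s : Finset V} {x y : V} (hne : s.Nonempty)
    (h : s ⊆ {x, y}) : s = {x, x} ∨ s = {y, y} ∨ s = {x, y} := by
  rw [← Finset.coe_subset, Finset.coe_insert, Finset.coe_singleton, Set.subset_pair_iff_eq] at h
  rcases h with h | h | h | h
  · exact absurd (Finset.coe_eq_empty.1 h) hne.ne_empty
  · exact Or.inl (Finset.coe_injective (by simpa using h))
  · exact Or.inr (Or.inl (Finset.coe_injective (by simpa using h)))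
  · exact Or.inr (Or.inr (Finset.coe_injective (by simpa using h)))

lemma exists_pair_of_mem_hexagonComplex {V : Type u} {e : ZMod 6 → V} {s : Finset V}
    (h : s ∈ (hexagonComplex e).faces) : ∃ a b, s = {e a, e b} := by
  obtain ⟨hne, i, hi⟩ := h
  rcases exists_pair_of_subset hne hi with h | h | h
  exacts [⟨_, _, h⟩, ⟨_, _, h⟩, ⟨_, _, h⟩]

lemma exists_index_of_mem {V : Type u} {e : ZMod 6 → V} {s : Finset V}
    (h : s ∈ (hexagonComplex e).faces) {x : V} (hx : x ∈ s) : ∃ i, x = e i := by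
  obtain ⟨a, b, rfl⟩ := exists_pair_of_mem_hexagonComplex h
  simp only [Finset.mem_insert, Finset.mem_singleton] at hx
  rcases hx with rfl | rfl
  exacts [⟨a, rfl⟩, ⟨b, rfl⟩]

lemma pair_mem_hexagonComplex {V : Type u} (e : ZMod 6 → V) {ε : ZMod 6} (hε : ε = 1 ∨ ε = -1)
    (i : ZMod 6) {s : Finset V} (hs : s.Nonempty) (h : s ⊆ {e i, e (i + ε)}) :
    s ∈ (hexagonComplex e).faces := by
  rcases hε with rfl | rfl
  · exact ⟨hs, i, h⟩
  · refine ⟨hs, i + -1, ?_⟩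
    rwa [neg_add_cancel_right, Finset.pair_comm]

/-- Two faces have at most four vertices. Their positions in the two hexagons are related by a
partial isometry of the circle, as both are measured by `D`, and it extends to a map `i ↦ ε * i +
k`. -/
lemma hexagonComplex_exchange {V : Type u} {e e' : ZMod 6 → V} (he : Function.Injective e)
    (he' : Function.Injective e') (D : V → V → ℕ)
    (hD : ∀ i j, D (e i) (e j) = hexagonDist (j - i))
    (hD' : ∀ i j, D (e' i) (e' j) = hexagonDist (j - i)) {s t : Finset V}
    (hs : s ∈ (hexagonComplex e).faces) (ht : t ∈ (hexagonComplex e).faces)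
    (hs' : s ∈ (hexagonComplex e').faces) (ht' : t ∈ (hexagonComplex e').faces) : ∃ φ : V → V,
      Set.InjOn φ {x | {x} ∈ (hexagonComplex e).faces} ∧
      (∀ r : Finset V, r ∈ (hexagonComplex e').faces ↔
        ∃ r₀ ∈ (hexagonComplex e).faces, r₀.image φ = r) ∧
      (∀ x ∈ s, φ x = x) ∧ (∀ x ∈ t, φ x = x) := by
  obtain ⟨a, b, rfl⟩ := exists_pair_of_mem_hexagonComplex hs
  obtain ⟨c, d, rfl⟩ := exists_pair_of_mem_hexagonComplex ht
  obtain ⟨a', ha⟩ := exists_index_of_mem hs' (x := e a) (by simp)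
  obtain ⟨b', hb⟩ := exists_index_of_mem hs' (x := e b) (by simp)
  obtain ⟨c', hc⟩ := exists_index_of_mem ht' (x := e c) (by simp)
  obtain ⟨d', hd⟩ := exists_index_of_mem ht' (x := e d) (by simp)
  have key : ∀ {i j i' j'}, e i = e' i' → e j = e' j' →
      hexagonDist (j - i) = hexagonDist (j' - i') := by
    intro i j i' j' hi hj
    rw [← hD, ← hD', hi, hj]
  obtain ⟨ε, hε, hub, huc, hud⟩ := hexagonDist_extend (b - a) (b' - a') (key ha hb)
    (c - a) (c' - a') (key ha hc) (by simpa using key hc hb) (d - a) (d' - a') (key ha hd)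
    (by simpa using key hd hb) (by simpa using key hd hc)
  have hεε : ε * ε = 1 := by rcases hε with rfl | rfl <;> norm_num
  set k := a' - ε * a with hk
  -- The constant `k` makes `a` correspond to `a'`. The identity outside the first hexagon is an
  -- arbitrary choice.
  set φ : V → V := Function.extend e (fun i => e' (ε * i + k)) id with hφ
  have hφe : ∀ i, φ (e i) = e' (ε * i + k) := fun i => he.extend_apply _ _ i
  have hmem : ∀ {x}, {x} ∈ (hexagonComplex e).faces → ∃ i, x = e i := fun h =>
    exists_index_of_mem h (Finset.mem_singleton_self _)
  have hfix : ∀ i i', e i = e' i' → i' - a' = ε * (i - a) → φ (e i) = e i := by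
    intro i i' h h'
    rw [hφe, h]
    congr 1
    rw [hk]
    linear_combination -h'
  have fa := hfix a a' ha (by ring)
  have fb := hfix b b' hb hub
  have fc := hfix c c' hc huc
  have fd := hfix d d' hd hud
  refine ⟨φ, ?_, ?_, by simp [fa, fb], by simp [fc, fd]⟩
  · intro x hx y hy hxy
    obtain ⟨i, rfl⟩ := hmem hx
    obtain ⟨j, rfl⟩ := hmem hy
    rw [hφe, hφe] at hxy
    have := he' hxy
    congr 1
    linear_combination ε * this - (i - j) * hεε
  · intro r
    constructor
    · rintro ⟨hne, i, hi⟩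
      have himg : ({e (ε * (i - k)), e (ε * (i - k) + ε)} : Finset V).image φ =
          {e' i, e' (i + 1)} := by
        rw [Finset.image_insert, Finset.image_singleton, hφe, hφe]
        congr 2
        · linear_combination (i - k) * hεε
        · congr 1
          linear_combination (i - k + 1) * hεε
      rw [← himg] at hi
      obtain ⟨u, hu, rfl⟩ := Finset.subset_image_iff.1 hi
      exact ⟨u, pair_mem_hexagonComplex e hε _ (by simpa using hne) hu, rfl⟩
    · rintro ⟨u, ⟨hne, i, hi⟩, rfl⟩
      refine pair_mem_hexagonComplex e' hε (ε * i + k) (hne.image _) ?_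
      refine (Finset.image_subset_image hi).trans ?_
      rw [Finset.image_insert, Finset.image_singleton, hφe, hφe,
        show ε * (i + 1) + k = ε * i + k + ε by ring]

/-- The hexagon with given points and lines. -/
def hexagon (p₀ l₀ p₁ l₁ p₂ l₂ : ZMod 7) : ZMod 6 → FanoVertex :=
  (![.inl p₀, .inr l₀, .inl p₁, .inr l₁, .inl p₂, .inr l₂] : Fin 6 → FanoVertex)

lemma isHexagon_hexagon {p₀ l₀ p₁ l₁ p₂ l₂ : ZMod 7}
    (h₁ : fanoAdj (.inl p₀) (.inr l₀) = true) (h₂ : fanoAdj (.inl p₁) (.inr l₀) = true)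
    (h₃ : fanoAdj (.inl p₁) (.inr l₁) = true) (h₄ : fanoAdj (.inl p₂) (.inr l₁) = true)
    (h₅ : fanoAdj (.inl p₂) (.inr l₂) = true) (h₆ : fanoAdj (.inl p₀) (.inr l₂) = true)
    (hp : p₀ ≠ p₁ ∧ p₁ ≠ p₂ ∧ p₀ ≠ p₂) (hl : l₀ ≠ l₁ ∧ l₁ ≠ l₂ ∧ l₀ ≠ l₂) :
    IsHexagon (hexagon p₀ l₀ p₁ l₁ p₂ l₂) := by
  obtain ⟨hp₁, hp₂, hp₃⟩ := hp
  obtain ⟨hl₁, hl₂, hl₃⟩ := hl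
  constructor
  · intro i j h
    change Fin 6 at i j
    have hp₁' := hp₁.symm
    have hp₂' := hp₂.symm
    have hp₃' := hp₃.symm
    have hl₁' := hl₁.symm
    have hl₂' := hl₂.symm
    have hl₃' := hl₃.symm
    fin_cases i <;> fin_cases j <;> first | rfl | (exfalso; simp_all [hexagon])
  · intro i
    change Fin 6 at i
    rw [fanoAdj_comm] at h₂ h₄ h₆
    fin_cases i
    exacts [h₁, h₂, h₃, h₄, h₅, h₆]

end

end ChambersMissing

/-! ### The Fano plane as an extension of `G₆` and of the links -/

namespace ChambersMissing

noncomputable section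

open scoped Classical

/-- The flag complex of the Fano plane. -/
def fanoComplex : AbstractSimplicialComplex FanoVertex := graphComplex fanoGraph

/-- The apartments of the flag complex of the Fano plane. -/
def fanoApartments : Set (PreAbstractSimplicialComplex FanoVertex) :=
  {S | ∃ e, IsHexagon e ∧ S = hexagonComplex e}

lemma mem_hexagonComplex_iff {V : Type u} (e : ZMod 6 → V) (s : Finset V) :
    s ∈ (hexagonComplex e).faces ↔ s.Nonempty ∧ ∃ i, ∀ x ∈ s, x = e i ∨ x = e (i + 1) := by
  simp [mem_hexagonComplex, Finset.subset_iff]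

lemma exists_flag_of_mem {s : Finset FanoVertex} (hs : s ∈ fanoComplex.faces) :
    ∃ p l : ZMod 7, fanoAdj (.inl p) (.inr l) = true ∧ ∀ x ∈ s, x = .inl p ∨ x = .inr l := by
  obtain ⟨-, z, w, h, hsub⟩ := (mem_graphComplex_iff exists_adj_fano s).1 hs
  have hsub' : ∀ x ∈ s, x = z ∨ x = w := fun x hx => by simpa using hsub hx
  rw [fanoGraph_adj] at h
  rcases z with p | l <;> rcases w with q | m <;> try (simp [fanoAdj] at h; done)
  · exact ⟨p, m, h, hsub'⟩
  · exact ⟨q, l, by rwa [fanoAdj_comm], fun x hx => (hsub' x hx).symm⟩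

lemma exists_hexagon_of_mem {s t : Finset FanoVertex} (hs : s ∈ fanoComplex.faces)
    (ht : t ∈ fanoComplex.faces) : ∃ e, IsHexagon e ∧ s ∈ (hexagonComplex e).faces ∧
      t ∈ (hexagonComplex e).faces := by
  obtain ⟨p, l, hpl, hs'⟩ := exists_flag_of_mem hs
  obtain ⟨q, m, hqm, ht'⟩ := exists_flag_of_mem ht
  obtain ⟨p₁, h₁, n₁, l₁, h₂, n₂, p₂, h₃, ⟨n₃, n₃'⟩, l₂, h₄, h₅, ⟨n₄, n₄'⟩, h⟩ :=
    exists_hexagon p l hpl q m hqm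
  refine ⟨hexagon p l p₁ l₁ p₂ l₂, isHexagon_hexagon hpl h₁ h₂ h₃ h₄ h₅ ⟨n₁, n₃, n₃'⟩
    ⟨n₂, n₄, n₄'⟩, ?_, ?_⟩
  · exact (mem_hexagonComplex_iff _ _).2 ⟨hs.1, 0, hs'⟩
  · refine (mem_hexagonComplex_iff _ _).2 ⟨ht.1, ?_⟩
    rcases h with ⟨rfl, rfl | rfl⟩ | ⟨rfl, rfl | rfl⟩ | ⟨rfl, rfl | rfl⟩
    · exact ⟨0, ht'⟩
    -- Index `5` is the closing edge, from `l₂` back to `p`.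
    · exact ⟨5, fun x hx => (ht' x hx).symm⟩
    · exact ⟨1, fun x hx => (ht' x hx).symm⟩
    · exact ⟨2, ht'⟩
    · exact ⟨3, fun x hx => (ht' x hx).symm⟩
    · exact ⟨4, ht'⟩

lemma IsHexagon.faces_subset {e : ZMod 6 → FanoVertex} (he : IsHexagon e) :
    (hexagonComplex e).faces ⊆ fanoComplex.faces := by
  rintro s ⟨hne, i, hi⟩
  exact (mem_graphComplex_iff exists_adj_fano s).2
    ⟨hne, e i, e (i + 1), (fanoGraph_adj _ _).2 (he.adj i), hi⟩

/-- A hexagon none of whose edges is removed. -/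
def remainingHexagon : ZMod 6 → FanoVertex := hexagon 0 1 1 0 2 2

lemma isHexagon_remainingHexagon : IsHexagon remainingHexagon := by
  apply isHexagon_hexagon <;> decide

lemma isApartmentSystem_fano :
    IsApartmentSystem (CoxeterMatrix.A 2) fanoComplex fanoApartments where
  nonempty := ⟨_, _, isHexagon_remainingHexagon, rfl⟩
  subcomplex := by
    rintro S ⟨e, he, rfl⟩
    exact he.faces_subset
  coxeter := by
    rintro S ⟨e, he, rfl⟩
    exact exists_A₂Embedding he.injective
  common := by
    intro s hs t ht
    obtain ⟨e, he, hs', ht'⟩ := exists_hexagon_of_mem hs ht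
    exact ⟨_, ⟨e, he, rfl⟩, hs', ht'⟩
  exchange := by
    rintro S ⟨e, he, rfl⟩ S' ⟨e', he', rfl⟩ s t hs ht hs' ht'
    exact hexagonComplex_exchange he.injective he'.injective fanoDist he.dist he'.dist
      hs ht hs' ht'

lemma isFreeCofiniteAction_of_subsingleton {V : Type u} {Γ : Type v} [Group Γ] [Subsingleton Γ]
    [MulAction Γ V] [Finite V] (K : AbstractSimplicialComplex V) : IsFreeCofiniteAction K Γ where
  simplicial g s hs := by
    rw [Subsingleton.elim g 1, translateFace_eq_image]
    simpa using hs
  free g _ _ _ := Subsingleton.elim g 1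
  cofinite := ⟨K.faces, Set.toFinite _, subset_rfl, fun s hs => ⟨s, hs, 1, by
    rw [translateFace_eq_image]
    simp⟩⟩

lemma sameOrbit_iff_of_subsingleton {V : Type u} {Γ : Type v} [Group Γ] [Subsingleton Γ]
    [MulAction Γ V] (p q : V →₀ ℝ) : SameOrbit Γ p q ↔ p = q := by
  have h1 : pushPoint (fun x : V => (1 : Γ) • x) p = p := by
    have : (fun x : V => (1 : Γ) • x) = id := by ext x; simp
    rw [this]
    exact Finsupp.mapDomain_id
  constructor
  · rintro ⟨g, hg⟩
    rw [← hg, Subsingleton.elim g 1, h1]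
  · rintro rfl
    exact ⟨1, h1⟩

/-- The three missing chambers. -/
def missingEdge : Fin 3 → Finset FanoVertex :=
  ![{.inl 3, .inr 1}, {.inl 6, .inr 2}, {.inl 5, .inr 4}]

/-- The ends of the three missing chambers. -/
def missingPoint : Fin 3 → ZMod 7 := ![3, 6, 5]

/-- The ends of the three missing chambers. -/
def missingLine : Fin 3 → ZMod 7 := ![1, 2, 4]

lemma mem_missingEdge (i : Fin 3) (x : FanoVertex) :
    x ∈ missingEdge i ↔ x = .inl (missingPoint i) ∨ x = .inr (missingLine i) := by
  fin_cases i <;> simp [missingEdge, missingPoint, missingLine]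

lemma removedAdj_iff (p l : ZMod 7) : removedAdj (.inl p) (.inr l) = true ↔
    ∃ i, p = missingPoint i ∧ l = missingLine i := by
  revert p l; decide +kernel

lemma missing_adj (i : Fin 3) :
    fanoAdj (.inl (missingPoint i)) (.inr (missingLine i)) = true ∧
      G₆Adj (.inl (missingPoint i)) (.inr (missingLine i)) = false := by
  revert i; decide +kernel

lemma missingEdge_injective : Function.Injective missingEdge := by
  intro i j h
  have : (.inl (missingPoint i) : FanoVertex) ∈ missingEdge j := by
    rw [← h]
    simp [mem_missingEdge]
  rw [mem_missingEdge] at this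
  have h' : missingPoint i = missingPoint j := by simpa using this
  revert i j
  have : ∀ i j, missingPoint i = missingPoint j → i = j := by decide +kernel
  exact fun i j _ _ => this i j

lemma image_equiv {V : Type u} {W : Type v} (e : V ≃ W) (s : Finset V) :
    s.image e = s.map e.toEmbedding := by
  rw [Finset.map_eq_image]
  rfl

/-- Any copy `K` of `G₆` is allowed, so that the lemma serves the links as well as `G₆`. With
trivial groups the orbit condition reduces to injectivity of `e` on the realization. -/
lemma isExtension_fano {V : Type} (K : AbstractSimplicialComplex V) (e : V ≃ FanoVertex)
    (he : ∀ s : Finset V, s.map e.toEmbedding ∈ G₆.faces ↔ s ∈ K.faces) :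
    IsExtension (Γ := (⊥ : Subgroup (Equiv.Perm V)))
      (Γ' := (⊥ : Subgroup (Equiv.Perm FanoVertex))) K fanoComplex e missingEdge := by
  have hone : ∀ (g : (⊥ : Subgroup (Equiv.Perm FanoVertex))) (s : Finset FanoVertex),
      translateFace g s = s := by
    intro g s
    rw [Subsingleton.elim g 1, translateFace_eq_image]
    simp
  have hG₆ : ∀ s, s ∈ G₆.faces → ∃ s' ∈ K.faces, s'.map e.toEmbedding = s := by
    intro s hs
    have : (s.map e.symm.toEmbedding).map e.toEmbedding = s := by
      rw [Finset.map_map]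
      convert Finset.map_refl
      ext x
      simp
    exact ⟨s.map e.symm.toEmbedding, (he _).1 (by rwa [this]), this⟩
  refine ⟨?_, ?_, ?_, ?_, ?_, ?_⟩
  · intro s hs
    rw [image_equiv]
    have := (he s).2 hs
    rw [G₆, mem_graphComplex_iff exists_adj_G₆] at this
    rw [fanoComplex, mem_graphComplex_iff exists_adj_fano]
    refine this.imp_right ?_
    rintro ⟨z, w, h, hsub⟩
    exact ⟨z, w, (SimpleGraph.deleteEdges_le _ h), hsub⟩
  · intro i
    refine (isChamber_graphComplex_iff exists_adj_fano _).2
      ⟨.inl (missingPoint i), .inr (missingLine i), (fanoGraph_adj _ _).2 (missing_adj i).1, ?_⟩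
    ext x
    simp [mem_missingEdge]
  · intro i j hij g h
    rw [hone] at h
    exact hij (missingEdge_injective h)
  · intro i s hs h
    rw [image_equiv] at h
    have h' := (he s).2 hs
    have := h'.2.2 (.inl (missingPoint i)) (by rw [h]; simp [mem_missingEdge])
      (.inr (missingLine i)) (by rw [h]; simp [mem_missingEdge]) (by simp)
    rw [G₆Graph_adj, (missing_adj i).2] at this
    exact Bool.false_ne_true this
  · intro t ht
    obtain ⟨p, l, hpl, hsub⟩ := exists_flag_of_mem ht
    by_cases hmem : t ∈ G₆.faces
    · obtain ⟨s, hs, h⟩ := hG₆ t hmem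
      exact Or.inl ⟨s, hs, (image_equiv e s).trans h⟩
    · right
      have hG : ¬ G₆Adj (.inl p) (.inr l) = true := by
        intro h
        refine hmem ((mem_graphComplex_iff exists_adj_G₆ t).2
          ⟨ht.1, .inl p, .inr l, (G₆Graph_adj _ _).2 h, ?_⟩)
        intro x hx
        simpa using hsub x hx
      have hrem : removedAdj (.inl p) (.inr l) = true := by
        simpa [G₆Adj, hpl] using hG
      obtain ⟨i, rfl, rfl⟩ := (removedAdj_iff p l).1 hrem
      refine ⟨i, 1, ?_⟩
      rw [hone]
      rcases exists_pair_of_subset ht.1 (x := .inl (missingPoint i)) (y := .inr (missingLine i))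
        (fun x hx => by simpa using hsub x hx) with h | h | h
      -- Single vertices are never missing, since `G₆` keeps all vertices of the Fano graph.
      · exact absurd (h ▸ by simpa using G₆.singleton_mem _) hmem
      · exact absurd (h ▸ by simpa using G₆.singleton_mem _) hmem
      · ext x
        rw [h, mem_missingEdge]
        simp
  · intro p q _ _
    rw [sameOrbit_iff_of_subsingleton, sameOrbit_iff_of_subsingleton]
    exact (Finsupp.mapDomain_injective e.injective).eq_iff.symm

lemma isSphericalBuilding_fano : IsSphericalBuilding fanoComplex :=
  ⟨Fin 2, inferInstance, CoxeterMatrix.A 2, fanoApartments, finite_A₂_group, isApartmentSystem_fano⟩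

lemma isSphericalBuildingWithChambersMissing_link (x : Γ₆₃) :
    IsSphericalBuildingWithChambersMissing (link X₆₃ x) :=
  ⟨Finite.of_equiv _ (linkEquiv x), FanoVertex, fanoComplex, (⊥ : Subgroup (Equiv.Perm FanoVertex)),
    inferInstance, inferInstance, (linkEquiv x).symm, 3, missingEdge, isSphericalBuilding_fano,
    isFreeCofiniteAction_of_subsingleton _, isExtension_fano _ _ (simplicialIso_link x)⟩

lemma card_fanoAdj (z : FanoVertex) : Nat.card {w // fanoGraph.Adj z w} = 3 := by
  have : ∀ z : FanoVertex, Fintype.card {w // fanoAdj z w = true} = 3 := by decide +kernel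
  simp only [fanoGraph_adj]
  rw [Nat.card_eq_fintype_card]
  exact this z

lemma isA₂BuildingWithChambersMissing_G₆ : IsA₂BuildingWithChambersMissing G₆ 2 3 := by
  refine ⟨inferInstance, FanoVertex, fanoComplex, fanoApartments,
    (⊥ : Subgroup (Equiv.Perm FanoVertex)), inferInstance, inferInstance, id, missingEdge,
    isApartmentSystem_fano, ?_, isFreeCofiniteAction_of_subsingleton _,
    isExtension_fano G₆ (Equiv.refl _) ?_, _, ⟨_, isHexagon_remainingHexagon, rfl⟩, ?_⟩
  · intro x
    rw [fanoComplex, card_chambers_graphComplex exists_adj_fano, card_fanoAdj]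
  · intro s
    simp
  · rintro t ⟨hne, i, hi⟩
    refine ⟨t, (mem_graphComplex_iff exists_adj_G₆ t).2 ⟨hne, _, _, ?_, hi⟩, ?_⟩
    on_goal 2 => exact (image_equiv (Equiv.refl _) t).trans Finset.map_refl
    rw [G₆Graph_adj]
    revert i
    have : ∀ i, G₆Adj (remainingHexagon i) (remainingHexagon (i + 1)) = true := by
      decide +kernel
    exact fun i _ => this i

end

end ChambersMissing

/-! ### Distances and degrees in `G₆`, by enumeration -/

namespace ChambersMissing

/-- `w` is at distance at most `n` from `z` in `G₆`. -/
def within : ℕ → FanoVertex → FanoVertex → Bool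
  | 0, z, w => decide (z = w)
  | n + 1, z, w => decide (z = w) || decide (∃ u, (G₆Adj z u && within n u w) = true)

/-- The ends of the deficient edges at a vertex. -/
def missingEnd (k : Fin 3 × Bool) : FanoVertex :=
  if k.2 then .inl (missingPoint k.1) else .inr (missingLine k.1)

/-- A path of length at most four between the ends of a removed edge would close up to a circuit
shorter than the girth six of the Fano graph. For all other pairs the enumeration finds such a path.
-/
lemma within_missingEnd : ∀ k k' : Fin 3 × Bool, k ≠ k' →
    (within 4 (missingEnd k) (missingEnd k') = false ↔ k.1 = k'.1 ∧ k.2 ≠ k'.2) := by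
  decide +kernel

lemma nbInv_missingEnd : ∀ k : Fin 3 × Bool, nbInv (missingEnd k) = missingEnd (k.1, !k.2) := by
  decide +kernel

lemma missingEnd_injective : Function.Injective missingEnd := by
  have : ∀ k k', missingEnd k = missingEnd k' → k = k' := by decide +kernel
  exact fun k k' => this k k'

lemma card_G₆Adj_le_iff : ∀ z : FanoVertex,
    Fintype.card {w // G₆Adj z w = true} ≤ 2 ↔ ∃ k, z = missingEnd k := by
  decide +kernel

lemma card_G₆Adj_missingEnd : ∀ k, Fintype.card {w // G₆Adj (missingEnd k) w = true} = 2 := by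
  decide +kernel

noncomputable section

open scoped Classical

/-! ### The extension invariant -/

lemma within_of_walk {z w : FanoVertex} (p : G₆Graph.Walk z w) {n : ℕ} (hn : p.length ≤ n) :
    within n z w = true := by
  induction p generalizing n with
  | nil => cases n <;> simp [within]
  | @cons _ v _ h p ih =>
    obtain ⟨n, rfl⟩ : ∃ m, n = m + 1 := ⟨n - 1, by simp at hn; omega⟩
    rw [within, Bool.or_eq_true, decide_eq_true_eq, decide_eq_true_eq]
    refine Or.inr ⟨v, ?_⟩
    rw [Bool.and_eq_true]
    exact ⟨(G₆Graph_adj _ _).1 h, ih (by simpa using hn)⟩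

lemma edist_le_of_within {n : ℕ} {z w : FanoVertex} (h : within n z w = true) :
    G₆Graph.edist z w ≤ n := by
  induction n generalizing z with
  | zero =>
    obtain rfl : z = w := by simpa [within] using h
    simp
  | succ n ih =>
    rw [within, Bool.or_eq_true, decide_eq_true_eq, decide_eq_true_eq] at h
    rcases h with rfl | ⟨u, h⟩
    · simp
    · rw [Bool.and_eq_true] at h
      have h₁ : G₆Graph.edist z u = 1 :=
        SimpleGraph.edist_eq_one_iff_adj.2 ((G₆Graph_adj _ _).2 h.1)
      calc G₆Graph.edist z w ≤ G₆Graph.edist z u + G₆Graph.edist u w :=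
            SimpleGraph.edist_triangle
        _ ≤ 1 + n := by rw [h₁]; gcongr; exact ih h.2
        _ = ((n + 1 : ℕ) : ℕ∞) := by push_cast; ring

lemma five_le_edist_iff (z w : FanoVertex) :
    5 ≤ G₆Graph.edist z w ↔ within 4 z w = false := by
  constructor
  · intro h
    by_contra hw
    have := edist_le_of_within (Bool.not_eq_false _ ▸ hw : within 4 z w = true)
    exact absurd (h.trans this) (by decide)
  · intro h
    by_contra hlt
    rw [not_le] at hlt
    obtain ⟨p, hp⟩ := SimpleGraph.exists_walk_of_edist_ne_top (hlt.ne_top)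
    rw [← hp] at hlt
    have : p.length < 5 := by exact_mod_cast hlt
    rw [within_of_walk p (by omega)] at h
    exact Bool.noConfusion h

lemma edist_le_of_hom {V : Type u} {W : Type v} {G : SimpleGraph V} {H : SimpleGraph W}
    (f : G →g H) (x y : V) : H.edist (f x) (f y) ≤ G.edist x y := by
  by_cases h : G.edist x y = ⊤
  · simp [h]
  · obtain ⟨p, hp⟩ := SimpleGraph.exists_walk_of_edist_ne_top h
    rw [← hp, ← SimpleGraph.Walk.length_map f p]
    exact SimpleGraph.edist_le _

lemma edist_iso {V : Type u} {W : Type v} {G : SimpleGraph V} {H : SimpleGraph W}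
    (f : G ≃g H) (x y : V) : H.edist (f x) (f y) = G.edist x y := by
  refine le_antisymm (edist_le_of_hom f.toHom x y) ?_
  simpa using edist_le_of_hom f.symm.toHom (f x) (f y)

lemma oneSkeleton_adj {V : Type u} {K : AbstractSimplicialComplex V} {x y : V} :
    (oneSkeleton K).Adj x y ↔ x ≠ y ∧ ({x, y} : Finset V) ∈ K.faces := Iff.rfl

lemma map_pair_equiv {V : Type u} {W : Type v} (e : V ≃ W) (x y : V) :
    ({x, y} : Finset V).map e.toEmbedding = {e x, e y} := by
  simp

/-- The graph isomorphism of `G₆` and a link of `X₆₃`. -/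
def linkIso (x : Γ₆₃) : G₆Graph ≃g oneSkeleton (link X₆₃ x) where
  toEquiv := linkEquiv x
  map_rel_iff' := by
    intro z w
    rw [oneSkeleton_adj, ← map_pair_equiv, map_linkEquiv_mem_iff, (linkEquiv x).injective.ne_iff]
    constructor
    · rintro ⟨hne, h⟩
      exact (pair_mem_graphComplex_iff hne).1 h
    · intro h
      exact ⟨h.ne, pair_mem_graphComplex h⟩

lemma edist_link (x : Γ₆₃) (z w : FanoVertex) :
    (oneSkeleton (link X₆₃ x)).edist (linkEquiv x z) (linkEquiv x w) = G₆Graph.edist z w :=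
  edist_iso (linkIso x) z w

lemma linkOrder_X₆₃ (x : Γ₆₃) : linkOrder X₆₃ x = 2 := by
  have hcard : Nat.card (LinkVertex X₆₃ x) = 14 := by
    rw [← Nat.card_congr (linkEquiv x), Nat.card_eq_fintype_card]
    rfl
  have hsqrt : √(25 : ℝ) = 5 := by
    rw [show (25 : ℝ) = 5 ^ 2 by norm_num]
    exact Real.sqrt_sq (by norm_num)
  rw [linkOrder, hcard]
  norm_num [hsqrt]

lemma projectiveOrder_X₆₃ : projectiveOrder X₆₃ = 2 := by
  simp only [projectiveOrder, linkOrder_X₆₃, ciSup_const]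

lemma valency_X₆₃ (x : Γ₆₃) (z : FanoVertex) :
    valency X₆₃ {x, x * nb z} = Fintype.card {w // G₆Adj z w = true} := by
  rw [valency, ← Nat.card_eq_fintype_card]
  symm
  have hsub : ∀ w, ({x, x * nb z} : Finset Γ₆₃) ⊆ {x, x * nb z, x * nb w} := by
    intro w y
    simp only [Finset.mem_insert, Finset.mem_singleton]
    tauto
  refine Nat.card_congr (Equiv.ofBijective (fun w => ⟨{x, x * nb z, x * nb w.1},
    (isChamber_of_card_eq isPureOfDim_X₆₃).2 ⟨triangle_mem_faces w.2 x, card_triangle w.2 x⟩,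
    hsub w.1⟩) ⟨?_, ?_⟩)
  · rintro ⟨w, hw⟩ ⟨w', hw'⟩ h
    have h' : ({x, x * nb z, x * nb w} : Finset Γ₆₃) = {x, x * nb z, x * nb w'} :=
      congrArg Subtype.val h
    have : x * nb w ∈ ({x, x * nb z, x * nb w'} : Finset Γ₆₃) := h' ▸ by simp
    rcases mul_nb_mem_iff.1 this with h | h
    · exact absurd h.symm (G₆Adj_ne hw)
    · exact Subtype.ext h
  · rintro ⟨t, ht, hxt⟩
    obtain ⟨htf, hcard⟩ := (isChamber_of_card_eq isPureOfDim_X₆₃).1 ht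
    obtain ⟨a, b, hab, hsub⟩ := (mem_faces_X₆₃_iff_of_mem (hxt (show x ∈ _ by simp))).1 htf
    have heq : t = {x, x * nb a, x * nb b} :=
      Finset.eq_of_subset_of_card_le hsub (by rw [hcard, card_triangle hab])
    subst heq
    rcases mul_nb_mem_iff.1 (hxt (show x * nb z ∈ _ by simp)) with rfl | rfl
    · exact ⟨⟨b, hab⟩, rfl⟩
    · refine ⟨⟨a, by rwa [G₆Adj_comm]⟩, Subtype.ext ?_⟩
      ext y
      simp only [Finset.mem_insert, Finset.mem_singleton]
      tauto

/-- The valency of an edge is a degree in `G₆`, and the vertices of degree two are the ends of the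
removed edges. So the deficient edges are the short diagonals. -/
lemma isDeficientEdge_iff (x y : Γ₆₃) :
    IsDeficientEdge X₆₃ {x, y} ↔ ∃ k, y = x * nb (missingEnd k) := by
  rw [IsDeficientEdge, projectiveOrder_X₆₃]
  constructor
  · rintro ⟨h, hcard, hval⟩
    have hne : y ≠ x := by
      rintro rfl
      simp at hcard
    obtain ⟨z, rfl⟩ := (pair_mem_faces_iff hne).1 h
    rw [valency_X₆₃] at hval
    obtain ⟨k, rfl⟩ := (card_G₆Adj_le_iff z).1 (by exact_mod_cast hval)
    exact ⟨k, rfl⟩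
  · rintro ⟨k, rfl⟩
    refine ⟨edge_mem_faces _ _, Finset.card_pair (by simp [nb_ne_one]), ?_⟩
    rw [valency_X₆₃]
    exact_mod_cast (card_G₆Adj_le_iff _).2 ⟨k, rfl⟩

lemma IsDeficientEdge.exists_eq {e : Finset Γ₆₃} (he : IsDeficientEdge X₆₃ e) :
    ∃ x i, e = {x, x * nb (missingEnd (i, true))} := by
  obtain ⟨x, y, -, rfl⟩ := Finset.card_eq_two.1 he.2.1
  obtain ⟨⟨i, b⟩, rfl⟩ := (isDeficientEdge_iff x y).1 he
  cases b with
  | true => exact ⟨x, i, rfl⟩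
  | false =>
    refine ⟨x * nb (missingEnd (i, false)), i, ?_⟩
    have : missingEnd (i, true) = nbInv (missingEnd (i, false)) := by rw [nbInv_missingEnd]; rfl
    rw [this, nb_nbInv, mul_inv_cancel_right, Finset.pair_comm]

lemma valency_of_isDeficientEdge {e : Finset Γ₆₃} (he : IsDeficientEdge X₆₃ e) :
    valency X₆₃ e = 2 := by
  obtain ⟨x, i, rfl⟩ := he.exists_eq
  rw [valency_X₆₃, card_G₆Adj_missingEnd]

/-- The extension invariant of `(X₆₃, Γ₆₃)`. -/
abbrev invariantX₆₃ : LabelledGraph := extensionInvariant X₆₃ Γ₆₃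

/-- The orbits of deficient ends. -/
def endClass (k : Fin 3 × Bool) : invariantX₆₃.V :=
  Quot.mk _ ⟨(1, 1 * nb (missingEnd k)), (isDeficientEdge_iff _ _).2 ⟨k, rfl⟩⟩

/-- The orbits of deficient edges. -/
def edgeClass (i : Fin 3) : invariantX₆₃.E₀ :=
  Quot.mk _ ⟨{1, 1 * nb (missingEnd (i, true))}, (isDeficientEdge_iff _ _).2 ⟨(i, true), rfl⟩⟩

lemma mk_eq_endClass {k : Fin 3 × Bool} {x y : Γ₆₃} (h : IsDeficientEdge X₆₃ {x, y})
    (hy : y = x * nb (missingEnd k)) :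
    (Quot.mk _ ⟨(x, y), h⟩ : invariantX₆₃.V) = endClass k := by
  subst hy
  symm
  apply Quot.sound
  exact ⟨x, by simp⟩

lemma mk_eq_edgeClass {i : Fin 3} {e : Finset Γ₆₃} (h : IsDeficientEdge X₆₃ e) {x : Γ₆₃}
    (he : e = {x, x * nb (missingEnd (i, true))}) :
    (Quot.mk _ ⟨e, h⟩ : invariantX₆₃.E₀) = edgeClass i := by
  subst he
  symm
  apply Quot.sound
  refine ⟨x, ?_⟩
  rw [translateFace_eq_image]
  simp [Finset.image_insert]

lemma mk_edge_eq {k : Fin 3 × Bool} (d : DeficientEnd X₆₃)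
    (hy : d.1.2 = d.1.1 * nb (missingEnd k)) :
    (Quot.mk _ d.edge : invariantX₆₃.E₀) = edgeClass k.1 := by
  obtain ⟨i, b⟩ := k
  cases b with
  | true => exact mk_eq_edgeClass _ (x := d.1.1) (by rw [hy])
  | false =>
    have : missingEnd (i, true) = nbInv (missingEnd (i, false)) := by rw [nbInv_missingEnd]; rfl
    refine mk_eq_edgeClass _ (x := d.1.2) ?_
    rw [this, nb_nbInv, hy, mul_inv_cancel_right, Finset.pair_comm]

/-- The element of the group which maps the first vertex of an end to the second one. -/
def endStep : invariantX₆₃.V → Γ₆₃ :=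
  Quot.lift (fun d : DeficientEnd X₆₃ => d.1.1⁻¹ * d.1.2) (by
    rintro d d' ⟨g, hg⟩
    rw [← hg]
    simp [mul_assoc])

lemma endStep_endClass (k : Fin 3 × Bool) : endStep (endClass k) = nb (missingEnd k) := by
  change (1 : Γ₆₃)⁻¹ * (1 * nb (missingEnd k)) = _
  simp

/-- Classes are separated by `endStep`, which is invariant under left translation; surjectivity is
`isDeficientEdge_iff`. -/
lemma endClass_bijective : Function.Bijective endClass := by
  constructor
  · intro k k' h
    have := congrArg endStep h
    rw [endStep_endClass, endStep_endClass] at this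
    exact missingEnd_injective (nb_injective this)
  · intro o
    obtain ⟨⟨⟨x, y⟩, h⟩, rfl⟩ := Quot.exists_rep o
    obtain ⟨k, hk⟩ := (isDeficientEdge_iff x y).1 h
    exact ⟨k, (mk_eq_endClass h hk).symm⟩

/-- The differences of the ends of an edge. -/
def edgeSteps : invariantX₆₃.E₀ → Set Γ₆₃ :=
  Quot.lift (fun e : DeficientEdge X₆₃ => {h | ∃ x ∈ e.1, ∃ y ∈ e.1, h = x⁻¹ * y}) (by
    rintro e e' ⟨g, hg⟩
    rw [← hg, translateFace_eq_image]
    ext h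
    simp only [Set.mem_ofPred_eq, Finset.exists_mem_image]
    simp [mul_assoc])

lemma edgeClass_bijective : Function.Bijective edgeClass := by
  constructor
  · intro i j h
    have hmem : nb (missingEnd (i, true)) ∈ edgeSteps (edgeClass i) :=
      ⟨1, by simp, 1 * nb (missingEnd (i, true)), by simp, by simp⟩
    rw [h] at hmem
    obtain ⟨x, hx, y, hy, hxy⟩ := hmem
    simp only [Finset.mem_insert, Finset.mem_singleton, one_mul] at hx hy
    rcases hx with rfl | rfl <;> rcases hy with rfl | rfl
    · exact absurd hxy (by simpa using nb_ne_one _)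
    · have := missingEnd_injective (nb_injective (by simpa using hxy))
      exact congrArg Prod.fst this
    -- An edge traversed backwards gives the inverse step, which belongs to the same removed edge.
    · rw [mul_one, ← nb_nbInv, nbInv_missingEnd] at hxy
      exact congrArg Prod.fst (missingEnd_injective (nb_injective hxy))
    · exact absurd hxy (by simpa using nb_ne_one _)
  · intro ε
    obtain ⟨⟨e, he⟩, rfl⟩ := Quot.exists_rep ε
    obtain ⟨x, i, hi⟩ := he.exists_eq
    exact ⟨i, (mk_eq_edgeClass he hi).symm⟩

lemma inc_iff (k : Fin 3 × Bool) (i : Fin 3) :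
    invariantX₆₃.Inc (endClass k) (edgeClass i) ↔ k.1 = i := by
  constructor
  · rintro ⟨d, hd, hε⟩
    obtain ⟨k', hk'⟩ := (isDeficientEdge_iff _ _).1 d.2
    have h := hd.trans (mk_eq_endClass d.2 hk')
    obtain rfl := endClass_bijective.1 h
    rw [mk_edge_eq d hk'] at hε
    exact (edgeClass_bijective.1 hε).symm
  · rintro rfl
    exact ⟨_, rfl, (mk_edge_eq _ rfl).symm⟩

lemma adj_iff (k k' : Fin 3 × Bool) :
    invariantX₆₃.E₁.Adj (endClass k) (endClass k') ↔ k.1 = k'.1 ∧ k.2 ≠ k'.2 := by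
  constructor
  · rintro ⟨hne, x, y, z, hy, hz, ho, ho', hdist⟩
    obtain ⟨a, ha⟩ := (isDeficientEdge_iff _ _).1 hy
    obtain ⟨b, hb⟩ := (isDeficientEdge_iff _ _).1 hz
    obtain rfl := endClass_bijective.1 (ho.trans (mk_eq_endClass hy ha))
    obtain rfl := endClass_bijective.1 (ho'.trans (mk_eq_endClass hz hb))
    obtain rfl : y = linkEquiv x (missingEnd k) := Subtype.ext ha
    obtain rfl : z = linkEquiv x (missingEnd k') := Subtype.ext hb
    rw [edist_link, five_le_edist_iff] at hdist
    exact (within_missingEnd k k' (fun h => hne (congrArg _ h))).1 hdist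
  · intro h
    have hne : k ≠ k' := fun h' => h.2 (congrArg _ h')
    refine ⟨fun h' => hne (endClass_bijective.1 h'), 1, linkEquiv 1 (missingEnd k),
      linkEquiv 1 (missingEnd k'), (isDeficientEdge_iff _ _).2 ⟨k, rfl⟩,
      (isDeficientEdge_iff _ _).2 ⟨k', rfl⟩, rfl, rfl, ?_⟩
    rw [edist_link, five_le_edist_iff]
    exact (within_missingEnd k k' hne).2 h

lemma LabelledGraph.iso_of_bijective {O O' : LabelledGraph} (a : O'.V → O.V) (b : O'.E₀ → O.E₀)
    (ha : Function.Bijective a) (hb : Function.Bijective b)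
    (hinc : ∀ k i, O.Inc (a k) (b i) ↔ O'.Inc k i) (hlabel : ∀ i, O.label (b i) = O'.label i)
    (hadj : ∀ k k', O.E₁.Adj (a k) (a k') ↔ O'.E₁.Adj k k') : O.Iso O' := by
  have hsa : ∀ k, (Equiv.ofBijective a ha).symm (a k) = k :=
    (Equiv.ofBijective a ha).symm_apply_apply
  have hsb : ∀ i, (Equiv.ofBijective b hb).symm (b i) = i :=
    (Equiv.ofBijective b hb).symm_apply_apply
  refine ⟨(Equiv.ofBijective a ha).symm, (Equiv.ofBijective b hb).symm, ?_, ?_, ?_⟩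
  · intro o ε
    obtain ⟨k, rfl⟩ := ha.2 o
    obtain ⟨i, rfl⟩ := hb.2 ε
    rw [hsa, hsb, hinc]
  · intro ε
    obtain ⟨i, rfl⟩ := hb.2 ε
    rw [hsb, hlabel]
  · intro o o'
    obtain ⟨k, rfl⟩ := ha.2 o
    obtain ⟨k', rfl⟩ := ha.2 o'
    rw [hsa, hsa, hadj]

/-- The representative used by the label is irrelevant: every deficient edge has valency two. -/
lemma label_eq (ε : invariantX₆₃.E₀) : invariantX₆₃.label ε = 1 := by
  change projectiveOrder X₆₃ - valency X₆₃ ε.out.1 + 1 = 1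
  rw [projectiveOrder_X₆₃, valency_of_isDeficientEdge ε.out.2]
  norm_num

lemma extensionInvariant_iso : (extensionInvariant X₆₃ Γ₆₃).Iso threeDigons :=
  LabelledGraph.iso_of_bijective (O' := threeDigons) endClass edgeClass endClass_bijective
    edgeClass_bijective inc_iff (fun i => label_eq (edgeClass i)) adj_iff

end

end ChambersMissing

namespace ChambersMissing

noncomputable section

open scoped Classical

/-! ### Links of vertices in buildings of rank three -/

section Building

variable {B : Type} {M : CoxeterMatrix B} {V : Type u} {X : AbstractSimplicialComplex V}
  {A : Set (PreAbstractSimplicialComplex V)}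

/-- The vertices of an apartment, given by their type and a chamber containing them. -/
structure IsApartmentChart (M : CoxeterMatrix B) (S : PreAbstractSimplicialComplex V)
    (F : B → M.Group → V) : Prop where
  eq_iff : ∀ i w w', F i w = F i w' ↔ w⁻¹ * w' ∈ maxParabolic M i
  type_eq : ∀ i j w w', F i w = F j w' → i = j
  mem_faces_iff : ∀ s : Finset V, s ∈ S.faces ↔ s.Nonempty ∧ ∃ w, ∀ x ∈ s, ∃ i, x = F i w

lemma IsApartmentSystem.exists_chart (hA : IsApartmentSystem M X A)
    {S : PreAbstractSimplicialComplex V} (hS : S ∈ A) : ∃ F, IsApartmentChart M S F := by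
  obtain ⟨f, hf⟩ := hA.coxeter S hS
  refine ⟨fun i w => f ⟨i, w⟩, ?_, ?_, ?_⟩
  · intro i w w'
    rw [f.injective.eq_iff, vertex_mk_eq_iff]
  · intro i j w w' h
    exact congrArg Sigma.fst (f.injective h)
  · intro s
    rw [hf]
    constructor
    · rintro ⟨t, ⟨hne, w, hw⟩, rfl⟩
      refine ⟨by simpa using hne, w, fun x hx => ?_⟩
      obtain ⟨c, hc, rfl⟩ := Finset.mem_map.1 hx
      exact ⟨c.1, by rw [← hw c hc]⟩
    · rintro ⟨hne, w, hw⟩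
      have hsub : s ⊆ (s.preimage f f.injective.injOn).map f := by
        intro x hx
        obtain ⟨i, rfl⟩ := hw x hx
        exact Finset.mem_map_of_mem _ (Finset.mem_preimage.2 hx)
      have heq : (s.preimage f f.injective.injOn).map f = s := by
        refine Finset.Subset.antisymm ?_ hsub
        intro x hx
        obtain ⟨c, hc, rfl⟩ := Finset.mem_map.1 hx
        exact Finset.mem_preimage.1 hc
      refine ⟨s.preimage f f.injective.injOn, ⟨?_, w, ?_⟩, heq⟩
      · rw [← Finset.map_nonempty (f := f), heq]
        exact hne
      · rintro ⟨j, c⟩ hc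
        obtain ⟨i, hi⟩ := hw _ (Finset.mem_preimage.1 hc)
        have := f.injective hi
        rw [this]

lemma IsApartmentSystem.card_le [Fintype B] (hA : IsApartmentSystem M X A) {s : Finset V}
    (hs : s ∈ X.faces) : s.card ≤ Fintype.card B := by
  obtain ⟨S, hS, hsS, -⟩ := hA.common s hs s hs
  obtain ⟨F, hF⟩ := hA.exists_chart hS
  obtain ⟨-, w, hw⟩ := (hF.mem_faces_iff s).1 hsS
  have hsub : s ⊆ Finset.univ.image fun i => F i w := by
    intro x hx
    obtain ⟨i, rfl⟩ := hw x hx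
    exact Finset.mem_image_of_mem _ (Finset.mem_univ i)
  exact (Finset.card_le_card hsub).trans Finset.card_image_le

lemma IsApartmentSystem.exists_chamber [Fintype B] (hA : IsApartmentSystem M X A) {s : Finset V}
    (hs : s ∈ X.faces) : ∃ t ∈ X.faces, s ⊆ t ∧ t.card = Fintype.card B := by
  obtain ⟨S, hS, hsS, -⟩ := hA.common s hs s hs
  obtain ⟨F, hF⟩ := hA.exists_chart hS
  obtain ⟨hne, w, hw⟩ := (hF.mem_faces_iff s).1 hsS
  have hsub : s ⊆ Finset.univ.image fun i => F i w := by
    intro x hx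
    obtain ⟨i, rfl⟩ := hw x hx
    exact Finset.mem_image_of_mem _ (Finset.mem_univ i)
  refine ⟨Finset.univ.image fun i => F i w, hA.subcomplex S hS ?_, hsub, ?_⟩
  · refine (hF.mem_faces_iff _).2 ⟨hne.mono hsub, w, fun x hx => ?_⟩
    obtain ⟨i, -, rfl⟩ := Finset.mem_image.1 hx
    exact ⟨i, rfl⟩
  · rw [Finset.card_image_of_injective _ fun i j h => hF.type_eq i j w w h, Finset.card_univ]

lemma IsApartmentSystem.card_chamber [Fintype B] (hA : IsApartmentSystem M X A) {s : Finset V}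
    (hs : IsChamber X s) : s.card = Fintype.card B := by
  obtain ⟨t, ht, hst, hcard⟩ := hA.exists_chamber hs.1
  rw [hs.eq_of_le ht hst, hcard]

/-- `a` and `b` are adjacent in the link of `v`. -/
def LinkAdj (K : PreAbstractSimplicialComplex V) (v a b : V) : Prop :=
  a ≠ v ∧ b ≠ v ∧ a ≠ b ∧ ({v, a, b} : Finset V) ∈ K.faces

lemma LinkAdj.symm {K : PreAbstractSimplicialComplex V} {v a b : V} (h : LinkAdj K v a b) :
    LinkAdj K v b a :=
  ⟨h.2.1, h.1, h.2.2.1.symm, by rw [Finset.pair_comm]; exact h.2.2.2⟩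

/-- `e` is a cyclic enumeration of the link of `v` in `S`, a cycle with `2 m` edges, or a line
if `m = 0`. -/
structure IsLinkCycle (S : PreAbstractSimplicialComplex V) (v : V) (m : ℕ) (e : ℤ → V) : Prop where
  eq_iff : ∀ s t, e s = e t ↔ (2 * m : ℤ) ∣ t - s
  adj_iff : ∀ a b, LinkAdj S v a b ↔ ∃ t, (a = e t ∧ b = e (t + 1)) ∨ (b = e t ∧ a = e (t + 1))

lemma IsLinkCycle.adj {S : PreAbstractSimplicialComplex V} {v : V} {m : ℕ} {e : ℤ → V}
    (he : IsLinkCycle S v m e) (t : ℤ) : LinkAdj S v (e t) (e (t + 1)) :=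
  (he.adj_iff _ _).2 ⟨t, Or.inl ⟨rfl, rfl⟩⟩

lemma IsLinkCycle.shift {S : PreAbstractSimplicialComplex V} {v : V} {m : ℕ} {e : ℤ → V}
    (he : IsLinkCycle S v m e) (c : ℤ) : IsLinkCycle S v m fun t => e (c + t) where
  eq_iff s t := by rw [he.eq_iff, show c + t - (c + s) = t - s by ring]
  adj_iff a b := by
    rw [he.adj_iff]
    constructor
    · rintro ⟨t, ht⟩
      exact ⟨t - c, by rwa [show c + (t - c) = t by ring, show c + (t - c + 1) = t + 1 by ring]⟩
    · rintro ⟨t, ht⟩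
      exact ⟨c + t, by rwa [add_assoc]⟩

lemma IsLinkCycle.reflect {S : PreAbstractSimplicialComplex V} {v : V} {m : ℕ} {e : ℤ → V}
    (he : IsLinkCycle S v m e) (c : ℤ) : IsLinkCycle S v m fun t => e (c - t) where
  eq_iff s t := by
    rw [he.eq_iff, show c - t - (c - s) = -(t - s) by ring, dvd_neg]
  adj_iff a b := by
    rw [he.adj_iff]
    constructor
    · rintro ⟨t, ht⟩
      refine ⟨c - t - 1, ?_⟩
      rw [show c - (c - t - 1) = t + 1 by ring, show c - (c - t - 1 + 1) = t by ring]
      tauto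
    · rintro ⟨t, ht⟩
      refine ⟨c - (t + 1), ?_⟩
      rw [show c - (t + 1) + 1 = c - t by ring]
      tauto

/-- An enumeration of the link which starts with a given edge. -/
lemma IsLinkCycle.exists_start {S : PreAbstractSimplicialComplex V} {v : V} {m : ℕ} {e : ℤ → V}
    (he : IsLinkCycle S v m e) {a b : V} (h : LinkAdj S v a b) :
    ∃ e', IsLinkCycle S v m e' ∧ e' 0 = a ∧ e' 1 = b := by
  obtain ⟨t, ⟨rfl, rfl⟩ | ⟨rfl, rfl⟩⟩ := (he.adj_iff a b).1 h
  · exact ⟨_, he.shift t, by simp, rfl⟩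
  · exact ⟨_, he.reflect (t + 1), by simp, by simp⟩

lemma maxParabolic_eq_closure_pair [Fintype B] (hB : Fintype.card B = 3) {i j k : B}
    (hij : i ≠ j) (hik : i ≠ k) (hjk : j ≠ k) :
    maxParabolic M i = Subgroup.closure {M.simple j, M.simple k} ∧
      ∀ l, l = i ∨ l = j ∨ l = k := by
  have huniv : ({i, j, k} : Finset B) = Finset.univ := by
    apply Finset.eq_univ_of_card
    rw [hB, Finset.card_eq_three]
    exact ⟨i, j, k, hij, hik, hjk, rfl⟩
  have hl : ∀ l, l = i ∨ l = j ∨ l = k := fun l => by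
    have := Finset.mem_univ l
    rw [← huniv] at this
    simpa using this
  refine ⟨?_, hl⟩
  have : {l | l ≠ i} = {j, k} := by
    ext l
    simp only [Set.mem_ofPred_eq, Set.mem_insert_iff, Set.mem_singleton_iff]
    constructor
    · intro h
      exact (hl l).resolve_left h
    · rintro (rfl | rfl)
      exacts [hij.symm, hik.symm]
  rw [maxParabolic, this, Set.image_pair]

/-- In rank three the chambers of the apartment at a vertex of type `i` form a coset of the
parabolic generated by the other two reflections, which `coxeterPath` enumerates. -/
lemma IsApartmentChart.exists_linkCycle [Fintype B] (hB : Fintype.card B = 3)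
    {S : PreAbstractSimplicialComplex V} {F : B → M.Group → V} (hF : IsApartmentChart M S F)
    {v x y : V} (h : LinkAdj S v x y) :
    ∃ m e, m ≠ 1 ∧ IsLinkCycle S v m e ∧ e 0 = x ∧ e 1 = y := by
  obtain ⟨hxv, hyv, hxy, hface⟩ := h
  obtain ⟨-, w, hw⟩ := (hF.mem_faces_iff _).1 hface
  obtain ⟨i, rfl⟩ := hw v (by simp)
  obtain ⟨j, rfl⟩ := hw x (by simp)
  obtain ⟨k, rfl⟩ := hw y (by simp)
  have hij : i ≠ j := by rintro rfl; exact hxv rfl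
  have hik : i ≠ k := by rintro rfl; exact hyv rfl
  have hjk : j ≠ k := by rintro rfl; exact hxy rfl
  obtain ⟨hP, hl⟩ := maxParabolic_eq_closure_pair (M := M) hB hij hik hjk
  have hFF : ∀ {i j : B} {w w' : M.Group}, F i w = F j w' ↔
      (⟨i, w⟩ : CoxeterVertex M) = ⟨j, w'⟩ := by
    intro i j w w'
    constructor
    · intro h
      obtain rfl := hF.type_eq _ _ _ _ h
      exact (vertex_mk_eq_iff M w w').2 ((hF.eq_iff _ _ _).1 h)
    · intro h
      obtain rfl := congrArg Sigma.fst h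
      exact (hF.eq_iff _ _ _).2 ((vertex_mk_eq_iff M w w').1 h)
  -- The chart descends to cosets; `hG` removes the choice of representative.
  let G : CoxeterVertex M → V := fun c => F c.1 (Quotient.out c.2)
  have hG : ∀ i (w : M.Group), G ⟨i, w⟩ = F i w := by
    intro i w
    refine hFF.2 ?_
    congr 1
    exact QuotientGroup.out_eq' _
  have hGinj : Function.Injective G := by
    rintro ⟨i, c⟩ ⟨j, d⟩ h
    obtain ⟨w, rfl⟩ := QuotientGroup.mk_surjective c
    obtain ⟨w', rfl⟩ := QuotientGroup.mk_surjective d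
    rw [hG, hG] at h
    exact hFF.1 h
  have hpath := coxeterPath_eq_iff M w hjk
  refine ⟨M j k, fun t => G (coxeterPath M w j k t), M.off_diagonal j k hjk, ⟨?_, ?_⟩, ?_, ?_⟩
  · intro s t
    rw [hGinj.eq_iff, hpath]
  · intro a b
    constructor
    · rintro ⟨hav, hbv, hab, hface'⟩
      obtain ⟨-, w', hw'⟩ := (hF.mem_faces_iff _).1 hface'
      obtain ⟨i', hi'⟩ := hw' (F i w) (by simp)
      obtain rfl := hF.type_eq _ _ _ _ hi'
      obtain ⟨a', rfl⟩ := hw' a (by simp)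
      obtain ⟨b', rfl⟩ := hw' b (by simp)
      have hp := (hF.eq_iff _ _ _).1 hi'
      rw [hP] at hp
      obtain ⟨t, ht⟩ := exists_coxeterPath_of_mem M w hjk hp
      rw [mul_inv_cancel_left] at ht
      have ha' : a' ≠ i := by rintro rfl; exact hav hi'.symm
      have hb' : b' ≠ i := by rintro rfl; exact hbv hi'.symm
      have hab' : a' ≠ b' := by rintro rfl; exact hab rfl
      refine ⟨t, ?_⟩
      rcases (hl a').resolve_left ha' with rfl | rfl <;>
        rcases (hl b').resolve_left hb' with rfl | rfl
      · exact absurd rfl hab'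
      · rcases ht with ⟨h₁, h₂⟩ | ⟨h₁, h₂⟩
        · exact Or.inl (by rw [← h₁, ← h₂, hG, hG]; exact ⟨rfl, rfl⟩)
        · exact Or.inr (by rw [← h₁, ← h₂, hG, hG]; exact ⟨rfl, rfl⟩)
      · rcases ht with ⟨h₁, h₂⟩ | ⟨h₁, h₂⟩
        · exact Or.inr (by rw [← h₁, ← h₂, hG, hG]; exact ⟨rfl, rfl⟩)
        · exact Or.inl (by rw [← h₁, ← h₂, hG, hG]; exact ⟨rfl, rfl⟩)
      · exact absurd rfl hab'
    · have key : ∀ t : ℤ, LinkAdj S (F i w) (G (coxeterPath M w j k t))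
          (G (coxeterPath M w j k (t + 1))) := by
        intro t
        obtain ⟨p, hp, ht⟩ := exists_chamber_of_coxeterPath M w hjk t
        rw [← hP] at hp
        have hv : F i w = F i (w * p) := (hF.eq_iff _ _ _).2 (by simpa using hp)
        have hadj : ∀ j k, i ≠ j → i ≠ k → j ≠ k →
            LinkAdj S (F i (w * p)) (F j (w * p)) (F k (w * p)) := by
          intro j k hij hik hjk
          refine ⟨fun h => hij (hF.type_eq _ _ _ _ h).symm,
            fun h => hik (hF.type_eq _ _ _ _ h).symm, fun h => hjk (hF.type_eq _ _ _ _ h),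
            (hF.mem_faces_iff _).2 ⟨by simp, w * p, ?_⟩⟩
          intro x hx
          simp only [Finset.mem_insert, Finset.mem_singleton] at hx
          rcases hx with rfl | rfl | rfl
          exacts [⟨_, rfl⟩, ⟨_, rfl⟩, ⟨_, rfl⟩]
        rw [hv]
        rcases ht with ⟨h₁, h₂⟩ | ⟨h₁, h₂⟩
        · rw [← h₁, ← h₂, hG, hG]
          exact hadj j k hij hik hjk
        · rw [← h₁, ← h₂, hG, hG]
          exact hadj k j hik hij hjk.symm
      rintro ⟨t, ⟨rfl, rfl⟩ | ⟨rfl, rfl⟩⟩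
      · exact key t
      · exact (key t).symm
  · have := coxeterPath_two_mul M w j k 0
    dsimp only
    rw [← hG, ← mul_zero (2 : ℤ), this]
    simp
  · have := coxeterPath_two_mul_add_one M w j k 0
    dsimp only
    rw [← hG, ← zero_add (1 : ℤ), ← mul_zero (2 : ℤ), this]
    simp

end Building

end

end ChambersMissing

/-! ### Comparison of apartments along a link, and retraction -/

namespace ChambersMissing

noncomputable section

open scoped Classical

section Building

variable {B : Type} {M : CoxeterMatrix B} {V : Type u} {X : AbstractSimplicialComplex V}
  {A : Set (PreAbstractSimplicialComplex V)}

/-- Two enumerations of the link in two apartments, starting with the same edge, agree on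
common vertices. -/
lemma IsApartmentSystem.linkCycle_agree (hA : IsApartmentSystem M X A)
    {S S' : PreAbstractSimplicialComplex V} (hS : S ∈ A) (hS' : S' ∈ A) {v : V} {m m' : ℕ}
    {e e' : ℤ → V} (he : IsLinkCycle S v m e) (he' : IsLinkCycle S' v m' e') (hm : m ≠ 1)
    (h0 : e 0 = e' 0) (h1 : e 1 = e' 1) {i j : ℤ} (hij : e i = e' j) :
    m = m' ∧ (2 * m : ℤ) ∣ j - i := by
  have hsingle : ∀ {S : PreAbstractSimplicialComplex V} {e : ℤ → V} {m : ℕ},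
      IsLinkCycle S v m e → ∀ t, ({e t} : Finset V) ∈ S.faces := by
    intro S e m he t
    exact (S.isRelLowerSet_faces (he.adj t).2.2.2).2 (by simp) (by simp)
  have hbase : ({v, e 0, e 1} : Finset V) ∈ S.faces := (he.adj 0).2.2.2
  have hbase' : ({v, e 0, e 1} : Finset V) ∈ S'.faces := by
    rw [h0, h1]
    exact (he'.adj 0).2.2.2
  -- The isomorphism fixes the initial triangle and also the common vertex whose two positions are
  -- compared.
  obtain ⟨φ, hinj, hφ, hfix, hfix'⟩ := hA.exchange S hS S' hS' _ {e i} hbase (hsingle he i)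
    hbase' (hij ▸ hsingle he' j)
  have fv : φ v = v := hfix v (by simp)
  have f0 : φ (e 0) = e 0 := hfix _ (by simp)
  have f1 : φ (e 1) = e 1 := hfix _ (by simp)
  have fi : φ (e i) = e i := hfix' _ (by simp)
  have hv : ({v} : Finset V) ∈ S.faces :=
    (S.isRelLowerSet_faces hbase).2 (by simp) (by simp)
  have hne : ∀ t, φ (e t) ≠ v := by
    intro t h
    exact (he.adj t).1 (hinj (hsingle he t) hv (h.trans fv.symm))
  have heq : ∀ s t, φ (e s) = φ (e t) → e s = e t := fun s t h =>
    hinj (hsingle he s) (hsingle he t) h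
  have hadj : ∀ t, LinkAdj S' v (φ (e t)) (φ (e (t + 1))) := by
    intro t
    refine ⟨hne _, hne _, fun h => (he.adj t).2.2.1 (heq _ _ h), ?_⟩
    refine (hφ _).2 ⟨_, (he.adj t).2.2.2, ?_⟩
    rw [Finset.image_insert, Finset.image_insert, Finset.image_singleton, fv]
  have hdvd : ¬ (2 * m : ℤ) ∣ 2 := by
    intro h
    rw [show (2 : ℤ) = 2 * 1 by norm_num, mul_assoc, one_mul,
      mul_dvd_mul_iff_left two_ne_zero] at h
    exact hm (by exact_mod_cast Int.eq_one_of_dvd_one (by positivity) h)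
  -- Here `m ≠ 1` enters: the enumeration never backtracks, so its image under `φ` is determined by
  -- its first edge.
  have hstep : ∀ s : ℤ, e s ≠ e (s + 2) := by
    intro s h
    rw [he.eq_iff] at h
    exact hdvd (by simpa using h)
  have hnext : ∀ t s : ℤ, φ (e t) = e' s → φ (e (t + 1)) = e' (s + 1) →
      φ (e (t + 2)) = e' (s + 2) := by
    intro t s hs hs'
    have := hadj (t + 1)
    rw [add_assoc, one_add_one_eq_two, hs'] at this
    obtain ⟨r, ⟨h₁, h₂⟩ | ⟨h₁, h₂⟩⟩ := (he'.adj_iff _ _).1 this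
    · rw [h₂, he'.eq_iff]
      rw [he'.eq_iff] at h₁
      rw [show s + 2 - (r + 1) = -(r - (s + 1)) by ring]
      exact h₁.neg_right
    · exfalso
      rw [he'.eq_iff] at h₂
      have h₃ : e' r = e' s := by
        rw [he'.eq_iff, show s - r = -(r + 1 - (s + 1)) by ring]
        exact h₂.neg_right
      exact hstep t (heq _ _ (by rw [h₁, h₃, hs]))
  have hprev : ∀ t s : ℤ, φ (e t) = e' s → φ (e (t + 1)) = e' (s + 1) →
      φ (e (t - 1)) = e' (s - 1) := by
    intro t s hs hs'
    have := hadj (t - 1)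
    rw [sub_add_cancel, hs] at this
    obtain ⟨r, ⟨h₁, h₂⟩ | ⟨h₁, h₂⟩⟩ := (he'.adj_iff _ _).1 this
    · rw [h₁, he'.eq_iff]
      rw [he'.eq_iff] at h₂
      rw [show s - 1 - r = -(r + 1 - s) by ring]
      exact h₂.neg_right
    · exfalso
      rw [he'.eq_iff] at h₁
      have h₃ : e' (r + 1) = e' (s + 1) := by
        rw [he'.eq_iff, show s + 1 - (r + 1) = -(r - s) by ring]
        exact h₁.neg_right
      refine hstep (t - 1) (heq _ _ ?_)
      rw [h₂, h₃, ← hs']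
      congr 2
      ring
  -- Two consecutive vertices are carried along, because the next one is determined only once the
  -- direction is known.
  have hall : ∀ t : ℤ, φ (e t) = e' t ∧ φ (e (t + 1)) = e' (t + 1) := by
    intro t
    induction t using Int.induction_on with
    | zero => exact ⟨f0.trans h0, by simpa using f1.trans h1⟩
    | succ n ih =>
      refine ⟨ih.2, ?_⟩
      rw [add_assoc, one_add_one_eq_two]
      exact hnext _ _ ih.1 ih.2
    | pred n ih =>
      refine ⟨hprev _ _ ih.1 ih.2, ?_⟩
      rw [sub_add_cancel]
      exact ih.1
  have hperiod : ∀ n : ℤ, (2 * m : ℤ) ∣ n ↔ (2 * m' : ℤ) ∣ n := by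
    intro n
    have h₁ := he.eq_iff 0 n
    have h₂ := he'.eq_iff 0 n
    rw [sub_zero] at h₁ h₂
    rw [← h₁, ← h₂, ← (hall 0).1, ← (hall n).1]
    exact ⟨fun h => congrArg φ h, heq _ _⟩
  have hmm : m = m' := by
    have h₁ := (hperiod (2 * m')).2 dvd_rfl
    have h₂ := (hperiod (2 * m)).1 dvd_rfl
    rw [mul_dvd_mul_iff_left two_ne_zero] at h₁ h₂
    exact Nat.dvd_antisymm (Int.natCast_dvd_natCast.1 h₁) (Int.natCast_dvd_natCast.1 h₂)
  refine ⟨hmm, ?_⟩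
  rw [hmm, ← he'.eq_iff, ← (hall i).1, fi, hij]

variable [Fintype B]

/-- The position of the vertices of a link with respect to the edge `{x, y}`, given by retraction
on an apartment containing this edge. -/
theorem IsApartmentSystem.exists_linkPosition (hA : IsApartmentSystem M X A)
    (hB : Fintype.card B = 3) {v : V} (hfin : {a | a ≠ v ∧ ({v, a} : Finset V) ∈ X.faces}.Finite)
    (hne : ∃ x y, LinkAdj X.toPreAbstractSimplicialComplex v x y) :
    ∃ m, 2 ≤ m ∧ ∀ x y, LinkAdj X.toPreAbstractSimplicialComplex v x y →
      ∃ pos : V → ZMod (2 * m), pos x = 0 ∧ pos y = 1 ∧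
        (∀ z w, LinkAdj X.toPreAbstractSimplicialComplex v z w →
          pos w = pos z + 1 ∨ pos w = pos z - 1) ∧
        ∀ z, (∃ w, LinkAdj X.toPreAbstractSimplicialComplex v z w) → ∃ e : ℤ → V,
          e 0 = x ∧ e 1 = y ∧
          (∀ t, LinkAdj X.toPreAbstractSimplicialComplex v (e t) (e (t + 1))) ∧
          (∀ s t : ℤ, e s = e t ↔ (s : ZMod (2 * m)) = t) ∧ ∃ t : ℤ, e t = z ∧ pos z = t := by
  have hsub : ∀ {S a b}, S ∈ A → LinkAdj S v a b →
      LinkAdj X.toPreAbstractSimplicialComplex v a b :=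
    fun hS h => ⟨h.1, h.2.1, h.2.2.1, hA.subcomplex _ hS h.2.2.2⟩
  have hcycle : ∀ {x y z w}, LinkAdj X.toPreAbstractSimplicialComplex v x y →
      LinkAdj X.toPreAbstractSimplicialComplex v z w → ∃ S ∈ A, LinkAdj S v z w ∧
        LinkAdj S v x y ∧ ∃ m e, 2 ≤ m ∧ IsLinkCycle S v m e ∧ e 0 = x ∧ e 1 = y := by
    intro x y z w hxy hzw
    obtain ⟨S, hS, h₁, h₂⟩ := hA.common _ hxy.2.2.2 _ hzw.2.2.2
    obtain ⟨F, hF⟩ := hA.exists_chart hS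
    have hxyS : LinkAdj S v x y := ⟨hxy.1, hxy.2.1, hxy.2.2.1, h₁⟩
    obtain ⟨m, e, hm, he, h0, h1⟩ := hF.exists_linkCycle hB hxyS
    refine ⟨S, hS, ⟨hzw.1, hzw.2.1, hzw.2.2.1, h₂⟩, hxyS, m, e, ?_, he, h0, h1⟩
    -- A line would put infinitely many vertices into the finite link.
    have hm0 : m ≠ 0 := by
      rintro rfl
      have hinj : Function.Injective e := by
        intro s t hst
        rw [he.eq_iff] at hst
        simp only [Nat.cast_zero, mul_zero, zero_dvd_iff] at hst
        omega
      refine Set.infinite_range_of_injective hinj (hfin.subset ?_)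
      rintro _ ⟨t, rfl⟩
      have := hsub hS (he.adj t)
      refine ⟨this.1, (X.isRelLowerSet_faces this.2.2.2).2 ?_ (by simp)⟩
      intro y
      simp only [Finset.mem_insert, Finset.mem_singleton]
      tauto
    omega
  obtain ⟨x₀, y₀, h₀⟩ := hne
  obtain ⟨S₀, hS₀, -, -, m, e₀, hm, he₀, h00, h01⟩ := hcycle h₀ h₀
  -- The length does not depend on the apartment: one apartment contains the reference edge and `{x,
  -- y}`, another one contains `{x, y}` and `{z, w}`.
  have hcycle' : ∀ {x y z w}, LinkAdj X.toPreAbstractSimplicialComplex v x y →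
      LinkAdj X.toPreAbstractSimplicialComplex v z w → ∃ S ∈ A, LinkAdj S v z w ∧
        ∃ e, IsLinkCycle S v m e ∧ e 0 = x ∧ e 1 = y := by
    intro x y z w hxy hzw
    obtain ⟨S, hS, hzwS, hxyS, m₁, e₁, hm₁, he₁, h10, h11⟩ := hcycle hxy hzw
    obtain ⟨S₂, hS₂, hxyS₂, -, m₂, e₂, hm₂, he₂, h20, h21⟩ := hcycle h₀ hxy
    obtain ⟨rfl, -⟩ := hA.linkCycle_agree hS₀ hS₂ he₀ he₂ (by omega) (h00.trans h20.symm)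
      (h01.trans h21.symm) (h00.trans h20.symm)
    obtain ⟨e₃, he₃, h30, h31⟩ := he₂.exists_start hxyS₂
    obtain ⟨rfl, -⟩ := hA.linkCycle_agree hS₂ hS he₃ he₁ (by omega) (h30.trans h10.symm)
      (h31.trans h11.symm) (h30.trans h10.symm)
    exact ⟨S, hS, hzwS, e₁, he₁, h10, h11⟩
  refine ⟨m, hm, fun x y hxy => ?_⟩
  have hindex : ∀ z, (∃ w, LinkAdj X.toPreAbstractSimplicialComplex v z w) →
      ∃ S ∈ A, ∃ e, IsLinkCycle S v m e ∧ e 0 = x ∧ e 1 = y ∧ ∃ t : ℤ, e t = z := by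
    rintro z ⟨w, hzw⟩
    obtain ⟨S, hS, hzwS, e, he, h0, h1⟩ := hcycle' hxy hzw
    obtain ⟨t, ⟨ht, -⟩ | ⟨-, ht⟩⟩ := (he.adj_iff _ _).1 hzwS
    exacts [⟨S, hS, e, he, h0, h1, t, ht.symm⟩, ⟨S, hS, e, he, h0, h1, t + 1, ht.symm⟩]
  have hcast : ∀ s t : ℤ, (s : ZMod (2 * m)) = t ↔ (2 * m : ℤ) ∣ t - s := by
    intro s t
    rw [ZMod.intCast_eq_intCast_iff_dvd_sub]
    push_cast
    rfl
  -- The position is read off in a chosen apartment; `hpos` shows that any other apartment through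
  -- the base edge gives the same class.
  choose! S hS e he h0 h1 τ hτ using hindex
  have hpos : ∀ {z S' e'} {t : ℤ}, (∃ w, LinkAdj X.toPreAbstractSimplicialComplex v z w) →
      S' ∈ A → IsLinkCycle S' v m e' → e' 0 = x → e' 1 = y → e' t = z →
      (τ z : ZMod (2 * m)) = t := by
    intro z S' e' t hz hS' he' h0' h1' ht
    exact (hcast _ _).2 (hA.linkCycle_agree (hS z hz) hS' (he z hz) he' (by omega)
      ((h0 z hz).trans h0'.symm) ((h1 z hz).trans h1'.symm) ((hτ z hz).trans ht.symm)).2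
  refine ⟨fun z => τ z, ?_, ?_, ?_, ?_⟩
  · have hx : ∃ w, LinkAdj X.toPreAbstractSimplicialComplex v x w := ⟨y, hxy⟩
    simpa using hpos hx (hS x hx) (he x hx) (h0 x hx) (h1 x hx) (h0 x hx)
  · have hy : ∃ w, LinkAdj X.toPreAbstractSimplicialComplex v y w := ⟨x, hxy.symm⟩
    simpa using hpos hy (hS y hy) (he y hy) (h0 y hy) (h1 y hy) (h1 y hy)
  · intro z w hzw
    obtain ⟨S', hS', hzwS, e', he', h0', h1'⟩ := hcycle' hxy hzw
    obtain ⟨t, ⟨rfl, rfl⟩ | ⟨rfl, rfl⟩⟩ := (he'.adj_iff _ _).1 hzwS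
    · dsimp only
      rw [hpos ⟨_, hzw⟩ hS' he' h0' h1' rfl, hpos ⟨_, hzw.symm⟩ hS' he' h0' h1' rfl]
      exact Or.inl (by push_cast; ring)
    · dsimp only
      rw [hpos ⟨_, hzw⟩ hS' he' h0' h1' rfl, hpos ⟨_, hzw.symm⟩ hS' he' h0' h1' rfl]
      exact Or.inr (by push_cast; ring)
  · intro z hz
    refine ⟨e z, h0 z hz, h1 z hz, fun t => hsub (hS z hz) ((he z hz).adj t), ?_, τ z, hτ z hz, rfl⟩
    intro s t
    rw [hcast, (he z hz).eq_iff]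

end Building

end

end ChambersMissing

namespace ChambersMissing

/-- Connectedness of `G₆`, which lets parities propagate. -/
lemma G₆_within_six (w : FanoVertex) : within 6 (.inl 0) w = true := by
  revert w; decide +kernel

lemma exists_path_of_not_adj : ∀ p l : ZMod 7, G₆Adj (.inl p) (.inr l) = true ∨
    removedAdj (.inl p) (.inr l) = true ∨ ∃ m, G₆Adj (.inl p) (.inr m) = true ∧
      ∃ q, G₆Adj (.inl q) (.inr m) = true ∧ G₆Adj (.inl q) (.inr l) = true := by
  decide +kernel

lemma removedAdj_fanoAdj : ∀ z w, removedAdj z w = true → fanoAdj z w = true := by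
  decide +kernel

lemma removedAdj_comm : ∀ z w, removedAdj z w = removedAdj w z := by
  decide +kernel

noncomputable section

open scoped Classical

/-! ### Extensions of `G₆` to generalized polygons -/

/-- The relation `L` admits retractions on cycles with `2 m` edges. -/
def IsPolygonal (m : ℕ) {N : Type u} (L : N → N → Prop) : Prop :=
  ∀ x y, L x y → ∃ pos : N → ZMod (2 * m), pos x = 0 ∧ pos y = 1 ∧
    (∀ z w, L z w → pos w = pos z + 1 ∨ pos w = pos z - 1) ∧
    ∀ z, ∃ e : ℤ → N, e 0 = x ∧ e 1 = y ∧ (∀ t, L (e t) (e (t + 1))) ∧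
      (∀ s t : ℤ, e s = e t ↔ (s : ZMod (2 * m)) = t) ∧ ∃ t : ℤ, e t = z ∧ pos z = t

section Polygonal

variable {m : ℕ} {N : Type u} {L : N → N → Prop}

/-- The properties of the position with respect to an edge which are used below. -/
lemma IsPolygonal.exists_pos (h : IsPolygonal m L) {x y : N} (hxy : L x y) :
    ∃ pos : N → ZMod (2 * m), pos x = 0 ∧ pos y = 1 ∧
      (∀ z w, L z w → pos w = pos z + 1 ∨ pos w = pos z - 1) ∧
      (∀ z, pos z = 0 → z = x) ∧ (∀ z, pos z = 1 → z = y) ∧ (∀ z, pos z = -1 → L z x) ∧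
      ∀ z, pos z = 3 → (3 : ZMod (2 * m)) ≠ 1 → (2 : ZMod (2 * m)) ≠ 0 →
        ∃ a b, L x a ∧ L a b ∧ L b z ∧ x ≠ b ∧ a ≠ z := by
  obtain ⟨pos, h0, h1, hadj, he⟩ := h x y hxy
  refine ⟨pos, h0, h1, hadj, ?_, ?_, ?_, ?_⟩
  · intro z hz
    obtain ⟨e, e0, e1, -, heq, t, rfl, ht⟩ := he z
    rw [← e0, heq, ← ht, hz, Int.cast_zero]
  · intro z hz
    obtain ⟨e, e0, e1, -, heq, t, rfl, ht⟩ := he z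
    rw [← e1, heq, ← ht, hz, Int.cast_one]
  · intro z hz
    obtain ⟨e, e0, e1, hL, heq, t, rfl, ht⟩ := he z
    have : e t = e (-1) := by
      rw [heq, ← ht, hz]
      simp
    rw [this, ← e0]
    exact hL (-1)
  · intro z hz h31 h20
    obtain ⟨e, e0, e1, hL, heq, t, rfl, ht⟩ := he z
    have h3 : e t = e 3 := by
      rw [heq, ← ht, hz]
      simp
    rw [h3, ← e0]
    refine ⟨e 1, e 2, hL 0, hL 1, hL 2, ?_, ?_⟩
    · rw [Ne, heq]
      simpa using h20.symm
    · rw [Ne, heq]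
      simpa using h31.symm

/-- Positions `0` and `1` are taken only by `x` and `y`, so other neighbours of these must move away
from the base edge. -/
lemma IsPolygonal.exists_pos_neighbors (h : IsPolygonal m L) {x y a b : N} (hxy : L x y)
    (hya : L y a) (hax : a ≠ x) (hxb : L x b) (hby : b ≠ y) :
    ∃ pos : N → ZMod (2 * m), pos x = 0 ∧ pos y = 1 ∧ pos a = 2 ∧ pos b = -1 ∧
      (∀ z w, L z w → pos w = pos z + 1 ∨ pos w = pos z - 1) ∧
      (∀ z, pos z = 0 → z = x) ∧ (∀ z, pos z = 1 → z = y) := by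
  obtain ⟨pos, h0, h1, hadj, inj0, inj1, -⟩ := h.exists_pos hxy
  refine ⟨pos, h0, h1, ?_, ?_, hadj, inj0, inj1⟩
  · rcases hadj _ _ hya with h | h
    · rw [h, h1, one_add_one_eq_two]
    · exact absurd (inj0 a (by rw [h, h1, sub_self])) hax
  · rcases hadj _ _ hxb with h | h
    · exact absurd (inj1 b (by rw [h, h0, zero_add])) hby
    · rw [h, h0, zero_sub]

/-- A hexagon bounds the girth. -/
lemma IsPolygonal.eq_two_or_three (h : IsPolygonal m L) (hsymm : ∀ x y, L x y → L y x)
    (hm : 2 ≤ m) {c : ZMod 6 → N} (hc : Function.Injective c) (hL : ∀ i, L (c i) (c (i + 1))) :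
    m = 2 ∨ m = 3 := by
  have hne : ∀ i j : ZMod 6, i ≠ j → c i ≠ c j := fun i j hij h => hij (hc h)
  obtain ⟨pos, h0, h1, h2, h5, hadj, inj0, inj1⟩ := h.exists_pos_neighbors (hL 0)
    (hL 1) (hne 2 0 (by decide)) (hsymm _ _ (hL 5)) (hne 5 1 (by decide))
  have h3 : pos (c 3) = 3 := by
    rcases hadj _ _ (hL 2) with h | h
    · rw [show (3 : ZMod 6) = 2 + 1 by decide, h, show pos (c 2) = 2 from h2]
      norm_num
    · exact absurd (inj1 (c 3) (by
        rw [show (3 : ZMod 6) = 2 + 1 by decide, h, show pos (c 2) = 2 from h2]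
        norm_num)) (hne _ _ (by decide))
  have h4 : pos (c 4) = -2 := by
    rcases hadj _ _ (hsymm _ _ (hL 4)) with h | h
    · exact absurd (inj0 (c 4) (by
        rw [h, show pos (c (4 + 1)) = -1 from h5]
        norm_num)) (hne _ _ (by decide))
    · rw [h, show pos (c (4 + 1)) = -1 from h5]
      norm_num
  -- Going around the hexagon in both directions gives positions `3` and `-2` to two adjacent
  -- vertices.
  have key : ((6 : ℕ) : ZMod (2 * m)) = 0 ∨ ((4 : ℕ) : ZMod (2 * m)) = 0 := by
    rcases hadj _ _ (hL 3) with h | h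
    · left
      have h' : (-2 : ZMod (2 * m)) = 3 + 1 := by
        rw [← h4, ← h3]
        exact h
      push_cast
      linear_combination -h'
    · right
      have h' : (-2 : ZMod (2 * m)) = 3 - 1 := by
        rw [← h4, ← h3]
        exact h
      push_cast
      linear_combination -h'
  rw [ZMod.natCast_eq_zero_iff, ZMod.natCast_eq_zero_iff] at key
  rcases key with h | h
  · have := Nat.le_of_dvd (by norm_num) h
    have : m ≤ 3 := by omega
    interval_cases m <;> simp_all
  · have := Nat.le_of_dvd (by norm_num) h
    left; omega

/-- Generalized triangles have no cycles of length four. -/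
lemma IsPolygonal.no_square {L : N → N → Prop} (h : IsPolygonal 3 L)
    (hsymm : ∀ x y, L x y → L y x) {a b c d : N} (hab : L a b) (hbc : L b c) (hcd : L c d)
    (hda : L d a) : a = c ∨ b = d := by
  by_contra! hne
  obtain ⟨pos, h0, h1, h2, h5, hadj, inj0, inj1⟩ := h.exists_pos_neighbors hab hbc
    hne.1.symm (hsymm _ _ hda) hne.2.symm
  -- Positions `2` and `-1` are not consecutive modulo six.
  have := hadj c d hcd
  rw [h2, h5] at this
  revert this
  decide

end Polygonal

/-! ### Polygonal relations on the vertices of the Fano graph -/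

section Fano

variable {L : FanoVertex → FanoVertex → Prop}

lemma parity_of_within {f : FanoVertex → ZMod 2}
    (hf : ∀ z w, G₆Adj z w = true → f w = f z) {n : ℕ} {z w : FanoVertex}
    (h : within n z w = true) : f w = f z := by
  induction n generalizing z with
  | zero =>
    obtain rfl : z = w := by simpa [within] using h
    rfl
  | succ n ih =>
    rw [within, Bool.or_eq_true, decide_eq_true_eq, decide_eq_true_eq] at h
    rcases h with rfl | ⟨u, h⟩
    · rfl
    · rw [Bool.and_eq_true] at h
      rw [ih h.2, hf _ _ h.1]

/-- The side of a vertex. -/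
def side (z : FanoVertex) : ZMod 2 := if z.isLeft then 0 else 1

lemma side_of_G₆Adj {z w : FanoVertex} (h : G₆Adj z w = true) : side w = side z + 1 := by
  rcases G₆Adj_isLeft h with ⟨p, l, rfl, rfl⟩ | ⟨p, l, rfl, rfl⟩ <;> simp [side]
  decide

/-- Along an edge of `G₆` the position and the side both change parity, and `G₆` is connected.
Parity of positions makes sense because the modulus is even. -/
lemma parity_pos {m : ℕ} (hG : ∀ z w, G₆Adj z w = true → L z w) {pos : FanoVertex → ZMod (2 * m)}
    (hadj : ∀ z w, L z w → pos w = pos z + 1 ∨ pos w = pos z - 1) :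
    ∀ z w, ZMod.castHom (dvd_mul_right 2 m) (ZMod 2) (pos w) + side w =
      ZMod.castHom (dvd_mul_right 2 m) (ZMod 2) (pos z) + side z := by
  set f : FanoVertex → ZMod 2 :=
    fun z => ZMod.castHom (dvd_mul_right 2 m) (ZMod 2) (pos z) + side z with hf
  have h2 : (2 : ZMod 2) = 0 := rfl
  have hstep : ∀ z w, G₆Adj z w = true → f w = f z := by
    intro z w h
    simp only [hf]
    rw [side_of_G₆Adj h]
    rcases hadj z w (hG z w h) with h' | h' <;> rw [h']
    · rw [map_add, map_one]
      linear_combination h2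
    · rw [map_sub, map_one]
      ring
  intro z w
  have h₁ := parity_of_within hstep (G₆_within_six w)
  have h₂ := parity_of_within hstep (G₆_within_six z)
  exact h₁.trans h₂.symm

lemma IsPolygonal.side_ne {m : ℕ} (h : IsPolygonal m L)
    (hG : ∀ z w, G₆Adj z w = true → L z w) {z w : FanoVertex} (hzw : L z w) :
    side w = side z + 1 := by
  obtain ⟨pos, h0, h1, hadj, -⟩ := h.exists_pos hzw
  have := parity_pos hG hadj z w
  rw [h0, h1, map_zero, map_one, zero_add] at this
  have h2 : (2 : ZMod 2) = 0 := rfl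
  linear_combination this - h2

/-- Relative to `z`, the vertex `w` has odd position; modulo four this is `1` or `-1`, and both mean
adjacency to `z`. -/
lemma IsPolygonal.adj_of_side_ne (h : IsPolygonal 2 L) (hsymm : ∀ x y, L x y → L y x)
    (hG : ∀ z w, G₆Adj z w = true → L z w) {z w : FanoVertex} (hzw : side w = side z + 1) :
    L z w := by
  obtain ⟨y, hy⟩ := exists_G₆Adj z
  obtain ⟨pos, h0, -, hadj, -, inj1, hneg, -⟩ := h.exists_pos (hG z y hy)
  have := parity_pos hG hadj z w
  rw [h0, map_zero, hzw] at this
  have hodd : ZMod.castHom (dvd_mul_right 2 2) (ZMod 2) (pos w) = 1 := by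
    have h2 : (2 : ZMod 2) = 0 := rfl
    linear_combination this - h2
  have hcases : ∀ a : ZMod (2 * 2), ZMod.castHom (dvd_mul_right 2 2) (ZMod 2) a = 1 →
      a = 1 ∨ a = -1 := by
    decide +kernel
  rcases hcases _ hodd with h' | h'
  · rw [inj1 w h']
    exact hG z y hy
  · exact hsymm _ _ (hneg w h')

lemma side_eq_cases {z w : FanoVertex} (h : side w = side z + 1) :
    (∃ p l, z = .inl p ∧ w = .inr l) ∨ ∃ p l, z = .inr l ∧ w = .inl p := by
  rcases z with p | p <;> rcases w with l | l <;> simp [side] at h ⊢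

/-- Any other edge between the two sides would close a path of length three in `G₆` to a square. -/
lemma IsPolygonal.adj_imp (h : IsPolygonal 3 L) (hsymm : ∀ x y, L x y → L y x)
    (hG : ∀ z w, G₆Adj z w = true → L z w) {z w : FanoVertex} (hzw : L z w) :
    G₆Adj z w = true ∨ removedAdj z w = true := by
  have key : ∀ p l : ZMod 7, L (.inl p) (.inr l) →
      G₆Adj (.inl p) (.inr l) = true ∨ removedAdj (.inl p) (.inr l) = true := by
    intro p l hpl
    rcases exists_path_of_not_adj p l with h' | h' | ⟨m, h₁, q, h₂, h₃⟩
    · exact Or.inl h'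
    · exact Or.inr h'
    · left
      rcases h.no_square hsymm (hG _ _ h₁) (hsymm _ _ (hG _ _ h₂)) (hG _ _ h₃)
        (hsymm _ _ hpl) with h' | h'
      · rwa [h']
      · rwa [← h']
  rcases side_eq_cases (h.side_ne hG hzw) with ⟨p, l, rfl, rfl⟩ | ⟨p, l, rfl, rfl⟩
  · exact key p l hzw
  · rw [G₆Adj_comm, removedAdj_comm]
    exact key p l (hsymm _ _ hzw)

/-- The position of `w` seen from `z` is odd. If it were `3`, a path of length three in `L`, which
lies in the Fano graph, would form a square with the removed edge. -/
lemma IsPolygonal.adj_of_removedAdj (h : IsPolygonal 3 L) (hsymm : ∀ x y, L x y → L y x)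
    (hG : ∀ z w, G₆Adj z w = true → L z w) {z w : FanoVertex} (hzw : removedAdj z w = true) :
    L z w := by
  have hfano : ∀ z w, L z w → fanoAdj z w = true := by
    intro z w hzw
    rcases h.adj_imp hsymm hG hzw with h' | h'
    · rw [G₆Adj, Bool.and_eq_true] at h'
      exact h'.1
    · exact removedAdj_fanoAdj z w h'
  have hside : side w = side z + 1 := by
    have := fanoAdj_isLeft (removedAdj_fanoAdj z w hzw)
    revert this
    rw [side, side]
    cases z.isLeft <;> cases w.isLeft <;> decide
  obtain ⟨y, hy⟩ := exists_G₆Adj z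
  obtain ⟨pos, h0, -, hadj, -, inj1, hneg, hthree⟩ := h.exists_pos (hG z y hy)
  have := parity_pos hG hadj z w
  rw [h0, map_zero, hside] at this
  have hodd : ZMod.castHom (dvd_mul_right 2 3) (ZMod 2) (pos w) = 1 := by
    have h2 : (2 : ZMod 2) = 0 := rfl
    linear_combination this - h2
  have hcases : ∀ a : ZMod (2 * 3), ZMod.castHom (dvd_mul_right 2 3) (ZMod 2) a = 1 →
      a = 1 ∨ a = -1 ∨ a = 3 := by
    decide +kernel
  rcases hcases _ hodd with h' | h' | h'
  · rw [inj1 w h']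
    exact hG z y hy
  · exact hsymm _ _ (hneg w h')
  · obtain ⟨a, b, h₁, h₂, h₃, hne₁, hne₂⟩ := hthree w h' (by decide) (by decide)
    have hwz : fanoAdj w z = true := by
      rw [fanoAdj_comm]
      exact removedAdj_fanoAdj z w hzw
    rcases fano_no_square' (hfano _ _ h₁) (hfano _ _ h₂) (hfano _ _ h₃) hwz with h' | h'
    · exact absurd h' hne₁
    · exact absurd h' hne₂

end Fano

end

end ChambersMissing

namespace ChambersMissing

lemma G₆Adj_no_triangle {a b c : FanoVertex} (h₁ : G₆Adj a b = true) (h₂ : G₆Adj b c = true)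
    (h₃ : G₆Adj a c = true) : False := by
  rcases a with a | a <;> rcases b with b | b <;> rcases c with c | c <;>
    simp [G₆Adj, fanoAdj] at h₁ h₂ h₃

/-- The flags of `G₆` which are missing in the complete bipartite graph. -/
abbrev MissingPair : Type := {q : ZMod 7 × ZMod 7 // G₆Adj (.inl q.1) (.inr q.2) = false}

/-- There are `49` pairs and `18` edges of `G₆`; what matters is that the difference is not
divisible by three. -/
lemma card_missingPair : Fintype.card MissingPair = 31 := by decide +kernel

noncomputable section

open scoped Classical

/-! ### Points of the realization -/

lemma isPoint_of_support_subset {V : Type u} {K : AbstractSimplicialComplex V} {p : V →₀ ℝ}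
    (hp : ∀ x, 0 ≤ p x) (hsum : (p.sum fun _ t => t) = 1) {s : Finset V} (hs : s ∈ K.faces)
    (hsub : p.support ⊆ s) : IsPoint K p := by
  refine ⟨hp, hsum, (K.isRelLowerSet_faces hs).2 hsub ?_⟩
  rw [Finset.nonempty_iff_ne_empty, Ne, Finsupp.support_eq_empty]
  rintro rfl
  simp at hsum

/-- The point dividing an edge in the ratio one to two. -/
def edgePoint {V : Type u} (x y : V) : V →₀ ℝ := Finsupp.single x (1 / 3) + Finsupp.single y (2 / 3)

/-- The centre of a triangle. -/
def trianglePoint {V : Type u} (x y z : V) : V →₀ ℝ :=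
  Finsupp.single x (1 / 3) + Finsupp.single y (1 / 3) + Finsupp.single z (1 / 3)

section Points

variable {V : Type u} {W : Type v} {K : AbstractSimplicialComplex V}

lemma isPoint_edgePoint {x y : V} (h : ({x, y} : Finset V) ∈ K.faces) :
    IsPoint K (edgePoint x y) := by
  refine isPoint_of_support_subset (s := {x, y}) ?_ ?_ h ?_
  · intro z
    rw [edgePoint, Finsupp.add_apply, Finsupp.single_apply, Finsupp.single_apply]
    positivity
  · rw [edgePoint, Finsupp.sum_add_index' (fun _ => rfl) (fun _ _ _ => rfl),
      Finsupp.sum_single_index rfl, Finsupp.sum_single_index rfl]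
    norm_num
  · intro z hz
    by_contra hcon
    simp only [Finset.mem_insert, Finset.mem_singleton, not_or] at hcon
    simp [edgePoint, Ne.symm hcon.1, Ne.symm hcon.2] at hz

lemma isPoint_trianglePoint {x y z : V} (h : ({x, y, z} : Finset V) ∈ K.faces) :
    IsPoint K (trianglePoint x y z) := by
  refine isPoint_of_support_subset (s := {x, y, z}) ?_ ?_ h ?_
  · intro w
    rw [trianglePoint, Finsupp.add_apply, Finsupp.add_apply, Finsupp.single_apply,
      Finsupp.single_apply, Finsupp.single_apply]
    positivity
  · rw [trianglePoint, Finsupp.sum_add_index' (fun _ => rfl) (fun _ _ _ => rfl),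
      Finsupp.sum_add_index' (fun _ => rfl) (fun _ _ _ => rfl),
      Finsupp.sum_single_index rfl, Finsupp.sum_single_index rfl, Finsupp.sum_single_index rfl]
    norm_num
  · intro w hw
    by_contra hcon
    simp only [Finset.mem_insert, Finset.mem_singleton, not_or] at hcon
    simp [trianglePoint, Ne.symm hcon.1, Ne.symm hcon.2.1,
      Ne.symm hcon.2.2] at hw

lemma pushPoint_edgePoint (f : V → W) (x y : V) :
    pushPoint f (edgePoint x y) = edgePoint (f x) (f y) := by
  simp [pushPoint, edgePoint, Finsupp.mapDomain_add, Finsupp.mapDomain_single]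

lemma pushPoint_trianglePoint (f : V → W) (x y z : V) :
    pushPoint f (trianglePoint x y z) = trianglePoint (f x) (f y) (f z) := by
  simp [pushPoint, trianglePoint, Finsupp.mapDomain_add, Finsupp.mapDomain_single]

/-- The unequal weights record the order of the ends, so orbits of points become orbits of oriented
edges. -/
lemma edgePoint_injective {x y x' y' : V} (hxy : x ≠ y) (h : edgePoint x y = edgePoint x' y') :
    x = x' ∧ y = y' := by
  have hx := DFunLike.congr_fun h x
  have hy := DFunLike.congr_fun h y
  simp only [edgePoint, Finsupp.add_apply, Finsupp.single_apply] at hx hy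
  rw [if_pos trivial, if_neg hxy.symm] at hx
  rw [if_pos trivial, if_neg hxy] at hy
  constructor
  · by_contra hne
    rw [if_neg (Ne.symm hne)] at hx
    split_ifs at hx <;> norm_num at hx
  · by_contra hne
    rw [if_neg (Ne.symm hne)] at hy
    split_ifs at hy <;> norm_num at hy

end Points

/-! ### Extensions of `X₆³` -/

section Extension

variable {V : Type u} {Γ : Type v} [Group Γ] [MulAction Γ V]

lemma IsFreeCofiniteAction.eq_one_of_smul_eq {X : AbstractSimplicialComplex V}
    (h : IsFreeCofiniteAction X Γ) {g : Γ} {x : V} (hx : g • x = x) : g = 1 := by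
  refine h.free g (edgePoint x x) (isPoint_edgePoint (by simpa using X.singleton_mem x)) ?_
  rw [pushPoint_edgePoint, hx]

lemma IsFreeCofiniteAction.eq_of_smul_eq {X : AbstractSimplicialComplex V}
    (h : IsFreeCofiniteAction X Γ) {g g' : Γ} {x : V} (hx : g • x = g' • x) : g = g' := by
  have : g'⁻¹ * g = 1 := h.eq_one_of_smul_eq (x := x) (by rw [mul_smul, hx, inv_smul_smul])
  exact (inv_mul_eq_one.1 this).symm

lemma IsFreeCofiniteAction.triple_mem {X : AbstractSimplicialComplex V}
    (h : IsFreeCofiniteAction X Γ) (g : Γ) {x y z : V} (hx : ({x, y, z} : Finset V) ∈ X.faces) :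
    ({g • x, g • y, g • z} : Finset V) ∈ X.faces := by
  have := h.simplicial g _ hx
  rwa [translateFace_eq_image, Finset.image_insert, Finset.image_insert,
    Finset.image_singleton] at this

/-- A triangle is not rotated. -/
lemma IsFreeCofiniteAction.eq_one_of_rotation {X : AbstractSimplicialComplex V}
    (h : IsFreeCofiniteAction X Γ) {g : Γ} {x y z : V} (hx : ({x, y, z} : Finset V) ∈ X.faces)
    (h₁ : g • x = y) (h₂ : g • y = z) (h₃ : g • z = x) : g = 1 := by
  refine h.free g (trianglePoint x y z) (isPoint_trianglePoint hx) ?_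
  rw [pushPoint_trianglePoint, h₁, h₂, h₃, trianglePoint, trianglePoint]
  abel

variable {X : AbstractSimplicialComplex V} {f : Γ₆₃ → V} {n : ℕ} {C : Fin n → Finset V}

/-- The map of an extension of `X₆₃` is injective on edges. -/
lemma IsExtension.map_ne (hf : IsExtension (Γ := Γ₆₃) (Γ' := Γ) X₆₃ X f C) {x y : Γ₆₃}
    (hxy : x ≠ y) (h : ({x, y} : Finset Γ₆₃) ∈ X₆₃.faces) : f x ≠ f y := by
  intro heq
  have hx : ({x, x} : Finset Γ₆₃) ∈ X₆₃.faces := by simpa using X₆₃.singleton_mem x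
  -- If the edge were collapsed, an inner point of it would be in the orbit of a vertex.
  have := (hf.orbits (edgePoint x y) (edgePoint x x) (isPoint_edgePoint h)
    (isPoint_edgePoint hx)).2 ⟨1, by
      simp only [pushPoint_edgePoint, one_smul, heq]⟩
  obtain ⟨g, hg⟩ := this
  rw [pushPoint_edgePoint] at hg
  have hne : g • x ≠ g • y := fun h' => hxy (MulAction.injective g h')
  obtain ⟨h₁, h₂⟩ := edgePoint_injective hne hg
  exact hne (h₁.trans h₂.symm)

/-- The map of an extension of `X₆₃` is injective on links. -/
lemma IsExtension.map_nb_injective (hf : IsExtension (Γ := Γ₆₃) (Γ' := Γ) X₆₃ X f C) :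
    Function.Injective fun z => f (nb z) := by
  intro z w h
  have hz : ({1, nb z} : Finset Γ₆₃) ∈ X₆₃.faces := by simpa using edge_mem_faces 1 z
  have hw : ({1, nb w} : Finset Γ₆₃) ∈ X₆₃.faces := by simpa using edge_mem_faces 1 w
  obtain ⟨g, hg⟩ := (hf.orbits (edgePoint 1 (nb z)) (edgePoint 1 (nb w)) (isPoint_edgePoint hz)
    (isPoint_edgePoint hw)).2 ⟨1, by
      simp only [pushPoint_edgePoint, one_smul]
      rw [show f (nb z) = f (nb w) from h]⟩
  rw [pushPoint_edgePoint] at hg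
  have hne : g • (1 : Γ₆₃) ≠ g • nb z := fun h' => nb_ne_one z (MulAction.injective g h').symm
  obtain ⟨h₁, h₂⟩ := edgePoint_injective hne hg
  have hg1 : g = 1 := by simpa using h₁
  rw [hg1, one_smul] at h₂
  exact nb_injective h₂

/-- The orbit condition provides an element for each edge. By freeness the elements of two edges
with a common vertex agree, and the generators connect all vertices. -/
lemma IsExtension.exists_smul_eq (hf : IsExtension (Γ := Γ₆₃) (Γ' := Γ) X₆₃ X f C)
    (hX : IsFreeCofiniteAction X Γ) (g : Γ₆₃) : ∃ γ : Γ, ∀ x, γ • f x = f (g * x) := by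
  have hedge : ∀ {x y : Γ₆₃}, x ≠ y → ({x, y} : Finset Γ₆₃) ∈ X₆₃.faces →
      ∃ γ : Γ, γ • f x = f (g * x) ∧ γ • f y = f (g * y) := by
    intro x y hxy h
    have h' : ({g * x, g * y} : Finset Γ₆₃) ∈ X₆₃.faces := by
      have := translateFace_mem_faces_X₆₃ g h
      rw [translateFace_eq_image] at this
      simpa [Finset.image_insert] using this
    obtain ⟨γ, hγ⟩ := (hf.orbits (edgePoint x y) (edgePoint (g * x) (g * y)) (isPoint_edgePoint h)
      (isPoint_edgePoint h')).1 ⟨g, by rw [pushPoint_edgePoint]; rfl⟩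
    rw [pushPoint_edgePoint, pushPoint_edgePoint, pushPoint_edgePoint] at hγ
    exact ⟨γ, edgePoint_injective
      (fun h' => hf.map_ne hxy h (MulAction.injective γ h')) hγ⟩
  have hstep : ∀ {γ : Γ} {x y : Γ₆₃}, x ≠ y → ({x, y} : Finset Γ₆₃) ∈ X₆₃.faces →
      γ • f x = f (g * x) → γ • f y = f (g * y) := by
    intro γ x y hxy h hx
    obtain ⟨γ', h₁, h₂⟩ := hedge hxy h
    rwa [hX.eq_of_smul_eq (hx.trans h₁.symm)]
  have hnb : ∀ {γ : Γ} {x : Γ₆₃} (z : FanoVertex), γ • f x = f (g * x) →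
      γ • f (x * nb z) = f (g * (x * nb z)) := by
    intro γ x z hx
    exact hstep (by simpa using nb_ne_one z) (edge_mem_faces x z) hx
  obtain ⟨γ, hγ, -⟩ := hedge (nb_ne_one (.inl 0)).symm (by simpa using edge_mem_faces 1 (.inl 0))
  refine ⟨γ, fun x => ?_⟩
  induction x using gen_induction with
  | one => exact hγ
  | mul x a ih =>
    have := hnb (genVertex a) ih
    rwa [nb_genVertex] at this
  | mul_inv x a ih =>
    have := hnb (nbInv (genVertex a)) ih
    rwa [nb_nbInv, nb_genVertex] at this

/-- The map of an extension of `X₆₃` is equivariant with respect to a homomorphism. -/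
lemma IsExtension.exists_hom (hf : IsExtension (Γ := Γ₆₃) (Γ' := Γ) X₆₃ X f C)
    (hX : IsFreeCofiniteAction X Γ) : ∃ φ : Γ₆₃ →* Γ, ∀ g x, φ g • f x = f (g * x) := by
  choose φ hφ using hf.exists_smul_eq hX
  refine ⟨MonoidHom.mk' φ fun g h => ?_, hφ⟩
  apply hX.eq_of_smul_eq (x := f 1)
  rw [hφ, mul_smul, hφ, hφ, mul_assoc]

variable {B : Type} [Fintype B] {M : CoxeterMatrix B} {A : Set (PreAbstractSimplicialComplex V)}

/-- A face which is too small to be a chamber and contains the image of `1` is the image of a face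
containing `1`. -/
lemma IsExtension.exists_lift (hf : IsExtension (Γ := Γ₆₃) (Γ' := Γ) X₆₃ X f C)
    (hX : IsFreeCofiniteAction X Γ) (hA : IsApartmentSystem M X A) {t : Finset V}
    (ht : t ∈ X.faces) (hcard : t.card < Fintype.card B) (h1 : f 1 ∈ t) :
    ∃ s ∈ X₆₃.faces, 1 ∈ s ∧ s.image f = t := by
  obtain ⟨φ, hφ⟩ := hf.exists_hom hX
  rcases hf.cover t ht with ⟨s, hs, rfl⟩ | ⟨i, g, rfl⟩
  · obtain ⟨a, ha, ha1⟩ := Finset.mem_image.1 h1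
    -- The map `f` need not be injective, but `a` acts trivially on the image, so translation by
    -- `a⁻¹` brings the face to `1` without changing its image.
    have hφa : φ a = 1 := by
      apply hX.eq_one_of_smul_eq (x := f 1)
      rw [hφ, mul_one, ha1]
    have hfa : ∀ x, f (a⁻¹ * x) = f x := by
      intro x
      rw [← hφ, map_inv, hφa, inv_one, one_smul]
    refine ⟨translateFace a⁻¹ s, translateFace_mem_faces_X₆₃ _ hs, ?_, ?_⟩
    · rw [translateFace_eq_image]
      exact Finset.mem_image.2 ⟨a, ha, by simp⟩
    · rw [translateFace_eq_image, Finset.image_image]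
      refine Finset.image_congr fun x _ => ?_
      exact hfa x
  · rw [translateFace, Finset.card_map, hA.card_chamber (hf.chamber i)] at hcard
    exact absurd hcard (lt_irrefl _)

/-- An edge is too small to be a missing chamber, so the link of `f 1` acquires no new vertices. -/
lemma IsExtension.exists_nb (hf : IsExtension (Γ := Γ₆₃) (Γ' := Γ) X₆₃ X f C)
    (hX : IsFreeCofiniteAction X Γ) (hA : IsApartmentSystem M X A) (hB : 3 ≤ Fintype.card B)
    {a : V} (ha : a ≠ f 1) (h : ({f 1, a} : Finset V) ∈ X.faces) : ∃ z, a = f (nb z) := by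
  obtain ⟨s, hs, h1, hst⟩ := hf.exists_lift hX hA h
    (lt_of_le_of_lt Finset.card_le_two (by omega)) (by simp)
  obtain ⟨z, w, hzw, hsub⟩ := (mem_faces_X₆₃_iff_of_mem h1).1 hs
  obtain ⟨x, hx, rfl⟩ := Finset.mem_image.1 (show a ∈ s.image f by rw [hst]; simp)
  have := hsub hx
  simp only [Finset.mem_insert, Finset.mem_singleton, one_mul] at this
  rcases this with rfl | rfl | rfl
  exacts [absurd rfl ha, ⟨z, rfl⟩, ⟨w, rfl⟩]

/-- In rank at least four triangles are not chambers either, so they lift as well. -/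
lemma IsExtension.G₆Adj_of_mem (hf : IsExtension (Γ := Γ₆₃) (Γ' := Γ) X₆₃ X f C)
    (hX : IsFreeCofiniteAction X Γ) (hA : IsApartmentSystem M X A) (hB : 4 ≤ Fintype.card B)
    {z w : FanoVertex} (hzw : z ≠ w)
    (h : ({f 1, f (nb z), f (nb w)} : Finset V) ∈ X.faces) : G₆Adj z w = true := by
  obtain ⟨s, hs, h1, hst⟩ := hf.exists_lift hX hA h
    (lt_of_le_of_lt Finset.card_le_three (by omega)) (by simp)
  obtain ⟨a, b, hab, hsub⟩ := (mem_faces_X₆₃_iff_of_mem h1).1 hs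
  have key : ∀ z, f (nb z) ∈ s.image f → z = a ∨ z = b := by
    intro z hz
    obtain ⟨x, hx, hxz⟩ := Finset.mem_image.1 hz
    have := hsub hx
    simp only [Finset.mem_insert, Finset.mem_singleton, one_mul] at this
    rcases this with rfl | rfl | rfl
    · exact absurd hxz (hf.map_ne (nb_ne_one z).symm (by simpa using edge_mem_faces 1 z))
    · exact Or.inl (hf.map_nb_injective hxz).symm
    · exact Or.inr (hf.map_nb_injective hxz).symm
  rcases key z (by rw [hst]; simp) with rfl | rfl <;>
    rcases key w (by rw [hst]; simp) with rfl | rfl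
  · exact absurd rfl hzw
  · exact hab
  · rwa [G₆Adj_comm]
  · exact absurd rfl hzw

lemma IsExtension.linkAdj_of_G₆Adj (hf : IsExtension (Γ := Γ₆₃) (Γ' := Γ) X₆₃ X f C)
    {z w : FanoVertex} (h : G₆Adj z w = true) :
    LinkAdj X.toPreAbstractSimplicialComplex (f 1) (f (nb z)) (f (nb w)) := by
  have hne : ∀ z, f (nb z) ≠ f 1 := fun z =>
    (hf.map_ne (nb_ne_one z).symm (by simpa using edge_mem_faces 1 z)).symm
  refine ⟨hne z, hne w, fun h' => G₆Adj_ne h (hf.map_nb_injective h'), ?_⟩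
  have := hf.simplicial _ (triangle_mem_faces h 1)
  simpa [Finset.image_insert] using this

/-- An extension of `X₆₃` has rank three. -/
lemma IsExtension.card_eq_three (hf : IsExtension (Γ := Γ₆₃) (Γ' := Γ) X₆₃ X f C)
    (hX : IsFreeCofiniteAction X Γ) (hA : IsApartmentSystem M X A) : Fintype.card B = 3 := by
  obtain ⟨w, hw⟩ := exists_G₆Adj (.inl 0)
  obtain ⟨h₁, h₂, h₃, hface⟩ := hf.linkAdj_of_G₆Adj hw
  have hcard : ({f 1, f (nb (.inl 0)), f (nb w)} : Finset V).card = 3 :=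
    Finset.card_eq_three.2 ⟨_, _, _, h₁.symm, h₂.symm, h₃, rfl⟩
  have hB : 3 ≤ Fintype.card B := hcard ▸ hA.card_le hface
  by_contra hne
  have hB4 : 4 ≤ Fintype.card B := by omega
  obtain ⟨t, ht, hsub, htcard⟩ := hA.exists_chamber hface
  -- The three vertices of `q` other than `f 1` would be pairwise adjacent in `G₆`, which is
  -- bipartite.
  obtain ⟨q, hq₁, hq₂, hq⟩ := Finset.exists_subsuperset_card_eq hsub (n := 4) (by omega) (by omega)
  have hqX : q ∈ X.faces := (X.isRelLowerSet_faces ht).2 hq₂ ⟨f 1, hq₁ (by simp)⟩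
  have h1q : f 1 ∈ q := hq₁ (by simp)
  have herase : (q.erase (f 1)).card = 3 := by rw [Finset.card_erase_of_mem h1q, hq]
  obtain ⟨a, b, c, hab, hac, hbc, heq⟩ := Finset.card_eq_three.1 herase
  have hmem : ∀ x ∈ ({a, b, c} : Finset V), x ≠ f 1 ∧ x ∈ q := fun x hx => by
    rw [← heq] at hx
    exact Finset.mem_erase.1 hx
  have hsubface : ∀ s : Finset V, f 1 ∈ s → s ⊆ q → s ∈ X.faces := fun s hs hsq =>
    (X.isRelLowerSet_faces hqX).2 hsq ⟨_, hs⟩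
  have hvertex : ∀ x ∈ ({a, b, c} : Finset V), ∃ z, x = f (nb z) := by
    intro x hx
    refine hf.exists_nb hX hA hB (hmem x hx).1 (hsubface _ (by simp) ?_)
    intro y hy
    simp only [Finset.mem_insert, Finset.mem_singleton] at hy
    rcases hy with rfl | rfl
    exacts [h1q, (hmem _ hx).2]
  have hadj : ∀ z w, f (nb z) ∈ ({a, b, c} : Finset V) → f (nb w) ∈ ({a, b, c} : Finset V) →
      f (nb z) ≠ f (nb w) → G₆Adj z w = true := by
    intro z w hz hw hzw
    refine hf.G₆Adj_of_mem hX hA hB4 (fun h => hzw (by rw [h])) (hsubface _ (by simp) ?_)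
    intro y hy
    simp only [Finset.mem_insert, Finset.mem_singleton] at hy
    rcases hy with rfl | rfl | rfl
    exacts [h1q, (hmem _ hz).2, (hmem _ hw).2]
  obtain ⟨z₁, rfl⟩ := hvertex a (by simp)
  obtain ⟨z₂, rfl⟩ := hvertex b (by simp)
  obtain ⟨z₃, rfl⟩ := hvertex c (by simp)
  exact G₆Adj_no_triangle (hadj z₁ z₂ (by simp) (by simp) hab)
    (hadj z₂ z₃ (by simp) (by simp) hbc) (hadj z₁ z₃ (by simp) (by simp) hac)

/-- The link of the image of `1`. -/
def extendedAdj (X : AbstractSimplicialComplex V) (f : Γ₆₃ → V) (z w : FanoVertex) : Prop :=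
  LinkAdj X.toPreAbstractSimplicialComplex (f 1) (f (nb z)) (f (nb w))

/-- The retractions of the link of `f 1` are pulled back to labels, which is possible because every
vertex of this link has a unique label. -/
lemma IsExtension.exists_isPolygonal (hf : IsExtension (Γ := Γ₆₃) (Γ' := Γ) X₆₃ X f C)
    (hX : IsFreeCofiniteAction X Γ) (hA : IsApartmentSystem M X A) :
    ∃ m, 2 ≤ m ∧ IsPolygonal m (extendedAdj X f) := by
  have hB := hf.card_eq_three hX hA
  have hnb : ∀ {a : V}, a ≠ f 1 → ({f 1, a} : Finset V) ∈ X.faces → ∃ z, a = f (nb z) :=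
    hf.exists_nb hX hA hB.ge
  have hnb' : ∀ {a b : V}, LinkAdj X.toPreAbstractSimplicialComplex (f 1) a b →
      ∃ z, f (nb z) = a := by
    intro a b h
    obtain ⟨z, hz⟩ := hnb h.1 ((X.isRelLowerSet_faces h.2.2.2).2 (by
      intro y
      simp only [Finset.mem_insert, Finset.mem_singleton]
      tauto) (by simp))
    exact ⟨z, hz.symm⟩
  obtain ⟨w₀, hw₀⟩ := exists_G₆Adj (.inl 0)
  obtain ⟨m, hm, hpos⟩ := hA.exists_linkPosition hB (v := f 1)
    ((Set.finite_range fun z => f (nb z)).subset (by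
      rintro a ⟨ha, h⟩
      obtain ⟨z, rfl⟩ := hnb ha h
      exact ⟨z, rfl⟩)) ⟨_, _, hf.linkAdj_of_G₆Adj hw₀⟩
  refine ⟨m, hm, fun x y hxy => ?_⟩
  obtain ⟨pos, h0, h1, hadj, he⟩ := hpos _ _ hxy
  refine ⟨fun z => pos (f (nb z)), h0, h1, fun z w h => hadj _ _ h, fun z => ?_⟩
  obtain ⟨w, hw⟩ := exists_G₆Adj z
  obtain ⟨e, e0, e1, hL, heq, t, ht, hpt⟩ := he (f (nb z)) ⟨_, hf.linkAdj_of_G₆Adj hw⟩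
  choose e' he' using fun t => hnb' (hL t)
  refine ⟨e', hf.map_nb_injective ((he' 0).trans e0), hf.map_nb_injective ((he' 1).trans e1),
    ?_, ?_, t, hf.map_nb_injective ((he' t).trans ht), hpt⟩
  · intro t
    rw [extendedAdj, he', he']
    exact hL t
  · intro s t
    rw [← heq, ← he', ← he', hf.map_nb_injective.eq_iff]

end Extension

end

end ChambersMissing

/-! ### Rotations of missing triangles and the contradiction -/

namespace ChambersMissing

lemma removedAdj_inl_three : removedAdj (.inl 3) (nbInv (.inl 3)) = true := by decide +kernel

/-- The removed edges are pairwise disjoint. -/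
lemma eq_of_removedAdj : ∀ u, removedAdj u (nbInv (.inl 3)) = true → u = .inl 3 := by
  decide +kernel

lemma G₆Adj_remainingHexagon :
    ∀ i, G₆Adj (remainingHexagon i) (remainingHexagon (i + 1)) = true := by
  decide +kernel

lemma remainingHexagon_injective : Function.Injective remainingHexagon := by
  decide +kernel

noncomputable section

open scoped Classical

section Rotation

variable {V : Type u} {Γ : Type v} [Group Γ] [MulAction Γ V]
variable {X : AbstractSimplicialComplex V} {f : Γ₆₃ → V} {n : ℕ} {C : Fin n → Finset V}
variable {B : Type} [Fintype B] {M : CoxeterMatrix B} {A : Set (PreAbstractSimplicialComplex V)}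
variable {φ : Γ₆₃ →* Γ}

lemma IsExtension.hom_nb_injective (hf : IsExtension (Γ := Γ₆₃) (Γ' := Γ) X₆₃ X f C)
    (hφ : ∀ g x, φ g • f x = f (g * x)) : Function.Injective fun z => φ (nb z) := by
  intro z w h
  refine hf.map_nb_injective ?_
  have h' : φ (nb z) • f 1 = φ (nb w) • f 1 := congrArg (· • f 1) h
  rwa [hφ, hφ, mul_one, mul_one] at h'

/-- The corners of a triangle correspond to each other under a map of order three. -/
lemma IsExtension.exists_rotation (hf : IsExtension (Γ := Γ₆₃) (Γ' := Γ) X₆₃ X f C)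
    (hX : IsFreeCofiniteAction X Γ) (hA : IsApartmentSystem M X A)
    (hφ : ∀ g x, φ g • f x = f (g * x)) {z w : FanoVertex} (h : extendedAdj X f z w) :
    ∃ u, φ (nb z) * φ (nb u) = φ (nb w) ∧ extendedAdj X f u (nbInv z) := by
  obtain ⟨hz, hw, hzw, hface⟩ := h
  have hinj : Function.Injective fun v : V => φ (nb z)⁻¹ • v := MulAction.injective _
  -- The triangle is translated so that its corner at `f (nb z)` comes to `f 1`.
  have hface' := hX.triple_mem (φ (nb z)⁻¹) hface
  rw [hφ, hφ, hφ, mul_one, inv_mul_cancel] at hface'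
  have h₁ : f ((nb z)⁻¹ * nb w) ≠ f 1 := by
    intro h
    refine hzw (hinj ?_)
    simp only [hφ, inv_mul_cancel, h]
  have h₂ : f ((nb z)⁻¹ * nb w) ≠ f (nb z)⁻¹ := by
    intro h
    refine hw (hinj ?_)
    simp only [hφ, mul_one, h]
  have h₃ : f (nb z)⁻¹ ≠ f 1 := by
    intro h
    refine hz (hinj ?_).symm
    simp only [hφ, mul_one, inv_mul_cancel, h]
  obtain ⟨u, hu⟩ := hf.exists_nb hX hA (hf.card_eq_three hX hA).ge h₁
    ((X.isRelLowerSet_faces hface').2 (by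
      intro y
      simp only [Finset.mem_insert, Finset.mem_singleton]
      tauto) (by simp))
  refine ⟨u, ?_, ?_⟩
  · apply hX.eq_of_smul_eq (x := f 1)
    rw [mul_smul, hφ, mul_one, ← hu, hφ, hφ, mul_inv_cancel_left, mul_one]
  · rw [extendedAdj, nb_nbInv, ← hu]
    refine ⟨h₁, h₃, h₂, (X.isRelLowerSet_faces hface').2 ?_ (by simp)⟩
    intro y
    simp only [Finset.mem_insert, Finset.mem_singleton]
    tauto

/-- If one corner of a triangle comes from `X₆₃`, so does the whole triangle: translated back, it
shows its corner at `1`. Hence rotation preserves the set of missing corners. -/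
lemma IsExtension.G₆Adj_of_rotation (hf : IsExtension (Γ := Γ₆₃) (Γ' := Γ) X₆₃ X f C)
    (hφ : ∀ g x, φ g • f x = f (g * x)) {z w u : FanoVertex}
    (h : φ (nb z) * φ (nb u) = φ (nb w)) (hu : G₆Adj u (nbInv z) = true) :
    G₆Adj z w = true := by
  have hface := translateFace_mem_faces_X₆₃ (nb z) (triangle_mem_faces hu 1)
  rw [translateFace_eq_image, nb_nbInv] at hface
  simp only [Finset.image_insert, Finset.image_singleton, smul_eq_mul, one_mul, mul_one,
    mul_inv_cancel] at hface
  have hne : nb z * nb u ≠ 1 := by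
    rw [Ne, mul_eq_one_iff_eq_inv, ← nb_nbInv, nb_injective.eq_iff]
    intro h'
    rw [h', nbInv_nbInv, G₆Adj_comm] at hu
    exact G₆Adj_ne hu rfl
  obtain ⟨w', hw'⟩ := (pair_mem_faces_iff hne).1 ((X₆₃.isRelLowerSet_faces hface).2
    (show {1, nb z * nb u} ⊆ ({nb z, nb z * nb u, 1} : Finset Γ₆₃) by
      intro y
      simp only [Finset.mem_insert, Finset.mem_singleton]
      tauto) (by simp))
  rw [one_mul] at hw'
  -- Only injectivity of `φ` on the neighbours of `1` is available, and it suffices.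
  obtain rfl : w' = w := hf.hom_nb_injective hφ (by simp only [← hw', map_mul, h])
  rw [hw'] at hface
  have hface' : ({1, 1 * nb z, 1 * nb w'} : Finset Γ₆₃) ∈ X₆₃.faces := by
    rw [one_mul, one_mul]
    convert hface using 1
    ext y
    simp only [Finset.mem_insert, Finset.mem_singleton]
    tauto
  rcases (triple_mem_faces_iff 1 z w').1 hface' with rfl | h'
  · rw [← hw', mul_eq_left] at hw'
    exact absurd hw' (nb_ne_one u)
  · exact h'

/-- With `a = φ (nb z)` the triangle has vertices `f 1`, `a • f 1` and `a⁻¹ • f 1`. If `a ^ 2 =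
a⁻¹`, then `a` rotates it and fixes its centre. -/
lemma IsFreeCofiniteAction.not_fixed (hX : IsFreeCofiniteAction X Γ)
    (hφ : ∀ g x, φ g • f x = f (g * x)) {z : FanoVertex}
    (hL : extendedAdj X f z (nbInv z)) (h : φ (nb z) * φ (nb z) = φ (nb (nbInv z))) : False := by
  have h1 : φ (nb z) = 1 := by
    refine hX.eq_one_of_rotation hL.2.2.2 ?_ ?_ ?_
    · rw [hφ, mul_one]
    · have : (φ (nb z) * φ (nb z)) • f 1 = f (nb (nbInv z)) := by rw [h, hφ, mul_one]
      rwa [mul_smul, hφ, mul_one] at this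
    · rw [hφ, nb_nbInv, mul_inv_cancel]
  refine hL.1 ?_
  rw [← mul_one (nb z), ← hφ, h1, one_smul]

/-- The missing triangles cannot be permuted freely by their rotations. -/
lemma IsExtension.not_isPolygonal_two (hf : IsExtension (Γ := Γ₆₃) (Γ' := Γ) X₆₃ X f C)
    (hX : IsFreeCofiniteAction X Γ) (hA : IsApartmentSystem M X A)
    (hφ : ∀ g x, φ g • f x = f (g * x)) : ¬ IsPolygonal 2 (extendedAdj X f) := by
  intro h
  have hsymm : ∀ x y, extendedAdj X f x y → extendedAdj X f y x := fun _ _ => LinkAdj.symm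
  have hG : ∀ z w, G₆Adj z w = true → extendedAdj X f z w := fun _ _ => hf.linkAdj_of_G₆Adj
  have hL : ∀ p l, extendedAdj X f (.inl p) (.inr l) := fun p l =>
    h.adj_of_side_ne hsymm hG (by simp [side])
  have hT : ∀ q : MissingPair, ∃ q' : MissingPair,
      φ (nb (.inl q.1.1)) * φ (nb (.inl q'.1.1)) = φ (nb (.inr q.1.2)) ∧
        .inr q'.1.2 = nbInv (.inl q.1.1) := by
    intro q
    obtain ⟨u, hu, hLu⟩ := hf.exists_rotation hX hA hφ (hL q.1.1 q.1.2)
    rcases side_eq_cases (h.side_ne hG hLu) with ⟨p, l, rfl, hl⟩ | ⟨p, l, rfl, hl⟩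
    · refine ⟨⟨(p, l), ?_⟩, hu, hl.symm⟩
      rw [Bool.eq_false_iff]
      intro hpl
      have := hf.G₆Adj_of_rotation hφ hu (hl ▸ hpl)
      rw [q.2] at this
      exact Bool.false_ne_true this
    · simp [nbInv] at hl
  choose T h₁ h₂ using hT
  -- If `a`, `b`, `c`, `d` are the images of the successive points, then `b * c = a⁻¹` and `c * d =
  -- b⁻¹`, whence `d = a`.
  have hcube : ∀ q, T (T (T q)) = q := by
    intro q
    have e₁ := h₁ q
    have e₂ := h₁ (T q)
    have e₃ := h₁ (T (T q))
    rw [h₂, nb_nbInv, map_inv] at e₂ e₃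
    have e₄ : φ (nb (.inl (T (T q)).1.1)) =
        (φ (nb (.inl (T q).1.1)))⁻¹ * (φ (nb (.inl q.1.1)))⁻¹ := by
      rw [← e₂, inv_mul_cancel_left]
    refine Subtype.ext (Prod.ext (Sum.inl_injective (β := ZMod 7) ?_)
      (Sum.inr_injective (α := ZMod 7) ?_))
    · refine hf.hom_nb_injective hφ ?_
      have e₅ := eq_inv_mul_of_mul_eq e₃
      simp only [e₅, e₄]
      group
    · refine hf.hom_nb_injective hφ ?_
      simp only
      rw [h₂, nb_nbInv, map_inv, ← e₁, e₄, mul_inv_rev, inv_inv, inv_inv]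
  -- The number of fixed points is congruent to `31` modulo three, hence not zero.
  have hcard := Equiv.Perm.card_fixedPoints_modEq (f := (T : Function.End MissingPair)) (p := 3)
    (n := 1) (funext hcube)
  obtain ⟨q, hq⟩ : (Function.fixedPoints T).Nonempty := by
    by_contra hne
    rw [Set.not_nonempty_iff_eq_empty] at hne
    have h0 : Fintype.card (Function.fixedPoints T) = 0 := by
      rw [Fintype.card_eq_zero_iff, hne]
      infer_instance
    rw [show Fintype.card (Function.fixedPoints (T : Function.End MissingPair)) = 0 from h0,
      card_missingPair] at hcard
    exact absurd hcard (by decide)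
  have e₁ := h₁ q
  have e₂ := h₂ q
  rw [show T q = q from hq] at e₁ e₂
  refine hX.not_fixed hφ (z := .inl q.1.1) ?_ ?_
  · rw [← e₂]
    exact hL _ _
  · rw [← e₂]
    exact e₁

/-- The missing corner from `.inl 3` to its inverse rotates to a missing corner with the same line.
That corner is again a removed edge, so it is the same one and is fixed by the rotation. -/
lemma IsExtension.not_isPolygonal_three (hf : IsExtension (Γ := Γ₆₃) (Γ' := Γ) X₆₃ X f C)
    (hX : IsFreeCofiniteAction X Γ) (hA : IsApartmentSystem M X A)
    (hφ : ∀ g x, φ g • f x = f (g * x)) : ¬ IsPolygonal 3 (extendedAdj X f) := by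
  intro h
  have hsymm : ∀ x y, extendedAdj X f x y → extendedAdj X f y x := fun _ _ => LinkAdj.symm
  have hG : ∀ z w, G₆Adj z w = true → extendedAdj X f z w := fun _ _ => hf.linkAdj_of_G₆Adj
  have hL := h.adj_of_removedAdj hsymm hG removedAdj_inl_three
  obtain ⟨u, hu, hLu⟩ := hf.exists_rotation hX hA hφ hL
  rcases h.adj_imp hsymm hG hLu with h' | h'
  · have := hf.G₆Adj_of_rotation hφ hu h'
    rw [G₆Adj, removedAdj_inl_three] at this
    simp at this
  · rw [eq_of_removedAdj u h'] at hu
    exact hX.not_fixed hφ hL hu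

end Rotation

lemma not_isBuildingWithChambersMissing :
    ¬ IsBuildingWithChambersMissing.{u} X₆₃ Γ₆₃ := by
  rintro ⟨V, X, Γ, _, _, f, n, C, ⟨B, _, M, A, hA⟩, hX, hf⟩
  cases nonempty_fintype B
  obtain ⟨φ, hφ⟩ := hf.exists_hom hX
  obtain ⟨m, hm, h⟩ := hf.exists_isPolygonal hX hA
  rcases h.eq_two_or_three (fun _ _ => LinkAdj.symm) hm remainingHexagon_injective
    (fun i => hf.linkAdj_of_G₆Adj (G₆Adj_remainingHexagon i)) with rfl | rfl
  · exact hf.not_isPolygonal_two hX hA hφ h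
  · exact hf.not_isPolygonal_three hX hA hφ h

end

end ChambersMissing

theorem mainTheorem9 :
    -- `Γ₆₃` is countable and acts freely, cocompactly, and transitively on the vertices of `X₆₃`
    Countable Γ₆₃ ∧ IsFreeCofiniteAction X₆₃ Γ₆₃ ∧ MulAction.IsPretransitive Γ₆₃ Γ₆₃ ∧
    -- `X₆₃` is a simply connected complex of pure dimension two without boundary
    IsSimplyConnectedComplex X₆₃ ∧ IsPureOfDim X₆₃ 2 ∧ HasNoBoundary X₆₃ 2 ∧
    -- all links are isomorphic to `G₆`, and are spherical buildings with chambers missing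
    (∀ x : Γ₆₃, SimplicialIso (link X₆₃ x) G₆ ∧
      IsSphericalBuildingWithChambersMissing (link X₆₃ x)) ∧
    IsPureOfDim G₆ 1 ∧ HasNoBoundary G₆ 1 ∧ IsA₂BuildingWithChambersMissing G₆ 2 3 ∧
    -- the extension invariant
    (extensionInvariant X₆₃ Γ₆₃).Iso threeDigons ∧
    -- `(X₆₃, Γ₆₃)` is not a building with chambers missing
    ¬ IsBuildingWithChambersMissing.{u} X₆₃ Γ₆₃ := by
  exact ⟨countable_Γ₆₃, isFreeCofiniteAction_X₆₃, inferInstance, isSimplyConnectedComplex_X₆₃,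
    isPureOfDim_X₆₃, hasNoBoundary_X₆₃,
    fun x => ⟨⟨(linkEquiv x).symm, simplicialIso_link x⟩,
      isSphericalBuildingWithChambersMissing_link x⟩,
    isPureOfDim_G₆, hasNoBoundary_G₆, isA₂BuildingWithChambersMissing_G₆,
    extensionInvariant_iso, not_isBuildingWithChambersMissing⟩
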